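/- Let $\Bbbk$ be a field of characteristic $0$ and $d\in\mathbb Z$. Graded quivers are small and $\mathbb Z$-graded over $\Bbbk$; a quiver $\mathcal A$ is $\operatorname{Hom}$-finite if all the spaces ${}_x\mathcal A_y$ are finite dimensional. Write $s$ for the shift $\mathcal A\to\mathcal A[1]$, $t$ for the shift $\mathcal A^*\to\mathcal A^*[d]$, ${}_x\mathcal A^*_y=({}_y\mathcal A_x)^*$ for the graded dual quiver. For a map $\Phi_0$ from the objects of $\mathcal A$ to those of $\mathcal B$, $\mathcal A\oplus\mathcal B^*[d-1]$ is the quiver with the objects of $\mathcal A$ and with morphisms ${}_x\mathcal A_y\oplus{}_{\Phi_0(x)}\mathcal B^*_{\Phi_0(y)}[d-1]$. For a morphism $\Phi:\mathcal A\to\mathcal B$ of graded quivers over $\Phi_0$, the $\Phi$-mixed bilinear form $\Gamma^\Phi$ on $\mathcal A\oplus\mathcal B^*[d-1]$ vanishes on pairs of elements of $\mathcal A$ and on pairs of elements of $\mathcal B^*$, and $\Gamma^\Phi(tf,sa)=-(-1)^{|sa||tf|}\Gamma^\Phi(sa,tf)=(-1)^{|tf|+1}f(\Phi(a))$; put $\Gamma^{\mathcal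 A}=\Gamma^{\mathrm{id}}$. All $A_\infty$-structures, $A_\infty$-morphisms and pre-Calabi-Yau structures have no component without inputs and with at most one output. A $d$-pre-Calabi-Yau structure on $\mathcal A$ is a collection of maps $M^{\bar x^1,\dots,\bar x^n}:\mathcal A[1]^{\otimes\bar x^1}\otimes\dots\otimes\mathcal A[1]^{\otimes\bar x^n}\to\bigotimes_{i=1}^{n}{}_{\operatorname{lt}(\bar x^i)}\mathcal A_{\operatorname{rt}(\bar x^{i+1})}[-d]$ (with $n\ge 1$, $\bar x^{n+1}=\bar x^1$, and $\operatorname{lt}$, $\operatorname{rt}$ the first and last object of a tuple), invariant under the cyclic groups $C_n$, of degree $d+2$ (so that $s_{d+1}M$ has degree $1$), with $s_{d+1}M\underset{\mathrm{nec}}{\circ}s_{d+1}M=0$ for the necklace product. Let $SpCY_d$ be the category whose objects are the $\operatorname{Hom}$-finite graded quivers with a $d$-pre-Calabi-Yau structure and whose morphisms are the strict $d$-pre-Calabi-Yau morphisms, that is, the degree $0$ morphisms of graded quivers $(\Phi_0,\Phi)$ with $(\Phi\otimes\dots\otimes\Phi)\circ M_{\mathcal A}=M_{\mathcal B}\circ(\Phi\otimes\dots\otimes\Phi)$.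 A partial category consists of objects, morphisms, and a relation that says which morphisms $f:X\to Y$, $g:Y\to Z$ are composable, with which $h:X\to Z$ as a composition. A functor of partial categories is a map on objects and morphisms such that, if $f,g$ are composable with composition $h$, then their images are composable with composition the image of $h$. The partial category $Scyc\widehat{A_\infty}_d$ has as objects the cyclic $A_\infty$-categories of the form $\mathcal A\oplus\mathcal A^*[d-1]$ (the $A_\infty$-structure is almost cyclic with respect to a given nondegenerate homogeneous bilinear form). A morphism from $\mathcal A\oplus\mathcal A^*[d-1]$ to $\mathcal B\oplus\mathcal B^*[d-1]$ consists of a map $\Phi_0$ between the sets of objects, an $A_\infty$-structure $sm_{\mathcal A\oplus\mathcal B^*}$ on $\mathcal A\oplus\mathcal B^*[d-1]$ that is almost cyclic with respect to a given homogeneous bilinear form, and strict cyclic $A_\infty$-morphisms $\varphi_{\mathcal A}:\mathcal A\oplus\mathcal B^*[d-1]\to\mathcal A\oplus\mathcal A^*[d-1]$ over the identity and $\varphi_{\mathcal B}:\mathcal A\oplus\mathcal B^*[d-1]\to\mathcal B\oplus\mathcal B^*[d-1]$ over $\Phi_0$. Morphisms $(sm_{\mathcal A\oplus\mathcal B^*},\varphi_{\mathcal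 A},\varphi_{\mathcal B})$ and $(sm_{\mathcal B\oplus\mathcal C^*},\psi_{\mathcal B},\psi_{\mathcal C})$ are composable with composition $(sm_{\mathcal A\oplus\mathcal C^*},\varphi_{\mathcal A}\circ\chi_{\mathcal A},\psi_{\mathcal C}\circ\chi_{\mathcal C})$ whenever this triple is a morphism and $\chi_{\mathcal A}:\mathcal A\oplus\mathcal C^*[d-1]\to\mathcal A\oplus\mathcal B^*[d-1]$ and $\chi_{\mathcal C}:\mathcal A\oplus\mathcal C^*[d-1]\to\mathcal B\oplus\mathcal C^*[d-1]$ are $A_\infty$-morphisms with $\varphi_{\mathcal B}\circ\chi_{\mathcal A}=\psi_{\mathcal B}\circ\chi_{\mathcal C}$. For a $d$-pre-Calabi-Yau category $(\mathcal A,s_{d+1}M_{\mathcal A})$ define $sm_{\mathcal A\oplus\mathcal A^*}$ as follows. For words $p_i$ in $\mathcal A[1]$ and $tf^i\in\mathcal A^*[d]$, its component in $\mathcal A[1]$ on $(p_n,tf^{n-1},p_{n-1},\dots,tf^1,p_1)$ is $(-1)^{\epsilon}$ times the contraction $f^1(o_1)\cdots f^{n-1}(o_{n-1})\,o_n$ of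 the outputs $o_1\otimes\dots\otimes o_n$ of $M_{\mathcal A}(p_1,\dots,p_n)$, where $$\epsilon=\sum_{i=1}^{n-1}|tf^i|\sum_{j>i}|p_j|+\sum_{i<j}|p_i||p_j|+d(n-1).$$ Its component in $\mathcal A^*[d]$ is zero on words in $\mathcal A[1]$ and is otherwise determined by cyclicity with respect to $\Gamma^{\mathcal A}$: $\Gamma^{\mathcal A}(sm(l,tf,r),sb)=(-1)^{(|r|+|sb|)(|l|+|tf|)}\Gamma^{\mathcal A}(sm(r,sb,l),tf)$ for $b\in\mathcal A$. **Theorem.** There is a functor of partial categories $SpCY_d\to Scyc\widehat{A_\infty}_d$ which sends $(\mathcal A,s_{d+1}M_{\mathcal A})$ to the cyclic $A_\infty$-category $(\mathcal A\oplus\mathcal A^*[d-1],sm_{\mathcal A\oplus\mathcal A^*})$ with the form $\Gamma^{\mathcal A}$, and a strict morphism $(\Phi_0,\Phi):\mathcal A\to\mathcal B$ to the $A_\infty$-structure $sm_{\mathcal A\oplus\mathcal B^*}$ on $\mathcal A\oplus\mathcal B^*[d-1]$, almost cyclic with respect to $\Gamma^\Phi$, whose component in $\mathcal A$ is that of $sm_{\mathcal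 A\oplus\mathcal A^*}$ precomposed with $\mathrm{id}\oplus\Phi^*$ on each argument and whose component in $\mathcal B^*$ is that of $sm_{\mathcal B\oplus\mathcal B^*}$ precomposed with $\Phi\oplus\mathrm{id}$ on each argument, together with the strict cyclic $A_\infty$-morphisms $\varphi_{\mathcal A}$, $\varphi_{\mathcal B}$ with $\varphi_{\mathcal A}(a)=a$, $\varphi_{\mathcal A}(f)=f\circ\Phi$, $\varphi_{\mathcal B}(a)=\Phi(a)$, $\varphi_{\mathcal B}(f)=f$. In particular these data are objects and morphisms of $Scyc\widehat{A_\infty}_d$. -/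

import Mathlib

open scoped DirectSum TensorProduct
open CategoryTheory

universe w u v₁ v₂ w₁ w₂

noncomputable section

namespace PreCY

/-! ## Words -/

/-- Composable words `a₁ a₂ … aₙ`, `aᵢ ∈ L xᵢ xᵢ₊₁`, in a family of letters `L`. The empty word at
an object is allowed. -/
inductive Word {O : Type w} (L : O → O → Type u) : O → O → Type (max w u)
  | nil (x : O) : Word L x x
  | cons {x y z : O} (a : L x y) (p : Word L y z) : Word L x z

namespace Word

variable {O : Type w} {L : O → O → Type u}

/-- Concatenation. -/
def append {x y z : O} : Word L x y → Word L y z → Word L x z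
  | nil _, q => q
  | cons a p, q => cons a (append p q)

/-- The word with one letter. -/
def single {x y : O} (a : L x y) : Word L x y := cons a (nil y)

def length {x y : O} : Word L x y → ℕ
  | nil _ => 0
  | cons _ p => p.length + 1

/-- The sum over the letters of an integer-valued function of a letter. -/
def weight (f : ∀ {x y : O}, L x y → ℤ) {x y : O} : Word L x y → ℤ
  | nil _ => 0
  | cons a p => f a + p.weight f

/-- All the ways to write a word as `u · q`. -/
def splits {x y : O} : Word L x y → List (Σ z : O, Word L x z × Word L z y)
  | nil x => [⟨x, nil x, nil x⟩]
  | cons a p => ⟨x, nil x, cons a p⟩ :: p.splits.map fun s => ⟨s.1, cons a s.2.1, s.2.2⟩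

/-- A decomposition `u · v · q` of a word from `x` to `y`. -/
structure Split3 (L : O → O → Type u) (x y : O) where
  {z t : O}
  u : Word L x z
  v : Word L z t
  q : Word L t y

/-- All the ways to write a word as `u · v · q`. -/
def splits3 {x y : O} (p : Word L x y) : List (Split3 L x y) :=
  p.splits.flatMap fun s => s.2.2.splits.map fun r => ⟨s.2.1, r.2.1, r.2.2⟩

/-- Letterwise image of a word. -/
def map {O' : Type w₁} {L' : O' → O' → Type u} (g : O → O')
    (φ : ∀ {x y : O}, L x y → L' (g x) (g y)) {x y : O} : Word L x y → Word L' (g x) (g y)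
  | nil x => nil (g x)
  | cons a p => cons (φ a) (p.map g φ)

theorem map_id (φ : ∀ {x y : O}, L x y → L x y) (hφ : ∀ {x y : O} (a : L x y), φ a = a) {x y : O}
    (p : Word L x y) : p.map (fun x => x) φ = p := by
  induction p with
  | nil x => rfl
  | cons a p ih => simp only [map, hφ, ih]

theorem map_map {O' : Type w₁} {L' : O' → O' → Type u} {O'' : Type w₂} {L'' : O'' → O'' → Type u}
    (g : O → O') (φ : ∀ {x y : O}, L x y → L' (g x) (g y))
    (h : O' → O'') (ψ : ∀ {x y : O'}, L' x y → L'' (h x) (h y)) {x y : O} (p : Word L x y) :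
    (p.map g φ).map h ψ = p.map (fun x => h (g x)) (fun a => ψ (φ a)) := by
  induction p with
  | nil x => rfl
  | cons a p ih => simp only [map, ih]

end Word

/-! ## Graded quivers -/

/-- A small `ℤ`-graded quiver over `k`: `hom x y j` is the degree `j` part of the space of
morphisms that start at `x` and end at `y`. -/
structure GradedQuiver (k : Type u) [Field k] where
  Obj : Type w
  hom : Obj → Obj → ℤ → Type u
  [grp : ∀ x y j, AddCommGroup (hom x y j)]
  [mod : ∀ x y j, Module k (hom x y j)]

attribute [instance] GradedQuiver.grp GradedQuiver.mod

variable {k : Type u} [Field k]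

namespace GradedQuiver

/-- The total space of morphisms from `x` to `y`. -/
abbrev Tot (A : GradedQuiver.{w} k) (x y : A.Obj) : Type u := ⨁ j : ℤ, A.hom x y j

/-- Homogeneous elements, together with their degree. -/
abbrev Letter (A : GradedQuiver.{w} k) (x y : A.Obj) : Type u := Σ j : ℤ, A.hom x y j

/-- The inclusion of the degree `j` part. -/
def incl (A : GradedQuiver.{w} k) {x y : A.Obj} (j : ℤ) : A.hom x y j →ₗ[k] A.Tot x y :=
  DirectSum.lof k ℤ (fun j => A.hom x y j) j

/-- The degree `j` component. -/
def comp (A : GradedQuiver.{w} k) {x y : A.Obj} (j : ℤ) : A.Tot x y →ₗ[k] A.hom x y j :=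
  DirectSum.component k ℤ (fun j => A.hom x y j) j

/-- The homogeneous element of degree `j` given by the degree `j` component. -/
def letter (A : GradedQuiver.{w} k) {x y : A.Obj} (j : ℤ) (t : A.Tot x y) : A.Letter x y :=
  ⟨j, A.comp j t⟩

/-- The degree of a word in `A[1]`. -/
def wdeg (A : GradedQuiver.{w} k) {x y : A.Obj} (p : Word A.Letter x y) : ℤ :=
  p.weight fun a => a.1 - 1

/-- Every space of morphisms is finite dimensional. -/
def HomFinite (A : GradedQuiver.{w} k) : Prop := ∀ x y : A.Obj, Module.Finite k (A.Tot x y)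

/-- The degree `j` part of the space of morphisms from `x` to `y` of `A^*[d-1]`: linear forms
on the part of degree `-(j + d - 1)` of the space of morphisms from `y` to `x`. -/
abbrev dualHom (A : GradedQuiver.{w} k) (d : ℤ) (x y : A.Obj) (j : ℤ) : Type u :=
  Module.Dual k (A.hom y x (-(j + d - 1)))

/-- Homogeneous elements of `A^*[d-1]`. -/
abbrev DLetter (A : GradedQuiver.{w} k) (d : ℤ) (x y : A.Obj) : Type u :=
  Σ j : ℤ, A.dualHom d x y j

/-- A homogeneous element of `A^*[d-1]` as a linear form on the total space. -/
def ev (A : GradedQuiver.{w} k) {d : ℤ} {x y : A.Obj} (f : A.DLetter d x y) :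
    A.Tot y x →ₗ[k] k :=
  f.2 ∘ₗ A.comp (-(f.1 + d - 1))

/-- The quiver `A ⊕ B^*[d-1]` attached to a map `g` from the objects of `A` to those of `B`. -/
abbrev mix (A B : GradedQuiver.{w} k) (g : A.Obj → B.Obj) (d : ℤ) : GradedQuiver.{w} k where
  Obj := A.Obj
  hom x y j := A.hom x y j × B.dualHom d (g x) (g y) j

/-- The quiver `A ⊕ A^*[d-1]`. -/
abbrev bdry (A : GradedQuiver.{w} k) (d : ℤ) : GradedQuiver.{w} k := mix A A (fun x => x) d

end GradedQuiver

open GradedQuiver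

/-! ## A∞-structures and bilinear forms -/

/-- A family of operations on words, `(a₁, …, aₙ) ↦ m (a₁, …, aₙ)`, for all `n`. -/
abbrev Op (Q : GradedQuiver.{w} k) : Type (max w u) :=
  ∀ x y : Q.Obj, Word Q.Letter x y → Q.Tot x y

/-- `m` is an (uncurved) `A∞`-structure. The element `m (a₁, …, aₙ)` is `sm (sa₁, …, saₙ)` without
its shift, so it has degree `|sa₁| + … + |saₙ| + 2`. -/
structure IsAInf {Q : GradedQuiver.{w} k} (m : Op Q) : Prop where
  uncurved : ∀ x, m x x (.nil x) = 0
  degree : ∀ {x y} (p : Word Q.Letter x y) (j : ℤ), j ≠ Q.wdeg p + 2 → Q.comp j (m x y p) = 0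
  linear : ∀ {x y z t} (p : Word Q.Letter x y) (q : Word Q.Letter z t) (j : ℤ),
    IsLinearMap k fun a : Q.hom y z j => m x t (p.append (.cons ⟨j, a⟩ q))
  stasheff : ∀ {x y} (p : Word Q.Letter x y),
    (p.splits3.map fun s => (Q.wdeg s.u).negOnePow •
      m x y (s.u.append (.cons (Q.letter (Q.wdeg s.v + 2) (m _ _ s.v)) s.q))).sum = 0

/-- A homogeneous bilinear form on a graded quiver: `val x y (a, b)` is `Γ (sa, sb)`. A form of
degree `deg` pairs degrees `i`, `j` to zero unless `i + j + deg = 0`, that is, as a map on the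
shifted quiver it has degree `deg + 2`. -/
structure Form (Q : GradedQuiver.{w} k) where
  deg : ℤ
  val : ∀ x y : Q.Obj, Q.Tot x y →ₗ[k] Q.Tot y x →ₗ[k] k
  homogeneous : ∀ {x y} (i j : ℤ) (a : Q.hom x y i) (b : Q.hom y x j), i + j + deg ≠ 0 →
    val x y (Q.incl i a) (Q.incl j b) = 0

/-- The map to the graded dual induced by the form is an isomorphism. -/
def Form.Nondegenerate {Q : GradedQuiver.{w} k} (Γ : Form Q) : Prop :=
  ∀ (x y : Q.Obj) (i j : ℤ), i + j + Γ.deg = 0 →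
    Function.Bijective ((Γ.val x y).compl₁₂ (Q.incl i) (Q.incl j) :
      Q.hom x y i → Module.Dual k (Q.hom y x j))

/-- `Γ(sm(sa₁,…,saₙ₋₁), saₙ) = (-1)^{|saₙ|(|sa₁|+…+|saₙ₋₁|)} Γ(sm(saₙ,sa₁,…,saₙ₋₂), saₙ₋₁)`, with
`p = a₁…aₙ₋₂`, `b = aₙ₋₁`, `c = aₙ`. -/
def AlmostCyclic {Q : GradedQuiver.{w} k} (m : Op Q) (Γ : Form Q) : Prop :=
  ∀ {x y z : Q.Obj} (p : Word Q.Letter x y) (b : Q.Letter y z) (c : Q.Letter z x),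
    Γ.val x z (m x z (p.append (.single b))) (Q.incl c.1 c.2) =
      ((c.1 - 1) * (Q.wdeg p + (b.1 - 1))).negOnePow •
        Γ.val z y (m z y (.cons c p)) (Q.incl b.1 b.2)

/-! ## A∞-morphisms -/

/-- A family of operations on words with values in another quiver. -/
abbrev MorOp (Q R : GradedQuiver.{w} k) (F₀ : Q.Obj → R.Obj) : Type (max w u) :=
  ∀ x y : Q.Obj, Word Q.Letter x y → R.Tot (F₀ x) (F₀ y)

section Morphisms

variable {Q R S : GradedQuiver.{w} k} {F₀ : Q.Obj → R.Obj} {G₀ : R.Obj → S.Obj}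

/-- `F` of a word as a homogeneous element (`F` has degree `0` on the shifted quivers). -/
def MorOp.letter (F : MorOp Q R F₀) {x y : Q.Obj} (p : Word Q.Letter x y) :
    R.Letter (F₀ x) (F₀ y) :=
  R.letter (Q.wdeg p + 1) (F x y p)

/-- Auxiliary for `MorOp.bar`: `r` is the (nonempty) first piece, still to be extended. -/
def MorOp.barAux (F : MorOp Q R F₀) {x y z : Q.Obj} (r : Word Q.Letter x y) :
    Word Q.Letter y z → List (Word R.Letter (F₀ x) (F₀ z))
  | .nil _ => [.single (F.letter r)]
  | .cons a p => F.barAux (r.append (.single a)) p ++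
      (F.barAux (.single a) p).map (.cons (F.letter r))

/-- The words `F(p₁) F(p₂) … F(pₘ)`, for all decompositions `p = p₁ p₂ … pₘ` of `p` into nonempty
words. -/
def MorOp.bar (F : MorOp Q R F₀) {x y : Q.Obj} :
    Word Q.Letter x y → List (Word R.Letter (F₀ x) (F₀ y))
  | .nil x => [.nil (F₀ x)]
  | .cons a p => F.barAux (.single a) p

/-- Composition of `A∞`-morphisms. -/
def MorOp.comp (F : MorOp Q R F₀) (G : MorOp R S G₀) : MorOp Q S (fun x => G₀ (F₀ x)) :=
  fun _ _ p => ((F.bar p).map (G _ _)).sum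

/-- Transport along an equality of maps between the sets of objects. -/
def MorOp.castObj {F₀' : Q.Obj → R.Obj} (e : F₀ = F₀') (F : MorOp Q R F₀) : MorOp Q R F₀' :=
  e ▸ F

/-- `F` is an `A∞`-morphism from `(Q, m)` to `(R, n)`. -/
structure IsAInfMor (m : Op Q) (n : Op R) (F : MorOp Q R F₀) : Prop where
  uncurved : ∀ x, F x x (.nil x) = 0
  degree : ∀ {x y} (p : Word Q.Letter x y) (j : ℤ), j ≠ Q.wdeg p + 1 → R.comp j (F x y p) = 0
  linear : ∀ {x y z t} (p : Word Q.Letter x y) (q : Word Q.Letter z t) (j : ℤ),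
    IsLinearMap k fun a : Q.hom y z j => F x t (p.append (.cons ⟨j, a⟩ q))
  morphism : ∀ {x y} (p : Word Q.Letter x y),
    (p.splits3.map fun s => (Q.wdeg s.u).negOnePow •
      F x y (s.u.append (.cons (Q.letter (Q.wdeg s.v + 2) (m _ _ s.v)) s.q))).sum =
    ((F.bar p).map (n _ _)).sum

/-- A morphism is strict if only its component with one argument is nonzero. -/
def MorOp.IsStrict (F : MorOp Q R F₀) : Prop :=
  ∀ {x y} (p : Word Q.Letter x y), p.length ≠ 1 → F x y p = 0

/-- The strict family with given linear part. -/
def MorOp.ofLinear (φ : ∀ (x y : Q.Obj) (j : ℤ), Q.hom x y j →ₗ[k] R.hom (F₀ x) (F₀ y) j) :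
    MorOp Q R F₀
  | _, _, .cons a (.nil _) => R.incl a.1 (φ _ _ a.1 a.2)
  | _, _, _ => 0

/-- Cyclicity of an `A∞`-morphism with respect to bilinear forms. -/
structure MorOp.IsCyclic (F : MorOp Q R F₀) (γ : Form Q) (Γ : Form R) : Prop where
  pairing : ∀ {x y} (a : Q.Letter x y) (b : Q.Letter y x),
    Γ.val _ _ (F x y (.single a)) (F y x (.single b)) = γ.val x y (Q.incl a.1 a.2) (Q.incl b.1 b.2)
  higher : ∀ {x} (p : Word Q.Letter x x), 3 ≤ p.length →
    (p.splits.map fun s => Γ.val _ _ (F x s.1 s.2.1) (F s.1 x s.2.2)).sum = 0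

end Morphisms

/-! ## Multilinear maps with several inputs and several outputs -/

/-- The shape of a tuple of words `(p₁, …, pₙ)`, `n ≥ 1`, that is, the end points of the words,
listed from the last word to the first. `Shape O x y`: the last word starts at `x` and the
first word ends at `y`. -/
inductive Shape (O : Type w) : O → O → Type w
  | one (x y : O) : Shape O x y
  | step (x y : O) {z t : O} (S : Shape O z t) : Shape O x t

namespace Shape

def map {O : Type w} {O' : Type w} (g : O → O') {x y : O} : Shape O x y → Shape O' (g x) (g y)
  | one x y => one (g x) (g y)
  | step x y S => step (g x) (g y) (S.map g)

/-- The tuples of words `(pₙ, …, p₁)` of a given shape. -/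
def Inputs (A : GradedQuiver.{w} k) {x y : A.Obj} : Shape A.Obj x y → Type (max w u)
  | one x y => Word A.Letter x y
  | step x y S => Word A.Letter x y × S.Inputs A

/-- For the shape of `(p₁, …, pₙ)` with `pᵢ` from `lᵢ` to `rᵢ`, the tensor product
`A(l₁, r₂) ⊗ A(l₂, r₃) ⊗ … ⊗ A(lₙ₋₁, rₙ) ⊗ V`. -/
def Out (A : GradedQuiver.{w} k) {x y : A.Obj} :
    Shape A.Obj x y → ModuleCat.{u} k → ModuleCat.{u} k
  | one _ _, V => V
  | step (z := z) _ y S, V => ModuleCat.of k (S.Out A (ModuleCat.of k (A.Tot z y)) ⊗[k] V)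

/-- The tensor product `A(l₁, r₂) ⊗ A(l₂, r₃) ⊗ … ⊗ A(lₙ₋₁, rₙ) ⊗ A(lₙ, r₁)` of outputs. -/
abbrev Output (A : GradedQuiver.{w} k) {x y : A.Obj} (S : Shape A.Obj x y) : ModuleCat.{u} k :=
  S.Out A (ModuleCat.of k (A.Tot x y))

/-- Tuples `(fⁿ⁻¹, …, f¹)` of homogeneous linear forms, `fⁱ` being a linear form
on `A(lᵢ, rᵢ₊₁)`. -/
def Forms (A : GradedQuiver.{w} k) (d : ℤ) {x y : A.Obj} : Shape A.Obj x y → Type u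
  | one _ _ => PUnit
  | step (z := z) _ y S => A.DLetter d y z × S.Forms A d

/-- The linear map `o¹ ⊗ … ⊗ oⁿ⁻¹ ⊗ v ↦ f¹(o¹) ⋯ fⁿ⁻¹(oⁿ⁻¹) v`. -/
def contract (A : GradedQuiver.{w} k) (d : ℤ) {x y : A.Obj} :
    ∀ (S : Shape A.Obj x y) (V : ModuleCat.{u} k), S.Forms A d → (S.Out A V →ₗ[k] V)
  | one _ _, _, _ => LinearMap.id
  | step (z := z) _ y S, V, f =>
      (TensorProduct.lid k V).toLinearMap ∘ₗ
        TensorProduct.map (A.ev f.1 ∘ₗ S.contract A d (ModuleCat.of k (A.Tot z y)) f.2)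
          LinearMap.id

end Shape

/-- Letters of a word in `A ⊕ B^*[d-1]` which belong to `A` or to `B^*[d-1]`. -/
abbrev PLetter (A B : GradedQuiver.{w} k) (g : A.Obj → B.Obj) (d : ℤ) (x y : A.Obj) : Type u :=
  A.Letter x y ⊕ B.DLetter d (g x) (g y)

/-- Words in `A ⊕ B^*[d-1]` all of whose letters belong to `A` or to `B^*[d-1]`. -/
abbrev MWord (A B : GradedQuiver.{w} k) (g : A.Obj → B.Obj) (d : ℤ) (x y : A.Obj) :
    Type (max w u) :=
  Word (PLetter A B g d) x y

/-- Words in `A ⊕ A^*[d-1]` all of whose letters belong to `A` or to `A^*[d-1]`. Such a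
word reads `pₙ fⁿ⁻¹ pₙ₋₁ … f¹ p₁`, the `pᵢ` being words in `A`. -/
abbrev PWord (A : GradedQuiver.{w} k) (d : ℤ) (x y : A.Obj) : Type (max w u) :=
  MWord A A (fun x => x) d x y

section PureWords

variable {A B : GradedQuiver.{w} k} {g : A.Obj → B.Obj} {d : ℤ}

/-- The degree of a word in `A[1] ⊕ B^*[d]`. -/
def pdeg {x y : A.Obj} (p : MWord A B g d x y) : ℤ :=
  p.weight fun a => match a with
    | .inl a => a.1 - 1
    | .inr f => f.1 - 1

/-- The sum of the degrees of the letters in `A[1]`. -/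
def adeg {x y : A.Obj} (p : MWord A B g d x y) : ℤ :=
  p.weight fun a => match a with
    | .inl a => a.1 - 1
    | .inr _ => 0

/-- The sum of the degrees of the letters in `B^*[d]`. -/
def fdeg {x y : A.Obj} (p : MWord A B g d x y) : ℤ :=
  p.weight fun a => match a with
    | .inl _ => 0
    | .inr f => f.1 - 1

/-- The number of letters in `B^*[d]`. -/
def fnum {x y : A.Obj} (p : MWord A B g d x y) : ℤ :=
  p.weight fun a => match a with
    | .inl _ => 0
    | .inr _ => 1

/-- The degree of `pₙ` in `pₙ fⁿ⁻¹ pₙ₋₁ … f¹ p₁`. -/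
def leftDeg {x y : A.Obj} : MWord A B g d x y → ℤ
  | .nil _ => 0
  | .cons (.inl a) p => (a.1 - 1) + leftDeg p
  | .cons (.inr _) _ => 0

/-- The degree of `p₁` in `pₙ fⁿ⁻¹ pₙ₋₁ … f¹ p₁`. -/
def rightDeg {x y : A.Obj} : MWord A B g d x y → ℤ
  | .nil _ => 0
  | .cons (.inl a) p => if fnum p = 0 then (a.1 - 1) + rightDeg p else rightDeg p
  | .cons (.inr _) p => rightDeg p

/-- A decomposition of a word at a letter in `B^*[d]`. -/
structure FSplit (A B : GradedQuiver.{w} k) (g : A.Obj → B.Obj) (d : ℤ) (x y : A.Obj) where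
  {z t : A.Obj}
  l : MWord A B g d x z
  f : B.DLetter d (g z) (g t)
  r : MWord A B g d t y

/-- The decomposition of a word at its first letter in `B^*[d]`, if there is one. -/
def fsplit {x y : A.Obj} : MWord A B g d x y → Option (FSplit A B g d x y)
  | .nil _ => none
  | .cons (.inl a) p => (fsplit p).map fun s => ⟨.cons (.inl a) s.l, s.f, s.r⟩
  | .cons (.inr f) p => some ⟨.nil _, f, p⟩

/-- A word in `A` as a word in `A ⊕ A^*[d-1]`. -/
def ofA {x y : A.Obj} (p : Word A.Letter x y) : PWord A d x y :=
  p.map (fun x => x) fun a => .inl a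

/-- Tuples `((pₙ, …, p₁), (fⁿ⁻¹, …, f¹))`. -/
abbrev Blocks (A : GradedQuiver.{w} k) (d : ℤ) (x y : A.Obj) : Type (max w u) :=
  Σ S : Shape A.Obj x y, S.Inputs A × S.Forms A d

/-- Adds a letter in front of `pₙ`. -/
def Blocks.consA {x y z : A.Obj} (a : A.Letter x y) :
    ∀ S : Shape A.Obj y z, S.Inputs A → S.Forms A d → Blocks A d x z
  | .one _ z, p, _ => ⟨.one x z, Word.cons a p, PUnit.unit⟩
  | .step _ t S, p, f => ⟨.step x t S, (Word.cons a p.1, p.2), f⟩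

/-- Adds an empty word and a linear form in front of `pₙ`. -/
def Blocks.consF {x y z : A.Obj} (f : A.DLetter d x y) (b : Blocks A d y z) : Blocks A d x z :=
  ⟨.step x x b.1, ((Word.nil x : Word A.Letter x x), b.2.1), ((f : A.DLetter d x y), b.2.2)⟩

/-- Cuts `pₙ fⁿ⁻¹ pₙ₋₁ … f¹ p₁` into `((pₙ, …, p₁), (fⁿ⁻¹, …, f¹))`. -/
def parse {x y : A.Obj} : PWord A d x y → Blocks A d x y
  | .nil x => ⟨.one x x, Word.nil x, PUnit.unit⟩
  | .cons (.inl a) p => Blocks.consA a (parse p).1 (parse p).2.1 (parse p).2.2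
  | .cons (.inr f) p => (parse p).consF f

end PureWords

/-- A collection of maps `M^{x̄¹,…,x̄ⁿ}` that take words `(p₁, …, pₙ)` to tensors
in `A(l₁, r₂) ⊗ … ⊗ A(lₙ₋₁, rₙ) ⊗ A(lₙ, r₁)`. -/
abbrev MultiOp (A : GradedQuiver.{w} k) : Type (max w u) :=
  ∀ {x y : A.Obj} (S : Shape A.Obj x y), S.Inputs A → S.Output A

/-- `⟨M; pₙ fⁿ⁻¹ pₙ₋₁ … f¹ p₁⟩ = (f¹ ⊗ … ⊗ fⁿ⁻¹ ⊗ id) (M (p₁, …, pₙ))`, without sign. A tensor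
in the outputs is determined by these contractions. -/
def MultiOp.pair {A : GradedQuiver.{w} k} (M : MultiOp A) {d : ℤ} {x y : A.Obj}
    (p : PWord A d x y) : A.Tot x y :=
  (parse p).1.contract A d _ (parse p).2.2 (M (parse p).1 (parse p).2.1)

/-- The elements of degree `1` of the shift by `d + 1` of the space of multilinear maps
`A[1]^{⊗ x̄¹} ⊗ … ⊗ A[1]^{⊗ x̄ⁿ} → A[-d] ⊗ … ⊗ A[-d]` invariant under the cyclic groups. -/
structure IsCyclicMulti {A : GradedQuiver.{w} k} (d : ℤ) (M : MultiOp A) : Prop where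
  uncurved : ∀ x, M.pair (d := d) (.nil x) = 0
  linear : ∀ {x y z t} (p : PWord A d x y) (q : PWord A d z t) (j : ℤ),
    IsLinearMap k fun a : A.hom y z j => M.pair (p.append (.cons (.inl ⟨j, a⟩) q))
  /-- The tensor `M (p₁, …, pₙ)` has degree `|p₁| + … + |pₙ| + d + 2` in `A[-d] ⊗ … ⊗ A[-d]`. -/
  degree : ∀ {x y} (p : PWord A d x y) (j : ℤ), j ≠ pdeg p + 2 → A.comp j (M.pair p) = 0
  /-- Invariance under the generator of the cyclic group of order `n`, with the Koszul signs of
  the permutation of the inputs and of the outputs. Here `p₁` is a word in `A`, `q` is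
  `pₙ fⁿ⁻¹ … f² p₂`, and the linear form `fⁿ` is paired with the last output. -/
  cyclic : ∀ {x y z t} (q : PWord A d x y) (f₁ : A.DLetter d y z) (p₁ : Word A.Letter z t)
      (fₙ : A.DLetter d t x),
    ((f₁.1 - 1) * (fdeg q + (fₙ.1 - 1))).negOnePow •
        A.ev fₙ (M.pair (q.append (.cons (.inr f₁) (ofA p₁)))) =
      (A.wdeg p₁ * adeg q).negOnePow •
        A.ev f₁ (M.pair ((ofA p₁).append (.cons (.inr fₙ) q)))

/-! ## The necklace product and pre-Calabi-Yau structures -/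

section Necklace

variable {A : GradedQuiver.{w} k} {d : ℤ} {M : MultiOp A}

/-- For `s = (l, f, r)`, the linear form `b ↦ f ⟨M; r b l⟩` on the part of degree `j` of `A`. -/
def outerForm (hM : IsCyclicMulti d M) {x y : A.Obj} (s : FSplit A A (fun x => x) d x y) (j : ℤ) :
    Module.Dual k (A.hom y x j) :=
  A.ev s.f ∘ₗ (hM.linear s.r s.l j).mk' _

/-- The sign of the term of the necklace product in which the last output of the inner factor
(with arguments `v`) is an argument of the outer factor (with the other arguments in `u`, `q`). -/
def innerSign {x y z t : A.Obj} (u : PWord A d x z) (v : PWord A d z t) (q : PWord A d t y) : ℤ :=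
  adeg q + fdeg v * (1 + pdeg q) +
    (if fnum v = 0 then pdeg v * (rightDeg u + leftDeg q) + rightDeg u * leftDeg q
      else rightDeg v * leftDeg q + rightDeg u * leftDeg v) +
    ((pdeg v + 1) * (rightDeg u + leftDeg q) + rightDeg u * leftDeg q)

/-- The sign of the term of the necklace product in which an output of one factor, other than its
last output, is an argument of the other factor (with arguments in `v`). -/
def outerSign {x y z t : A.Obj} (u : PWord A d x z) (v : PWord A d z t) (q : PWord A d t y)
    (s : FSplit A A (fun x => x) d z t) : ℤ :=
  adeg v * (pdeg q + pdeg v + d + 1) + fdeg q + adeg s.l * (adeg s.r - rightDeg s.r) +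
    rightDeg s.r * (pdeg v + d) + rightDeg s.r * leftDeg q + rightDeg u * adeg s.l

/-- The necklace product of `M` with itself, contracted with linear forms. For a word
`u · v · q`, in the first (inner) summand the last output of the copy of `M` with arguments in `v`
is an argument of the other copy. In the second (outer) summand, `v = l f r` with `f` its first
linear form: the copy of `M` with arguments in `v` has all its outputs contracted with the linear
forms in `v`, and it has one more argument `b`, between `r` and `l`, which is the
output of the other copy that lies between `u` and `q`. -/
def necklace (hM : IsCyclicMulti d M) {x y : A.Obj} (p : PWord A d x y) : A.Tot x y :=
  (p.splits3.map fun s =>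
    (innerSign s.u s.v s.q).negOnePow •
        M.pair (s.u.append (.cons (.inl (A.letter (pdeg s.v + 2) (M.pair s.v))) s.q)) +
      match fsplit s.v with
      | none => 0
      | some r => (outerSign s.u s.v s.q r).negOnePow •
          M.pair (s.u.append (.cons (.inr ⟨pdeg s.v + 2, outerForm hM r _⟩) s.q))).sum

/-- `M` is a `d`-pre-Calabi-Yau structure on `A`. -/
structure IsPreCY (d : ℤ) (M : MultiOp A) : Prop where
  multi : IsCyclicMulti d M
  maurerCartan : ∀ {x y} (p : PWord A d x y), necklace multi p = 0

end Necklace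

/-- The `Hom`-finite `d`-pre-Calabi-Yau categories. -/
structure SpCY (k : Type u) [Field k] (d : ℤ) where
  quiver : GradedQuiver.{w} k
  homFinite : quiver.HomFinite
  M : MultiOp quiver
  isPreCY : IsPreCY d M

/-! ## Strict morphisms -/

section Strict

variable {A B C : GradedQuiver.{w} k}

/-- A morphism of graded quivers. -/
structure QuiverHom (A B : GradedQuiver.{w} k) where
  obj : A.Obj → B.Obj
  map : ∀ (x y : A.Obj) (j : ℤ), A.hom x y j →ₗ[k] B.hom (obj x) (obj y) j

namespace QuiverHom

def id (A : GradedQuiver.{w} k) : QuiverHom A A := ⟨fun x => x, fun _ _ _ => LinearMap.id⟩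

def comp (Φ : QuiverHom A B) (Ψ : QuiverHom B C) : QuiverHom A C :=
  ⟨fun x => Ψ.obj (Φ.obj x), fun x y j => Ψ.map _ _ j ∘ₗ Φ.map x y j⟩

/-- The map on homogeneous elements. -/
def letter (Φ : QuiverHom A B) {x y : A.Obj} (a : A.Letter x y) : B.Letter (Φ.obj x) (Φ.obj y) :=
  ⟨a.1, Φ.map x y a.1 a.2⟩

/-- The map on total spaces. -/
def tot (Φ : QuiverHom A B) (x y : A.Obj) : A.Tot x y →ₗ[k] B.Tot (Φ.obj x) (Φ.obj y) :=
  DFinsupp.mapRange.linearMap (Φ.map x y)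

/-- The map on words in `A`. -/
def word (Φ : QuiverHom A B) {x y : A.Obj} (p : Word A.Letter x y) :
    Word B.Letter (Φ.obj x) (Φ.obj y) :=
  p.map Φ.obj Φ.letter

/-- The map on tuples of words. -/
def inputs (Φ : QuiverHom A B) {x y : A.Obj} :
    ∀ S : Shape A.Obj x y, S.Inputs A → (S.map Φ.obj).Inputs B
  | .one _ _, p => Φ.word p
  | .step _ _ S, p => (Φ.word p.1, Φ.inputs S p.2)

/-- The map `Φ ⊗ … ⊗ Φ ⊗ h`. -/
def out (Φ : QuiverHom A B) {x y : A.Obj} :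
    ∀ (S : Shape A.Obj x y) {V W : ModuleCat.{u} k}, (V →ₗ[k] W) →
      (S.Out A V →ₗ[k] (S.map Φ.obj).Out B W)
  | .one _ _, _, _, h => h
  | .step (z := z) _ y S, _, _, h => TensorProduct.map
      (Φ.out S (V := ModuleCat.of k (A.Tot z y))
        (W := ModuleCat.of k (B.Tot (Φ.obj z) (Φ.obj y))) (Φ.tot z y)) h

/-- The map `Φ ⊗ … ⊗ Φ` on outputs. -/
def output (Φ : QuiverHom A B) {x y : A.Obj} (S : Shape A.Obj x y) :
    S.Output A →ₗ[k] (S.map Φ.obj).Output B :=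
  Φ.out S (V := ModuleCat.of k (A.Tot x y))
    (W := ModuleCat.of k (B.Tot (Φ.obj x) (Φ.obj y))) (Φ.tot x y)

theorem tot_id (x y : A.Obj) : (QuiverHom.id A).tot x y = LinearMap.id := by
  refine LinearMap.ext fun a => ?_
  exact DFinsupp.mapRange_id (fun _ => rfl) a

theorem tot_comp (Φ : QuiverHom A B) (Ψ : QuiverHom B C) (x y : A.Obj) :
    (Φ.comp Ψ).tot x y = Ψ.tot _ _ ∘ₗ Φ.tot x y :=
  DFinsupp.mapRange.linearMap_comp _ _

theorem out_id {x y : A.Obj} (S : Shape A.Obj x y) (ws : S.Inputs A) {V : ModuleCat.{u} k} :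
    (⟨S.map (QuiverHom.id A).obj, (QuiverHom.id A).inputs S ws,
        (QuiverHom.id A).out S (V := V) (W := V) LinearMap.id⟩ :
      Σ T : Shape A.Obj x y, T.Inputs A × (S.Out A V →ₗ[k] T.Out A V)) =
      ⟨S, ws, LinearMap.id⟩ := by
  induction S generalizing V with
  | one x y =>
    exact congrArg (fun w : Word A.Letter x y =>
      (⟨.one x y, w, LinearMap.id⟩ : Σ T : Shape A.Obj x y, T.Inputs A × (V →ₗ[k] T.Out A V)))
      (Word.map_id _ (fun _ => rfl) ws)
  | @step x y z t S ih =>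
    have h := ih ws.2 (V := ModuleCat.of k (A.Tot z y))
    rw [← tot_id] at h
    have hw : (QuiverHom.id A).word ws.1 = ws.1 := Word.map_id _ (fun _ => rfl) ws.1
    have := congrArg (fun s : Σ T : Shape A.Obj z t, T.Inputs A ×
        (S.Out A (ModuleCat.of k (A.Tot z y)) →ₗ[k] T.Out A (ModuleCat.of k (A.Tot z y))) =>
      (⟨.step x y s.1, ((QuiverHom.id A).word ws.1, s.2.1), TensorProduct.map s.2.2 LinearMap.id⟩ :
        Σ T : Shape A.Obj x t, T.Inputs A × ((Shape.step x y S).Out A V →ₗ[k] T.Out A V))) h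
    refine this.trans ?_
    rw [hw, TensorProduct.map_id]
    rfl

theorem out_comp (Φ : QuiverHom A B) (Ψ : QuiverHom B C) {x y : A.Obj} (S : Shape A.Obj x y)
    (ws : S.Inputs A) {V W U : ModuleCat.{u} k} (h : V →ₗ[k] W) (h' : W →ₗ[k] U) :
    (⟨(S.map Φ.obj).map Ψ.obj, Ψ.inputs _ (Φ.inputs S ws), Ψ.out _ h' ∘ₗ Φ.out S h⟩ :
      Σ T : Shape C.Obj (Ψ.obj (Φ.obj x)) (Ψ.obj (Φ.obj y)),
        T.Inputs C × (S.Out A V →ₗ[k] T.Out C U)) =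
      ⟨S.map (Φ.comp Ψ).obj, (Φ.comp Ψ).inputs S ws, (Φ.comp Ψ).out S (h' ∘ₗ h)⟩ := by
  induction S generalizing V W U with
  | one x y =>
    exact congrArg (fun w : Word C.Letter (Ψ.obj (Φ.obj x)) (Ψ.obj (Φ.obj y)) =>
      (⟨.one _ _, w, h' ∘ₗ h⟩ :
        Σ T : Shape C.Obj (Ψ.obj (Φ.obj x)) (Ψ.obj (Φ.obj y)), T.Inputs C × (V →ₗ[k] T.Out C U)))
      (Word.map_map _ _ _ _ ws)
  | @step x y z t S ih =>
    have h₀ := ih ws.2 (V := ModuleCat.of k (A.Tot z y))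
      (W := ModuleCat.of k (B.Tot (Φ.obj z) (Φ.obj y)))
      (U := ModuleCat.of k (C.Tot (Ψ.obj (Φ.obj z)) (Ψ.obj (Φ.obj y)))) (Φ.tot z y) (Ψ.tot _ _)
    have hw : Ψ.word (Φ.word ws.1) = (Φ.comp Ψ).word ws.1 := Word.map_map _ _ _ _ ws.1
    have := congrArg (fun s : Σ T : Shape C.Obj (Ψ.obj (Φ.obj z)) (Ψ.obj (Φ.obj t)),
        T.Inputs C × (S.Out A (ModuleCat.of k (A.Tot z y)) →ₗ[k]
          T.Out C (ModuleCat.of k (C.Tot (Ψ.obj (Φ.obj z)) (Ψ.obj (Φ.obj y))))) =>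
      (⟨.step (Ψ.obj (Φ.obj x)) (Ψ.obj (Φ.obj y)) s.1, (Ψ.word (Φ.word ws.1), s.2.1),
          TensorProduct.map s.2.2 (h' ∘ₗ h)⟩ :
        Σ T : Shape C.Obj (Ψ.obj (Φ.obj x)) (Ψ.obj (Φ.obj t)),
          T.Inputs C × ((Shape.step x y S).Out A V →ₗ[k] T.Out C U))) h₀
    rw [← tot_comp] at this
    simp only [TensorProduct.map_comp] at this
    refine Eq.trans this ?_
    rw [hw]
    rfl

end QuiverHom
end Strict

/-- Strict `d`-pre-Calabi-Yau morphisms: morphisms `Φ` of graded quivers such that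
`(Φ ⊗ … ⊗ Φ) ∘ M_A = M_B ∘ (Φ ⊗ … ⊗ Φ)`. -/
@[ext]
structure SpCY.Hom {d : ℤ} (X Y : SpCY.{w} k d) where
  hom : QuiverHom X.quiver Y.quiver
  comm : ∀ {x y : X.quiver.Obj} (S : Shape X.quiver.Obj x y) (ws : S.Inputs X.quiver),
    hom.output S (X.M S ws) = Y.M (S.map hom.obj) (hom.inputs S ws)

/-- The category of `Hom`-finite `d`-pre-Calabi-Yau categories and strict morphisms. -/
instance SpCY.category (d : ℤ) : Category (SpCY.{w} k d) where
  Hom X Y := SpCY.Hom X Y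
  id X :=
    { hom := QuiverHom.id X.quiver
      comm := fun {x y} S ws => by
        have key : ∀ s : Σ T : Shape X.quiver.Obj x y, T.Inputs X.quiver ×
            (S.Output X.quiver →ₗ[k] T.Output X.quiver), s = ⟨S, ws, LinearMap.id⟩ →
            s.2.2 (X.M S ws) = X.M s.1 s.2.1 := by
          rintro _ rfl
          rfl
        have h := QuiverHom.out_id S ws (V := ModuleCat.of k (X.quiver.Tot x y))
        rw [← QuiverHom.tot_id] at h
        exact key _ h }
  comp {X Y Z} f g :=
    { hom := f.hom.comp g.hom
      comm := fun {x y} S ws => by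
        have key : ∀ s : Σ T : Shape Z.quiver.Obj (g.hom.obj (f.hom.obj x))
            (g.hom.obj (f.hom.obj y)), T.Inputs Z.quiver ×
            (S.Output X.quiver →ₗ[k] T.Output Z.quiver),
            (⟨(S.map f.hom.obj).map g.hom.obj, g.hom.inputs _ (f.hom.inputs S ws),
              g.hom.output _ ∘ₗ f.hom.output S⟩ : Σ T : Shape Z.quiver.Obj
              (g.hom.obj (f.hom.obj x)) (g.hom.obj (f.hom.obj y)), T.Inputs Z.quiver ×
              (S.Output X.quiver →ₗ[k] T.Output Z.quiver)) = s →
            s.2.2 (X.M S ws) = Z.M s.1 s.2.1 := by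
          rintro _ rfl
          exact (congrArg (g.hom.output _) (f.comm S ws)).trans (g.comm _ _)
        have h := QuiverHom.out_comp f.hom g.hom S ws (V := ModuleCat.of k (X.quiver.Tot x y))
          (W := ModuleCat.of k (Y.quiver.Tot _ _)) (U := ModuleCat.of k (Z.quiver.Tot _ _))
          (f.hom.tot x y) (g.hom.tot _ _)
        rw [← QuiverHom.tot_comp] at h
        exact key _ h }

/-! ## The operations on `A ⊕ A^*[d-1]` and on `A ⊕ B^*[d-1]` -/

section Operations

variable {A B : GradedQuiver.{w} k} {g : A.Obj → B.Obj} {d : ℤ}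

/-- For `p = pₙ fⁿ⁻¹ pₙ₋₁ … f¹ p₁`, the integer
`∑_{i<n} |fⁱ| ∑_{j>i} |pⱼ| + ∑_{i<j} |pᵢ| |pⱼ| + d (n - 1)`. -/
def signExp {x y : A.Obj} : MWord A B g d x y → ℤ
  | .nil _ => 0
  | .cons (.inl a) p => (a.1 - 1) * (fdeg p + (adeg p - leftDeg p)) + signExp p
  | .cons (.inr _) p => d + signExp p

/-- The component `A ⊕ A^*[d-1] → A` of the structure on `A ⊕ A^*[d-1]` on words whose letters
belong to `A` or `A^*[d-1]`. -/
def opA (d : ℤ) (M : MultiOp A) {x y : A.Obj} (p : PWord A d x y) : A.Tot x y :=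
  (signExp p).negOnePow • M.pair p

/-- The component `A ⊕ A^*[d-1] → A^*[d-1]` of the structure on `A ⊕ A^*[d-1]`. It vanishes on
words in `A`, and for `p = l f r` with `f` the first letter in `A^*[d-1]`, it is determined by
`Γ(sm(l, tf, r), sb) = (-1)^{(|r| + |sb|)(|l| + |tf|)} Γ(sm(r, sb, l), tf)` for `b` in `A`, where
`Γ` is the natural bilinear form. -/
def opD {M : MultiOp A} (hM : IsCyclicMulti d M) {x y : A.Obj} (p : PWord A d x y) :
    A.DLetter d x y :=
  ⟨pdeg p + 2, match fsplit p with
    | none => 0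
    | some s =>
      let j : ℤ := -(pdeg p + 2 + d - 1)
      (pdeg p + (pdeg s.r + (j - 1)) * (pdeg s.l + (s.f.1 - 1)) + (d + 1) * (s.f.1 - 1) +
        signExp (s.r.append (.cons (.inl ⟨j, 0⟩) s.l))).negOnePow • outerForm hM s j⟩

/-- The words whose letters belong to `A` or `B^*[d-1]` of which a word in `A ⊕ B^*[d-1]` is
the sum. -/
def expand {x y : A.Obj} : Word (mix A B g d).Letter x y → List (MWord A B g d x y)
  | .nil x => [.nil x]
  | .cons (y := y) a p => (expand (x := y) p).flatMap fun q =>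
      [.cons (.inl ⟨a.1, a.2.1⟩) q, .cons (.inr ⟨a.1, a.2.2⟩) q]

/-- The inclusion of `A` into `A ⊕ B^*[d-1]`. -/
def mixInl (B : GradedQuiver.{w} k) (g : A.Obj → B.Obj) (d : ℤ) {x y : A.Obj} :
    A.Tot x y →ₗ[k] (mix A B g d).Tot x y :=
  DFinsupp.mapRange.linearMap fun j => LinearMap.inl k (A.hom x y j) (B.dualHom d (g x) (g y) j)

/-- The operations on `A ⊕ B^*[d-1]` with given components to `A` and to `B^*[d-1]` on words whose
letters belong to `A` or `B^*[d-1]`. -/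
def mixOp (a : ∀ {x y : A.Obj}, MWord A B g d x y → A.Tot x y)
    (b : ∀ {x y : A.Obj}, MWord A B g d x y → B.DLetter d (g x) (g y)) : Op (mix A B g d) :=
  fun x y p => ((expand p).map fun q =>
    mixInl B g d (a q) + (mix A B g d).incl (b q).1 ((0 : A.hom x y (b q).1), (b q).2)).sum

/-- The map `Φ^* : B^*[d-1] → A^*[d-1]`. -/
def QuiverHom.dual (Φ : QuiverHom A B) {x y : A.Obj} (f : B.DLetter d (Φ.obj x) (Φ.obj y)) :
    A.DLetter d x y :=
  ⟨f.1, f.2 ∘ₗ Φ.map y x _⟩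

/-- The map `id ⊕ Φ^*` on words. -/
def QuiverHom.pull (Φ : QuiverHom A B) {x y : A.Obj} (p : MWord A B Φ.obj d x y) : PWord A d x y :=
  p.map (fun x => x) (Sum.map (fun a => a) Φ.dual)

/-- The map `Φ ⊕ id` on words. -/
def QuiverHom.push (Φ : QuiverHom A B) {x y : A.Obj} (p : MWord A B Φ.obj d x y) :
    PWord B d (Φ.obj x) (Φ.obj y) :=
  p.map Φ.obj (Sum.map Φ.letter (fun f => f))

/-- The pairing `((a, f), (b, g)) ↦ f (Φ b)` on `A ⊕ B^*[d-1]`. -/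
def mixPair (Φ : QuiverHom A B) (d : ℤ) (x y : A.Obj) (i j : ℤ) :
    (mix A B Φ.obj d).hom x y i →ₗ[k] (mix A B Φ.obj d).hom y x j →ₗ[k] k :=
  (LinearMap.lcomp k k (B.comp (-(i + d - 1)) ∘ₗ B.incl j ∘ₗ Φ.map y x j)).compl₁₂
    (LinearMap.snd k (A.hom x y i) (B.dualHom d (Φ.obj x) (Φ.obj y) i))
    (LinearMap.fst k (A.hom y x j) (B.dualHom d (Φ.obj y) (Φ.obj x) j))

/-- The `Φ`-mixed bilinear form on `A ⊕ B^*[d-1]`: it vanishes on pairs of elements of `A` and on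
pairs of elements of `B^*[d-1]`, and
`Γ(tf, sa) = -(-1)^{|sa||tf|} Γ(sa, tf) = (-1)^{|tf|+1} f (Φ a)`. -/
def mixForm (Φ : QuiverHom A B) (d : ℤ) : Form (mix A B Φ.obj d) where
  deg := d - 1
  val x y := DirectSum.toModule k ℤ _ fun i => (DirectSum.toModule k ℤ _ fun j =>
    (i.negOnePow • mixPair Φ d x y i j -
      ((i - 1) * (j - 1) + j).negOnePow • (mixPair Φ d y x j i).flip).flip).flip
  homogeneous := by
    intro x y i j a b h
    have h₁ : ∀ {x y : A.Obj} (i j : ℤ) (a : (mix A B Φ.obj d).hom x y i)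
        (b : (mix A B Φ.obj d).hom y x j), i + j + (d - 1) ≠ 0 → mixPair Φ d x y i j a b = 0 := by
      intro x y i j a b h
      have : B.comp (-(i + d - 1)) (B.incl j (Φ.map y x j b.1)) = 0 :=
        (DirectSum.component.of (R := k) _ _ _).trans (dif_neg (by omega))
      simp only [mixPair, LinearMap.compl₁₂_apply, LinearMap.lcomp_apply, LinearMap.comp_apply]
      erw [this, map_zero]
    simp only [GradedQuiver.incl, DirectSum.toModule_lof, LinearMap.flip_apply,
      LinearMap.sub_apply, Units.smul_def, LinearMap.smul_apply]
    rw [h₁ i j a b h, h₁ j i b a (by omega), smul_zero, smul_zero, sub_zero]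

end Operations

section Structures

variable {d : ℤ}

/-- The `A∞`-structure on `A ⊕ A^*[d-1]` of a `d`-pre-Calabi-Yau category `A`. -/
def bdryOp (X : SpCY.{w} k d) : Op (bdry X.quiver d) :=
  mixOp (opA d X.M) (opD X.isPreCY.multi)

/-- The `A∞`-structure on `A ⊕ B^*[d-1]` of a strict morphism `Φ` from `A` to `B`: its component
to `A` is that of the structure on `A ⊕ A^*[d-1]` after `id ⊕ Φ^*`, and its component to `B^*[d-1]`
is that of the structure on `B ⊕ B^*[d-1]` after `Φ ⊕ id`. -/
def mixedOp {X Y : SpCY.{w} k d} (Φ : X ⟶ Y) : Op (mix X.quiver Y.quiver Φ.hom.obj d) :=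
  mixOp (fun p => opA d X.M (Φ.hom.pull p)) (fun p => opD Y.isPreCY.multi (Φ.hom.push p))

/-- The morphism `φ_A` from `A ⊕ B^*[d-1]` to `A ⊕ A^*[d-1]`, `a ↦ a`, `f ↦ f ∘ Φ`. -/
def phiA {A B : GradedQuiver.{w} k} (Φ : QuiverHom A B) (d : ℤ) :
    MorOp (mix A B Φ.obj d) (bdry A d) (fun x => x) :=
  MorOp.ofLinear fun x y j => LinearMap.prodMap (LinearMap.id : A.hom x y j →ₗ[k] A.hom x y j)
    (LinearMap.lcomp k k (Φ.map y x (-(j + d - 1))))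

/-- The morphism `φ_B` from `A ⊕ B^*[d-1]` to `B ⊕ B^*[d-1]`, `a ↦ Φ a`, `f ↦ f`. -/
def phiB {A B : GradedQuiver.{w} k} (Φ : QuiverHom A B) (d : ℤ) :
    MorOp (mix A B Φ.obj d) (bdry B d) Φ.obj :=
  MorOp.ofLinear fun x y j => LinearMap.prodMap (Φ.map x y j)
    (LinearMap.id : B.dualHom d (Φ.obj x) (Φ.obj y) j →ₗ[k] _)

end Structures

/-! ## Partial categories -/

/-- Objects and morphisms, with a relation `IsComp f g h`: the morphisms `f : X ⟶ Y` and
`g : Y ⟶ Z` are composable and `h : X ⟶ Z` is a composition of them. -/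
class PartialCategory (C : Type v₁) extends Quiver.{v₂} C where
  IsComp : ∀ {X Y Z : C}, (X ⟶ Y) → (Y ⟶ Z) → (X ⟶ Z) → Prop

/-- A functor of partial categories: if `f` and `g` are composable with composition `h` then
their images are composable with composition the image of `h`. -/
structure PartialFunctor (C : Type v₁) (D : Type w₁) [PartialCategory.{v₁, v₂} C]
    [PartialCategory.{w₁, w₂} D] extends C ⥤q D where
  map_comp : ∀ {X Y Z : C} (f : X ⟶ Y) (g : Y ⟶ Z) (h : X ⟶ Z),
    PartialCategory.IsComp f g h → PartialCategory.IsComp (map f) (map g) (map h)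

instance SpCY.partialCategory (d : ℤ) : PartialCategory (SpCY.{w} k d) where
  toQuiver := inferInstance
  IsComp f g h := f ≫ g = h

/-- `(Q, m)` is a cyclic `A∞`-category with respect to `Γ`. -/
structure IsCyclicAInf {Q : GradedQuiver.{w} k} (m : Op Q) (Γ : Form Q) : Prop where
  isAInf : IsAInf m
  almostCyclic : AlmostCyclic m Γ
  nondegenerate : Γ.Nondegenerate

/-- `(m, φ_A, φ_B)` is a strict cyclic hat morphism: `m` is an `A∞`-structure on `A ⊕ B^*[d-1]`,
almost cyclic with respect to `Γ`, and `φ_A`, `φ_B` are strict cyclic `A∞`-morphisms. -/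
structure IsStrictCyclicHat {A B : GradedQuiver.{w} k} {d : ℤ}
    (mA : Op (bdry A d)) (ΓA : Form (bdry A d)) (mB : Op (bdry B d)) (ΓB : Form (bdry B d))
    {g : A.Obj → B.Obj} (m : Op (mix A B g d)) (Γ : Form (mix A B g d))
    (φA : MorOp (mix A B g d) (bdry A d) (fun x => x))
    (φB : MorOp (mix A B g d) (bdry B d) g) : Prop where
  isAInf : IsAInf m
  almostCyclic : AlmostCyclic m Γ
  morA : IsAInfMor m mA φA
  strictA : φA.IsStrict
  cyclicA : φA.IsCyclic Γ ΓA
  morB : IsAInfMor m mB φB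
  strictB : φB.IsStrict
  cyclicB : φB.IsCyclic Γ ΓB

/-- Objects: cyclic `A∞`-categories of the form `A ⊕ A^*[d-1]`. -/
structure Scyc (k : Type u) [Field k] (d : ℤ) where
  quiver : GradedQuiver.{w} k
  m : Op (bdry quiver d)
  form : Form (bdry quiver d)
  isCyclic : IsCyclicAInf m form

/-- Morphisms: hat morphisms consisting of an almost cyclic `A∞`-structure on `A ⊕ B^*[d-1]` and
strict cyclic `A∞`-morphisms to `A ⊕ A^*[d-1]` and `B ⊕ B^*[d-1]`. -/
structure Scyc.Hom {d : ℤ} (X Y : Scyc.{w} k d) where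
  obj : X.quiver.Obj → Y.quiver.Obj
  m : Op (mix X.quiver Y.quiver obj d)
  form : Form (mix X.quiver Y.quiver obj d)
  φA : MorOp (mix X.quiver Y.quiver obj d) (bdry X.quiver d) (fun x => x)
  φB : MorOp (mix X.quiver Y.quiver obj d) (bdry Y.quiver d) obj
  isHat : IsStrictCyclicHat X.m X.form Y.m Y.form m form φA φB

/-- Hat morphisms `f = (m_f, φ_A, φ_B)` and `g = (m_g, ψ_B, ψ_C)` are composable with composition
`(m_h, φ_A ∘ χ_A, ψ_C ∘ χ_C)` if `χ_A` and `χ_C` are `A∞`-morphisms from `(A ⊕ C^*[d-1], m_h)` to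
`(A ⊕ B^*[d-1], m_f)` and to `(B ⊕ C^*[d-1], m_g)` with `φ_B ∘ χ_A = ψ_B ∘ χ_C`. -/
instance Scyc.partialCategory (d : ℤ) : PartialCategory (Scyc.{w} k d) where
  Hom X Y := Scyc.Hom X Y
  IsComp {X Y Z} (f : Scyc.Hom X Y) (g : Scyc.Hom Y Z) (h : Scyc.Hom X Z) :=
    ∃ (e : h.obj = fun x => g.obj (f.obj x))
      (χA : MorOp (mix X.quiver Z.quiver h.obj d) (mix X.quiver Y.quiver f.obj d) (fun x => x))
      (χC : MorOp (mix X.quiver Z.quiver h.obj d) (mix Y.quiver Z.quiver g.obj d) f.obj),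
      IsAInfMor h.m f.m χA ∧ IsAInfMor h.m g.m χC ∧
      χA.comp f.φB = χC.comp g.φA ∧
      h.φA = χA.comp f.φA ∧
      MorOp.castObj (Q := mix X.quiver Z.quiver h.obj d) (R := bdry Z.quiver d) e h.φB =
        χC.comp g.φB

end PreCY

end

open PreCY

/-!
The operations on `A ⊕ A^*[d-1]` repackage the maps `M` of a pre-Calabi-Yau category `A`: evaluating
linear forms on all outputs of `M` but the last one gives the component to `A` of the operations,
and cyclicity with respect to the natural form dictates the component to `A^*[d-1]`. The theorem
rests on two comparisons and on a transfer argument.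

*Cyclicity.* All operations are multilinear, so that every identity may be checked on words each of
whose letters belongs to `A` or to `A^*[d-1]` (`emb_induction`). On such words almost cyclicity
amounts, according to the position of the linear forms, to the definition of the component to
`A^*[d-1]` or to the invariance of `M` under the cyclic groups (`doubleOp_cyclic_emb`).

*Stasheff identities.* In the Stasheff sum, the value of the inner operation splits into its
components in `A` and in `A^*[d-1]`. For the component to `A` of the sum these two parts are the
inner and the outer summand of the necklace product, so that this component is the necklace product
of `M` with itself up to a sign (`mixFst_stasheffSum_emb`) and vanishes. For the component to
`A^*[d-1]`, pair the sum with an element of `A`. As the operations are almost cyclic and the form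
is graded antisymmetric, the result does not change, up to sign, when the word is rotated
(`form_stasheffSum_rotate`). If the word contains a linear form, rotate until that linear form is
the last argument of the bilinear form: it is then paired with the component to `A`, which is known
to vanish (`doubleForm_stasheffSum_emb_append`). On a word in `A` no operation has a component to
`A^*[d-1]`.

*Transfer.* A strict morphism `Φ : A → B` intertwines the contractions of `M_A` with `f ∘ Φ` and
those of `M_B` with `f` (`tot_pair_pull`). Hence `id ⊕ Φ^*` and `Φ ⊕ id` commute with the
operations on `A ⊕ B^*[d-1]`. These two maps are jointly injective and preserve the bilinear forms,
so that the Stasheff identities and almost cyclicity on `A ⊕ B^*[d-1]` follow from those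
on `A ⊕ A^*[d-1]` and `B ⊕ B^*[d-1]` (`IsAInf.of_jointly_injective`, `AlmostCyclic.of_isometry`). For a
composite `A → B → C`, the maps `χ_A = id ⊕ Ψ^*` and `χ_C = Φ ⊕ id` out of `A ⊕ C^*[d-1]` witness
composability.

All signs are compared in `ZMod 2`, where `n ↦ (-1)ⁿ` turns polynomial identities into equalities
of signs; the identities `a * a = a` for the degrees that occur are supplied to `grind` where they
are needed.
-/

noncomputable section

namespace PreCY

/-! ### Words -/

namespace Word

variable {O : Type w} {L : O → O → Type u}

@[simp] theorem nil_append {x y : O} (p : Word L x y) : (nil x).append p = p := rfl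

@[simp] theorem cons_append {x y z t : O} (a : L x y) (p : Word L y z) (q : Word L z t) :
    (cons a p).append q = cons a (p.append q) := rfl

@[simp] theorem append_nil {x y : O} (p : Word L x y) : p.append (nil y) = p := by
  induction p with
  | nil x => rfl
  | cons a p ih => rw [cons_append, ih]

theorem append_assoc {x y z t : O} (p : Word L x y) (q : Word L y z) (r : Word L z t) :
    (p.append q).append r = p.append (q.append r) := by
  induction p with
  | nil x => rfl
  | cons a p ih => rw [cons_append, cons_append, cons_append, ih]

theorem weight_append (f : ∀ {x y : O}, L x y → ℤ) {x y z : O} (p : Word L x y)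
    (q : Word L y z) : (p.append q).weight f = p.weight f + q.weight f := by
  induction p with
  | nil x => exact (zero_add _).symm
  | cons a p ih => simp only [cons_append, weight, ih, add_assoc]

theorem splits_append_cons {x y z t : O} (p : Word L x y) (a : L y z) (q : Word L z t) :
    (p.append (cons a q)).splits =
      p.splits.map (fun s => ⟨s.1, s.2.1, s.2.2.append (cons a q)⟩) ++
        q.splits.map (fun s => ⟨s.1, p.append (cons a s.2.1), s.2.2⟩) := by
  induction p with
  | nil x => rfl
  | cons b p ih =>
    simp only [cons_append, splits, ih, List.map_append, List.map_map, List.map_cons,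
      List.cons_append]
    rfl

theorem append_of_mem_splits {x y : O} (p : Word L x y) :
    ∀ s ∈ p.splits, s.2.1.append s.2.2 = p := by
  induction p with
  | nil x => simp [splits]
  | cons a p ih =>
    intro s hs
    simp only [splits, List.mem_cons, List.mem_map] at hs
    rcases hs with rfl | ⟨r, hr, rfl⟩
    · rfl
    · simp only [cons_append, ih r hr]

theorem append_of_mem_splits3 {x y : O} (p : Word L x y) :
    ∀ s ∈ p.splits3, s.u.append (s.v.append s.q) = p := by
  intro s hs
  simp only [splits3, List.mem_flatMap, List.mem_map] at hs
  obtain ⟨r, hr, t, ht, rfl⟩ := hs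
  simp only [append_of_mem_splits _ _ ht, append_of_mem_splits _ _ hr]

section Map

variable {O' : Type w₁} {L' : O' → O' → Type u} (g : O → O')
  (φ : ∀ {x y : O}, L x y → L' (g x) (g y))

@[simp] theorem map_append {x y z : O} (p : Word L x y) (q : Word L y z) :
    (p.append q).map g φ = (p.map g φ).append (q.map g φ) := by
  induction p with
  | nil x => rfl
  | cons a p ih => simp only [cons_append, map, ih]

theorem weight_map (f : ∀ {x y : O'}, L' x y → ℤ) {x y : O} (p : Word L x y) :
    (p.map g φ).weight f = p.weight (fun a => f (φ a)) := by
  induction p with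
  | nil x => rfl
  | cons a p ih => simp only [map, weight, ih]

theorem splits_map {x y : O} (p : Word L x y) :
    (p.map g φ).splits = p.splits.map fun s => ⟨g s.1, s.2.1.map g φ, s.2.2.map g φ⟩ := by
  induction p with
  | nil x => rfl
  | cons a p ih =>
    simp only [map, splits, ih, List.map_map, List.map_cons]
    rfl

theorem splits3_map {x y : O} (p : Word L x y) :
    (p.map g φ).splits3 =
      p.splits3.map fun s => ⟨s.u.map g φ, s.v.map g φ, s.q.map g φ⟩ := by
  simp only [splits3, splits_map, List.flatMap_map, List.map_flatMap, List.map_map]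
  rfl

end Map

section Sums

variable {V : Type*} [AddCommMonoid V]

theorem sum_flatMap_map {α β : Type*} (l : List α) (F : α → List β) (f : β → V) :
    ((l.flatMap F).map f).sum = (l.map fun a => ((F a).map f).sum).sum := by
  induction l with
  | nil => rfl
  | cons a l ih => simp only [List.flatMap_cons, List.map_append, List.sum_append, ih,
      List.map_cons, List.sum_cons]

theorem sum_splits3 {x y : O} (p : Word L x y) (f : Split3 L x y → V) :
    (p.splits3.map f).sum =
      (p.splits.map fun s => (s.2.2.splits.map fun r => f ⟨s.2.1, r.2.1, r.2.2⟩).sum).sum := by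
  rw [splits3, sum_flatMap_map]
  simp only [List.map_map, Function.comp_def]

theorem sum_splits3_cons {x y z : O} (a : L x y) (p : Word L y z) (f : Split3 L x z → V) :
    ((cons a p).splits3.map f).sum =
      f ⟨nil x, nil x, cons a p⟩ + (p.splits.map fun s => f ⟨nil x, cons a s.2.1, s.2.2⟩).sum +
        (p.splits3.map fun s => f ⟨cons a s.u, s.v, s.q⟩).sum := by
  rw [sum_splits3, sum_splits3]
  simp only [splits, List.map_cons, List.sum_cons, List.map_map, Function.comp_def]

/-- The decompositions of `p · a · q` into three words, sorted by the factor to which the letter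
`a` belongs. -/
theorem sum_splits3_append_cons {x y z t : O} (p : Word L x y) (a : L y z) (q : Word L z t)
    (f : Split3 L x t → V) :
    ((p.append (cons a q)).splits3.map f).sum =
      (p.splits3.map fun s => f ⟨s.u, s.v, s.q.append (cons a q)⟩).sum +
        (p.splits.map fun s => (q.splits.map fun r =>
          f ⟨s.2.1, s.2.2.append (cons a r.2.1), r.2.2⟩).sum).sum +
        (q.splits3.map fun s => f ⟨p.append (cons a s.u), s.v, s.q⟩).sum := by
  simp only [sum_splits3, splits_append_cons, List.map_append, List.sum_append, List.map_map,
    Function.comp_def, List.sum_map_add]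

end Sums

end Word

/-! ### Homogeneous components -/

theorem negOnePow_congr {m n : ℤ} (h : (m : ZMod 2) = n) : m.negOnePow = n.negOnePow := by
  rw [Int.negOnePow_eq_iff, ← ZMod.intCast_eq_zero_iff_even, Int.cast_sub, h, sub_self]

theorem zmod_two_mul_self (a : ZMod 2) : a * a = a := by
  revert a
  decide

theorem isLinearMap_list_sum {k V W ι : Type*} [Semiring k] [AddCommMonoid V] [AddCommMonoid W]
    [Module k V] [Module k W] (l : List ι) (f : ι → V → W)
    (h : ∀ i ∈ l, IsLinearMap k (f i)) : IsLinearMap k fun a => (l.map fun i => f i a).sum := by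
  induction l with
  | nil => exact ⟨by simp, by simp⟩
  | cons i l ih =>
    have h₁ := h i (by simp)
    have h₂ := ih fun j hj => h j (by simp [hj])
    exact ⟨fun a b => by simp [h₁.map_add, h₂.map_add, add_add_add_comm],
      fun c a => by simp [h₁.map_smul, h₂.map_smul]⟩

variable {k : Type u} [Field k]

namespace GradedQuiver

variable (A : GradedQuiver.{w} k) {x y : A.Obj}

@[simp] theorem comp_incl_same (j : ℤ) (a : A.hom x y j) : A.comp j (A.incl j a) = a :=
  DirectSum.component.lof_self k j a

theorem comp_incl_ne {i j : ℤ} (h : i ≠ j) (a : A.hom x y i) : A.comp j (A.incl i a) = 0 :=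
  (DirectSum.component.of (R := k) _ _ _).trans (dif_neg (by omega))

variable {A}

theorem tot_ext {a b : A.Tot x y} (h : ∀ j, A.comp j a = A.comp j b) : a = b :=
  DirectSum.ext_component k h

theorem tot_hom_ext {V : Type*} [AddCommMonoid V] [Module k V] {f g : A.Tot x y →ₗ[k] V}
    (h : ∀ j a, f (A.incl j a) = g (A.incl j a)) : f = g :=
  DirectSum.linearMap_ext k fun j => LinearMap.ext fun a => h j a

/-- An element concentrated in degree `j` is its degree `j` component. -/
theorem incl_comp_of_homogeneous {a : A.Tot x y} {j : ℤ} (h : ∀ i, i ≠ j → A.comp i a = 0) :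
    A.incl j (A.comp j a) = a := by
  refine tot_ext fun i => ?_
  by_cases hi : i = j
  · subst hi; rw [comp_incl_same]
  · rw [comp_incl_ne _ (Ne.symm hi), h i hi]

theorem wdeg_append {z : A.Obj} (p : Word A.Letter x y) (q : Word A.Letter y z) :
    A.wdeg (p.append q) = A.wdeg p + A.wdeg q := Word.weight_append _ _ _

@[simp] theorem wdeg_nil : A.wdeg (.nil x) = 0 := rfl

@[simp] theorem wdeg_cons {z : A.Obj} (a : A.Letter x y) (p : Word A.Letter y z) :
    A.wdeg (.cons a p) = a.1 - 1 + A.wdeg p := rfl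

end GradedQuiver

open GradedQuiver

/-! ### The Stasheff identities -/

/-- The left-hand side of the Stasheff identity of the operations `m` on the word `p`. -/
def Op.stasheffSum {Q : GradedQuiver.{w} k} (m : Op Q) {x y : Q.Obj} (p : Word Q.Letter x y) :
    Q.Tot x y :=
  (p.splits3.map fun s => (Q.wdeg s.u).negOnePow •
    m x y (s.u.append (.cons (Q.letter (Q.wdeg s.v + 2) (m _ _ s.v)) s.q))).sum

/-- The operations `m` are linear in each argument. -/
def Op.IsMultilinear {Q : GradedQuiver.{w} k} (m : Op Q) : Prop :=
  ∀ {x y z t} (p : Word Q.Letter x y) (q : Word Q.Letter z t) (j : ℤ),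
    IsLinearMap k fun a : Q.hom y z j => m x t (p.append (.cons ⟨j, a⟩ q))

section Stasheff

variable {Q : GradedQuiver.{w} k} {m : Op Q}

theorem isLinearMap_negOnePow_smul {V W : Type*} [AddCommGroup V] [AddCommGroup W] [Module k V]
    [Module k W] {f : V → W} (hf : IsLinearMap k f) (n : ℤ) :
    IsLinearMap k fun a => n.negOnePow • f a :=
  ⟨fun a b => by rw [hf.map_add, smul_add], fun c a => by rw [hf.map_smul, smul_comm]⟩

theorem isLinearMap_congr {V W : Type*} [AddCommMonoid V] [AddCommMonoid W] [Module k V]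
    [Module k W] {f g : V → W} (hf : IsLinearMap k f) (h : ∀ a, g a = f a) : IsLinearMap k g :=
  (funext h : g = f) ▸ hf

theorem isLinearMap_add {V W : Type*} [AddCommGroup V] [AddCommGroup W] [Module k V]
    [Module k W] {f g : V → W} (hf : IsLinearMap k f) (hg : IsLinearMap k g) :
    IsLinearMap k fun a => f a + g a :=
  ⟨fun a b => by rw [hf.map_add, hg.map_add, add_add_add_comm],
    fun c a => by rw [hf.map_smul, hg.map_smul, smul_add]⟩

theorem isLinearMap_comp {V W U : Type*} [AddCommGroup V] [AddCommGroup W] [Module k V]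
    [Module k W] [AddCommGroup U] [Module k U] {f : W → U} {g : V → W} (hf : IsLinearMap k f)
    (hg : IsLinearMap k g) : IsLinearMap k fun a => f (g a) :=
  ⟨fun a b => by rw [hg.map_add, hf.map_add], fun c a => by rw [hg.map_smul, hf.map_smul]⟩

theorem Op.IsMultilinear.map_zero (h : m.IsMultilinear) {x y z t : Q.Obj}
    (p : Word Q.Letter x y) (q : Word Q.Letter z t) (j : ℤ) :
    m x t (p.append (.cons ⟨j, (0 : Q.hom y z j)⟩ q)) = 0 := (h p q j).map_zero

/-- A given letter lies in the left, middle or right part of a decomposition, and the corresponding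
term is linear in it in each of the three cases. -/
theorem Op.IsMultilinear.stasheffSum (h : m.IsMultilinear) {x y z t : Q.Obj}
    (p : Word Q.Letter x y) (q : Word Q.Letter z t) (j : ℤ) :
    IsLinearMap k fun a : Q.hom y z j => m.stasheffSum (p.append (.cons ⟨j, a⟩ q)) := by
  simp only [Op.stasheffSum, Word.sum_splits3_append_cons]
  refine isLinearMap_add (isLinearMap_add (isLinearMap_list_sum _ _ fun s _ => ?_)
    (isLinearMap_list_sum _ _ fun s _ => isLinearMap_list_sum _ _ fun r _ => ?_))
    (isLinearMap_list_sum _ _ fun s _ => ?_)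
  · refine isLinearMap_negOnePow_smul ?_ _
    have := h (s.u.append (.cons (Q.letter (Q.wdeg s.v + 2) (m _ _ s.v)) s.q)) q j
    simpa only [Word.append_assoc, Word.cons_append] using this
  · refine isLinearMap_negOnePow_smul ?_ _
    simp only [wdeg_append, wdeg_cons]
    exact isLinearMap_comp (g := fun a => Q.comp _ (m _ _ (s.2.2.append (.cons ⟨j, a⟩ r.2.1))))
      (h s.2.1 r.2.2 _) (isLinearMap_comp (LinearMap.isLinear (Q.comp _)) (h s.2.2 r.2.1 j))
  · simp only [wdeg_append, wdeg_cons, Word.append_assoc, Word.cons_append]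
    exact isLinearMap_negOnePow_smul (h p _ j) _

theorem negOnePow_smul_smul {V : Type*} [AddCommGroup V] (i j : ℤ) (a : V) :
    i.negOnePow • j.negOnePow • a = (i + j).negOnePow • a := by
  rw [smul_smul, Int.negOnePow_add]

theorem neg_eq_negOnePow_smul {V : Type*} [AddCommGroup V] (a : V) :
    -a = (1 : ℤ).negOnePow • a := by
  rw [Int.negOnePow_one, Units.neg_smul, one_smul]

theorem Form.val_sum {ι : Type*} (Γ : Form Q) {x y : Q.Obj} (l : List ι) (f : ι → Q.Tot x y)
    (c : Q.Tot y x) : Γ.val x y (l.map f).sum c = (l.map fun i => Γ.val x y (f i) c).sum := by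
  rw [← LinearMap.flip_apply, map_list_sum, List.map_map]
  rfl

theorem Form.val_smul (Γ : Form Q) {x y : Q.Obj} (n : ℤ) (a : Q.Tot x y)
    (c : Q.Tot y x) : Γ.val x y (n.negOnePow • a) c = n.negOnePow • Γ.val x y a c := by
  rw [map_zsmul_unit, Units.smul_def, Units.smul_def, LinearMap.smul_apply]

theorem sum_map_congr_smul {V ι : Type*} [AddCommGroup V] (l : List ι) (f g : ι → V) (n : ℤ)
    (h : ∀ i ∈ l, f i = n.negOnePow • g i) : (l.map f).sum = n.negOnePow • (l.map g).sum := by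
  rw [List.smul_sum, List.map_map]
  exact congrArg List.sum (List.map_congr_left h)

/-- For operations that are almost cyclic with respect to a graded antisymmetric form, the pairing
of the Stasheff sum with a further argument is cyclically invariant. In the terms in which the
inner operation is the last argument of the outer one, the two operations exchange their roles. -/
theorem form_stasheffSum_rotate {Γ : Form Q} (hm₀ : ∀ x, m x x (.nil x) = 0)
    (hdeg : ∀ {x y} (p : Word Q.Letter x y) (j : ℤ), j ≠ Q.wdeg p + 2 → Q.comp j (m x y p) = 0)
    (hlin : m.IsMultilinear) (hcyc : AlmostCyclic m Γ)
    (hanti : ∀ {x y} (a : Q.Letter x y) (b : Q.Letter y x),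
      Γ.val x y (Q.incl a.1 a.2) (Q.incl b.1 b.2) =
        -(((a.1 - 1) * (b.1 - 1)).negOnePow • Γ.val y x (Q.incl b.1 b.2) (Q.incl a.1 a.2)))
    {x y z : Q.Obj} (p : Word Q.Letter x y) (b : Q.Letter y z) (c : Q.Letter z x) :
    Γ.val x z (m.stasheffSum (p.append (.single b))) (Q.incl c.1 c.2) =
      ((c.1 - 1) * (Q.wdeg p + (b.1 - 1))).negOnePow •
        Γ.val z y (m.stasheffSum (.cons c p)) (Q.incl b.1 b.2) := by
  have hm : ∀ {x y} (p : Word Q.Letter x y),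
      Q.incl (Q.letter (Q.wdeg p + 2) (m _ _ p)).1 (Q.letter (Q.wdeg p + 2) (m _ _ p)).2 =
        m x y p := fun p => incl_comp_of_homogeneous fun i hi => hdeg p i hi
  have hz : ∀ {x y z t} (p : Word Q.Letter x y) (q : Word Q.Letter z t) (j : ℤ)
      (h : Q.Tot y z), h = 0 → m x t (p.append (.cons (Q.letter j h) q)) = 0 := by
    rintro x y z t p q j _ rfl
    simp only [GradedQuiver.letter, _root_.map_zero]
    exact hlin.map_zero p q j
  -- The operations vanish on the empty word, so in `p · b` the inner operation either ends with `b`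
  -- or lies in `p`, and in `c · p` it either starts with `c` or lies in `p`.
  rw [Op.stasheffSum, Word.single, Word.sum_splits3_append_cons, Op.stasheffSum,
    Word.sum_splits3_cons]
  simp only [Word.splits3, Word.splits, List.map_cons, List.map_nil, List.sum_cons, List.sum_nil,
    List.flatMap_cons, List.flatMap_nil, List.append_nil, add_zero]
  rw [hz _ _ _ _ (hm₀ _), hz _ _ _ _ (hm₀ _), smul_zero, smul_zero, zero_add, add_zero,
    map_add, map_add, LinearMap.add_apply, LinearMap.add_apply, smul_add, add_comm]
  congr 1
  · rw [Form.val_sum, Form.val_sum]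
    refine sum_map_congr_smul _ _ _ _ fun s hs => ?_
    have hp : Q.wdeg p = Q.wdeg s.2.1 + Q.wdeg s.2.2 := by
      rw [← wdeg_append, Word.append_of_mem_splits _ _ hs]
    -- For `p = u · v`, both `Γ(m(u, m(v, b)), c)` and `Γ(m(m(c, u), v), b)` are, up to sign, the
    -- pairing of `m(c, u)` with `m(v, b)`.
    have h₁ := hcyc s.2.1 (Q.letter (Q.wdeg (s.2.2.append (.single b)) + 2)
      (m _ _ (s.2.2.append (.single b)))) c
    have h₂ := hanti (Q.letter (Q.wdeg (.cons c s.2.1) + 2) (m _ _ (.cons c s.2.1)))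
      (Q.letter (Q.wdeg (s.2.2.append (.single b)) + 2) (m _ _ (s.2.2.append (.single b))))
    have h₃ := hcyc s.2.2 b (Q.letter (Q.wdeg (.cons c s.2.1) + 2) (m _ _ (.cons c s.2.1)))
    rw [hm, hm] at h₂
    rw [hm] at h₁ h₃
    simp only [Word.single] at h₁ h₂ h₃
    rw [Form.val_smul, Form.val_smul, h₁, h₂, h₃, neg_eq_negOnePow_smul]
    simp only [negOnePow_smul_smul, Word.nil_append]
    congr 1
    refine negOnePow_congr ?_
    simp only [hp, wdeg_append, wdeg_cons, wdeg_nil, GradedQuiver.letter]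
    push_cast
    grind
  · rw [Form.val_sum, Form.val_sum]
    refine sum_map_congr_smul _ _ _ _ fun s hs => ?_
    have hp : Q.wdeg p = Q.wdeg s.u + (Q.wdeg s.v + Q.wdeg s.q) := by
      rw [← wdeg_append, ← wdeg_append, Word.append_of_mem_splits3 _ _ hs]
    have h₁ := hcyc (s.u.append (.cons (Q.letter (Q.wdeg s.v + 2) (m _ _ s.v)) s.q)) b c
    simp only [Word.single, Word.append_assoc, Word.cons_append] at h₁
    rw [Form.val_smul, Form.val_smul, h₁]
    simp only [negOnePow_smul_smul, Word.cons_append]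
    congr 1
    refine negOnePow_congr ?_
    simp only [hp, wdeg_append, wdeg_cons, GradedQuiver.letter]
    push_cast
    grind

end Stasheff

/-! ### Strict morphisms -/

section StrictMorphisms

variable {Q R S : GradedQuiver.{w} k} {F₀ : Q.Obj → R.Obj} {G₀ : R.Obj → S.Obj}

/-- The map on total spaces induced by maps on homogeneous parts. -/
def totMap (φ : ∀ (x y : Q.Obj) (j : ℤ), Q.hom x y j →ₗ[k] R.hom (F₀ x) (F₀ y) j) (x y : Q.Obj) :
    Q.Tot x y →ₗ[k] R.Tot (F₀ x) (F₀ y) :=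
  DFinsupp.mapRange.linearMap (φ x y)

/-- The map on homogeneous elements induced by maps on homogeneous parts. -/
def letterMap (φ : ∀ (x y : Q.Obj) (j : ℤ), Q.hom x y j →ₗ[k] R.hom (F₀ x) (F₀ y) j) {x y : Q.Obj}
    (a : Q.Letter x y) : R.Letter (F₀ x) (F₀ y) :=
  ⟨a.1, φ x y a.1 a.2⟩

variable (φ : ∀ (x y : Q.Obj) (j : ℤ), Q.hom x y j →ₗ[k] R.hom (F₀ x) (F₀ y) j)
  (ψ : ∀ (x y : R.Obj) (j : ℤ), R.hom x y j →ₗ[k] S.hom (G₀ x) (G₀ y) j)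

@[simp] theorem totMap_incl {x y : Q.Obj} (j : ℤ) (a : Q.hom x y j) :
    totMap φ x y (Q.incl j a) = R.incl j (φ x y j a) :=
  DFinsupp.mapRange_single (hf := fun j => (φ x y j).map_zero)

@[simp] theorem comp_totMap {x y : Q.Obj} (j : ℤ) (a : Q.Tot x y) :
    R.comp j (totMap φ x y a) = φ x y j (Q.comp j a) := rfl

@[simp] theorem wdeg_map_letterMap {x y : Q.Obj} (p : Word Q.Letter x y) :
    R.wdeg (p.map F₀ (letterMap φ)) = Q.wdeg p := Word.weight_map _ _ _ _

theorem letterMap_letter {x y : Q.Obj} (j : ℤ) (a : Q.Tot x y) :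
    letterMap φ (Q.letter j a) = R.letter j (totMap φ x y a) := rfl

/-- A strict map that commutes with the operations commutes with the Stasheff sums. -/
theorem totMap_stasheffSum {m : Op Q} {n : Op R}
    (h : ∀ {x y} (p : Word Q.Letter x y), totMap φ x y (m x y p) =
      n _ _ (p.map F₀ (letterMap φ))) {x y : Q.Obj} (p : Word Q.Letter x y) :
    totMap φ x y (m.stasheffSum p) = n.stasheffSum (p.map F₀ (letterMap φ)) := by
  rw [Op.stasheffSum, Op.stasheffSum, map_list_sum, Word.splits3_map, List.map_map, List.map_map]
  congr 1
  refine List.map_congr_left fun s _ => ?_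
  simp only [Function.comp_apply, map_zsmul_unit, h, Word.map_append, Word.map,
    wdeg_map_letterMap, letterMap_letter]

/-- An `A∞`-structure can be pulled back along a pair of jointly injective strict maps that
commute with the operations. -/
theorem IsAInf.of_jointly_injective {R' : GradedQuiver.{w} k} {F₀' : Q.Obj → R'.Obj}
    (φ' : ∀ (x y : Q.Obj) (j : ℤ), Q.hom x y j →ₗ[k] R'.hom (F₀' x) (F₀' y) j)
    {m : Op Q} {n : Op R} {n' : Op R'} (hn : IsAInf n) (hn' : IsAInf n')
    (h : ∀ {x y} (p : Word Q.Letter x y), totMap φ x y (m x y p) =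
      n _ _ (p.map F₀ (letterMap φ)))
    (h' : ∀ {x y} (p : Word Q.Letter x y), totMap φ' x y (m x y p) =
      n' _ _ (p.map F₀' (letterMap φ')))
    (hinj : ∀ {x y j} (a : Q.hom x y j), φ x y j a = 0 → φ' x y j a = 0 → a = 0) :
    IsAInf m := by
  have hinjT : ∀ {x y} (a : Q.Tot x y), totMap φ x y a = 0 → totMap φ' x y a = 0 → a = 0 := by
    intro x y a h₁ h₂
    refine tot_ext fun j => ?_
    rw [map_zero]
    refine hinj _ ?_ ?_
    · rw [← comp_totMap, h₁, map_zero]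
    · rw [← comp_totMap, h₂, map_zero]
  have hinjE : ∀ {x y} (a b : Q.Tot x y), totMap φ x y a = totMap φ x y b →
      totMap φ' x y a = totMap φ' x y b → a = b := by
    intro x y a b h₁ h₂
    rw [← sub_eq_zero]
    refine hinjT _ ?_ ?_
    · rw [map_sub, h₁, sub_self]
    · rw [map_sub, h₂, sub_self]
  constructor
  · intro x
    refine hinjT _ ?_ ?_
    · rw [h]; exact hn.uncurved _
    · rw [h']; exact hn'.uncurved _
  · intro x y p j hj
    refine hinj _ ?_ ?_
    · rw [← comp_totMap, h]
      exact hn.degree _ _ (by rwa [wdeg_map_letterMap])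
    · rw [← comp_totMap, h']
      exact hn'.degree _ _ (by rwa [wdeg_map_letterMap])
  · intro x y z t p q j
    constructor
    · intro a b
      refine hinjE _ _ ?_ ?_
      · simp only [map_add, h, Word.map_append, Word.map, letterMap]
        exact (hn.linear _ _ j).map_add _ _
      · simp only [map_add, h', Word.map_append, Word.map, letterMap]
        exact (hn'.linear _ _ j).map_add _ _
    · intro c a
      refine hinjE _ _ ?_ ?_
      · simp only [map_smul, h, Word.map_append, Word.map, letterMap]
        exact (hn.linear _ _ j).map_smul _ _
      · simp only [map_smul, h', Word.map_append, Word.map, letterMap]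
        exact (hn'.linear _ _ j).map_smul _ _
  · intro x y p
    refine hinjT (m.stasheffSum p) ?_ ?_
    · rw [totMap_stasheffSum φ h]; exact hn.stasheff _
    · rw [totMap_stasheffSum φ' h']; exact hn'.stasheff _

/-- Almost cyclicity can be pulled back along a strict map that commutes with the operations and
preserves the bilinear forms; the map need not be injective. -/
theorem AlmostCyclic.of_isometry {m : Op Q} {n : Op R} {Γ : Form Q} {Γ' : Form R}
    (hn : AlmostCyclic n Γ')
    (h : ∀ {x y} (p : Word Q.Letter x y), totMap φ x y (m x y p) =
      n _ _ (p.map F₀ (letterMap φ)))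
    (hΓ : ∀ {x y} (a : Q.Tot x y) (b : Q.Tot y x),
      Γ'.val _ _ (totMap φ x y a) (totMap φ y x b) = Γ.val x y a b) : AlmostCyclic m Γ := by
  intro x y z p b c
  have := hn (p.map F₀ (letterMap φ)) (letterMap φ b) (letterMap φ c)
  rw [wdeg_map_letterMap] at this
  rw [← hΓ, ← hΓ, h, h, totMap_incl, totMap_incl, Word.map_append]
  exact this

theorem ofLinear_cons_append_cons {x y z t v : Q.Obj} (b : Q.Letter x y) (p : Word Q.Letter y z)
    (a : Q.Letter z t) (q : Word Q.Letter t v) :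
    MorOp.ofLinear φ x v ((Word.cons b p).append (.cons a q)) = 0 := by
  cases p <;> rfl

theorem ofLinear_cons_cons {x y z t : Q.Obj} (b : Q.Letter x y) (a : Q.Letter y z)
    (q : Word Q.Letter z t) : MorOp.ofLinear φ x t (.cons b (.cons a q)) = 0 := rfl

theorem ofLinear_isLinearMap {x y z t : Q.Obj} (p : Word Q.Letter x y) (q : Word Q.Letter z t)
    (j : ℤ) : IsLinearMap k fun a : Q.hom y z j =>
      MorOp.ofLinear φ x t (p.append (.cons ⟨j, a⟩ q)) := by
  have hz : IsLinearMap k fun _ : Q.hom y z j => (0 : R.Tot (F₀ x) (F₀ t)) :=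
    ⟨fun _ _ => (add_zero _).symm, fun _ _ => (smul_zero _).symm⟩
  cases p with
  | nil x =>
    cases q with
    | nil z => exact (R.incl j ∘ₗ φ _ _ j).isLinear
    | cons b q => exact hz
  | cons b p =>
    simp only [ofLinear_cons_append_cons]
    exact hz

theorem ofLinear_letter_single {x y : Q.Obj} (a : Q.Letter x y) :
    (MorOp.ofLinear φ).letter (.single a) = letterMap φ a := by
  have : Q.wdeg (.single a) + 1 = a.1 := by
    simp only [Word.single, wdeg_cons, wdeg_nil]; ring
  rw [MorOp.letter, this]
  exact Sigma.ext rfl (heq_of_eq (comp_incl_same _ _ _))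

theorem sum_map_eq_zero {V ι : Type*} [AddCommMonoid V] (l : List ι) (f : ι → V)
    (h : ∀ i ∈ l, f i = 0) : (l.map f).sum = 0 := by
  refine List.sum_eq_zero fun a ha => ?_
  obtain ⟨i, hi, rfl⟩ := List.mem_map.1 ha
  exact h i hi

/-- For a strict morphism, only the decomposition into letters contributes to the bar
construction. -/
theorem sum_bar_ofLinear {V : Type*} [AddCommMonoid V] {x y : Q.Obj}
    (G : Word R.Letter (F₀ x) (F₀ y) → V)
    (hG : ∀ {z t : R.Obj} (p : Word R.Letter (F₀ x) z) (q : Word R.Letter t (F₀ y)) (j : ℤ),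
      G (p.append (.cons ⟨j, (0 : R.hom z t j)⟩ q)) = 0) (p : Word Q.Letter x y) :
    (((MorOp.ofLinear φ).bar p).map G).sum = G (p.map F₀ (letterMap φ)) := by
  have hz : ∀ {z t v s : Q.Obj} (P : Word R.Letter (F₀ x) (F₀ z)) (b : Q.Letter z v)
      (a : Q.Letter v s) (r : Word Q.Letter s t) (q : Word R.Letter (F₀ t) (F₀ y)),
      G (P.append (.cons ((MorOp.ofLinear φ).letter (.cons b (.cons a r))) q)) = 0 := by
    intro z t v s P b a r q
    rw [MorOp.letter, ofLinear_cons_cons, GradedQuiver.letter, map_zero]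
    exact hG _ _ _
  -- The decompositions whose first piece has at least two letters contribute zero.
  have h₁ : ∀ {z t v s : Q.Obj} (P : Word R.Letter (F₀ x) (F₀ z)) (b : Q.Letter z v)
      (a : Q.Letter v s) (r : Word Q.Letter s t) (q : Word Q.Letter t y),
      (((MorOp.ofLinear φ).barAux (.cons b (.cons a r)) q).map fun w => G (P.append w)).sum =
        0 := by
    intro z t v s P b a r q
    induction q with
    | nil t => simpa [MorOp.barAux, Word.single] using hz P b a r (.nil _)
    | cons c q ih =>
      rw [MorOp.barAux, List.map_append, List.sum_append, List.map_map]
      refine (congrArg₂ (· + ·) (ih G hG p hz (r.append (.single c)))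
        (sum_map_eq_zero _ _ fun i _ => hz P b a r i)).trans (add_zero _)
  have h₂ : ∀ {z t : Q.Obj} (P : Word R.Letter (F₀ x) (F₀ z)) (a : Q.Letter z t)
      (q : Word Q.Letter t y),
      (((MorOp.ofLinear φ).barAux (.single a) q).map fun w => G (P.append w)).sum =
        G (P.append (.cons (letterMap φ a) (q.map F₀ (letterMap φ)))) := by
    intro z t P a q
    induction q generalizing z with
    | nil t =>
      simp only [MorOp.barAux, List.map_cons, List.map_nil, List.sum_cons, List.sum_nil, add_zero,
        ofLinear_letter_single]
      rfl
    | cons c q ih =>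
      rw [MorOp.barAux, List.map_append, List.sum_append, List.map_map]
      refine (congrArg₂ (· + ·) (h₁ P a c (.nil _) q) ?_).trans (zero_add _)
      have := ih G hG p hz h₁ (P.append (.single (letterMap φ a))) c
      simp only [Word.append_assoc] at this
      rw [ofLinear_letter_single]
      exact this
  cases p with
  | nil x => simp only [MorOp.bar, List.map_cons, List.map_nil, List.sum_cons, List.sum_nil,
      add_zero]; rfl
  | cons a p => exact h₂ (.nil _) a p

/-- For a strict morphism, only the innermost operation on the whole word contributes. -/
theorem sum_splits3_eq_of_vanish {V : Type*} [AddCommMonoid V] {x y : Q.Obj}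
    (p : Word Q.Letter x y) (f : Word.Split3 Q.Letter x y → V)
    (hl : ∀ {z t v} (a : Q.Letter x z) (u : Word Q.Letter z t) (r : Word Q.Letter t v)
      (q : Word Q.Letter v y), f ⟨.cons a u, r, q⟩ = 0)
    (hr : ∀ {z t} (r : Word Q.Letter x z) (a : Q.Letter z t) (q : Word Q.Letter t y),
      f ⟨.nil x, r, .cons a q⟩ = 0) :
    (p.splits3.map f).sum = f ⟨.nil x, p, .nil y⟩ := by
  have hs : ∀ {z} (q : Word Q.Letter z y) (g : (Σ t, Word Q.Letter z t × Word Q.Letter t y) → V)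
      (_ : ∀ {t v} (r : Word Q.Letter z t) (a : Q.Letter t v) (q : Word Q.Letter v y),
        g ⟨t, r, .cons a q⟩ = 0), (q.splits.map g).sum = g ⟨y, q, .nil y⟩ := by
    intro z q
    induction q with
    | nil z => intro g _; simp [Word.splits]
    | cons a q ih =>
      intro g hg
      rw [Word.splits, List.map_cons, List.sum_cons, List.map_map, hg, zero_add]
      exact ih p f hl hr (fun s => g ⟨s.1, .cons a s.2.1, s.2.2⟩)
        fun r b q => hg (.cons a r) b q
  cases p with
  | nil x => simp [Word.splits3, Word.splits]
  | cons a p =>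
    rw [Word.sum_splits3_cons, hr, zero_add]
    refine (congrArg₂ (· + ·) ?_ (sum_map_eq_zero _ _ fun s _ => hl a s.u s.v s.q)).trans
      (add_zero _)
    exact hs p (fun s => f ⟨.nil x, .cons a s.2.1, s.2.2⟩) fun r b q => hr (.cons a r) b q

/-- A strict map that commutes with the operations is an `A∞`-morphism: on both sides of the
defining identity a single term is left. -/
theorem isAInfMor_ofLinear {m : Op Q} {n : Op R} (hm : IsAInf m) (hn : IsAInf n)
    (h : ∀ {x y} (p : Word Q.Letter x y), totMap φ x y (m x y p) =
      n _ _ (p.map F₀ (letterMap φ))) : IsAInfMor m n (MorOp.ofLinear φ) := by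
  constructor
  · intro x; rfl
  · intro x y p j hj
    match p, hj with
    | .nil x, _ => exact map_zero _
    | .cons a (.nil _), hj =>
      refine R.comp_incl_ne (Ne.symm ?_) _
      simpa using hj
    | .cons a (.cons b p), _ => exact map_zero _
  · exact ofLinear_isLinearMap φ
  · intro x y p
    rw [sum_bar_ofLinear φ (n _ _) (fun p q j => (hn.linear p q j).map_zero),
      sum_splits3_eq_of_vanish, ← h]
    · simp only [wdeg_nil, Int.negOnePow_zero, one_smul, Word.nil_append]
      refine (totMap_incl φ _ _).symm.trans ?_
      exact congrArg _ (incl_comp_of_homogeneous fun i hi => hm.degree p i hi)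
    · intro z t v a u r q
      exact (congrArg _ (ofLinear_cons_append_cons φ _ _ _ _)).trans (smul_zero _)
    · intro z t r a q
      exact (congrArg _ (ofLinear_cons_cons φ _ _ _)).trans (smul_zero _)

theorem ofLinear_isStrict : (MorOp.ofLinear φ).IsStrict := by
  intro x y p hp
  match p, hp with
  | .nil x, _ => rfl
  | .cons a (.nil _), hp => exact absurd rfl hp
  | .cons a (.cons b p), _ => rfl

/-- The condition on words of length at least `3` is void for a strict morphism, as one of the two
parts of such a word has length different from `1`. -/
theorem ofLinear_isCyclic {γ : Form Q} {Γ : Form R}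
    (hΓ : ∀ {x y} (a : Q.Tot x y) (b : Q.Tot y x),
      Γ.val _ _ (totMap φ x y a) (totMap φ y x b) = γ.val x y a b) :
    (MorOp.ofLinear φ).IsCyclic γ Γ := by
  constructor
  · intro x y a b
    rw [← hΓ, totMap_incl, totMap_incl]
    rfl
  · intro x p hp
    refine sum_map_eq_zero _ _ fun s hs => ?_
    have hlen : ∀ {x y z : Q.Obj} (p : Word Q.Letter x y) (q : Word Q.Letter y z),
        (p.append q).length = p.length + q.length := by
      intro x y z p q
      induction p with
      | nil x => exact (Nat.zero_add _).symm
      | cons a p ih => simp only [Word.cons_append, Word.length, ih]; omega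
    have := hlen s.2.1 s.2.2
    rw [Word.append_of_mem_splits _ _ hs] at this
    by_cases h₁ : s.2.1.length = 1
    · rw [ofLinear_isStrict φ s.2.2 (by omega), map_zero]
    · rw [ofLinear_isStrict φ s.2.1 h₁, map_zero, LinearMap.zero_apply]

theorem comp_ofLinear : (MorOp.ofLinear φ).comp (MorOp.ofLinear ψ) =
    MorOp.ofLinear (F₀ := fun x => G₀ (F₀ x)) fun x y j => ψ _ _ j ∘ₗ φ x y j := by
  funext x y p
  rw [MorOp.comp, sum_bar_ofLinear φ _ fun p q j => (ofLinear_isLinearMap ψ p q j).map_zero]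
  match p with
  | .nil x => rfl
  | .cons a (.nil _) => rfl
  | .cons a (.cons b p) => rfl

end StrictMorphisms

/-! ### The quiver `A ⊕ B^*[d-1]` and its bilinear form -/

/-- Linear maps on the total spaces of a quiver. -/
abbrev TotHom (Q : GradedQuiver.{w} k) (x y : Q.Obj) (V : Type*) [AddCommMonoid V] [Module k V] :=
  Q.Tot x y →ₗ[k] V

/-- Degree-preserving linear maps over a map between the sets of objects. -/
abbrev HomMap (Q R : GradedQuiver.{w} k) (F₀ : Q.Obj → R.Obj) :=
  ∀ (x y : Q.Obj) (j : ℤ), Q.hom x y j →ₗ[k] R.hom (F₀ x) (F₀ y) j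

theorem tot_induction {Q : GradedQuiver.{w} k} {x y : Q.Obj} {P : Q.Tot x y → Prop}
    (incl : ∀ j a, P (Q.incl j a)) (add : ∀ a b, P a → P b → P (a + b)) (a : Q.Tot x y) : P a := by
  refine DirectSum.induction_on a ?_ incl add
  have := incl 0 0
  rwa [map_zero] at this

section Mix

variable {A B : GradedQuiver.{w} k} {g : A.Obj → B.Obj} {d : ℤ}

/-- The projection of `A ⊕ B^*[d-1]` to `A`. -/
def mixFst {x y : A.Obj} : TotHom (mix A B g d) x y (A.Tot x y) :=
  DFinsupp.mapRange.linearMap fun j => LinearMap.fst k (A.hom x y j) (B.dualHom d (g x) (g y) j)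

/-- The projection of `A ⊕ B^*[d-1]` to `B^*[d-1]`, with values considered as linear forms on the
total spaces of `B`. -/
def mixSnd {x y : A.Obj} : TotHom (mix A B g d) x y (B.Tot (g y) (g x) →ₗ[k] k) :=
  DirectSum.toModule k ℤ _ fun j => LinearMap.lcomp k k (B.comp (-(j + d - 1))) ∘ₗ
    LinearMap.snd k (A.hom x y j) (B.dualHom d (g x) (g y) j)

@[simp] theorem mixFst_incl {x y : A.Obj} (j : ℤ) (a : (mix A B g d).hom x y j) :
    mixFst ((mix A B g d).incl j a) = A.incl j a.1 :=
  DFinsupp.mapRange_single (hf := fun _ => rfl)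

@[simp] theorem mixSnd_incl {x y : A.Obj} (j : ℤ) (a : (mix A B g d).hom x y j) :
    mixSnd ((mix A B g d).incl j a) = B.ev (d := d) ⟨j, a.2⟩ :=
  DirectSum.toModule_lof k j a

theorem fst_comp {x y : A.Obj} (j : ℤ) (X : (mix A B g d).Tot x y) :
    ((mix A B g d).comp j X).1 = A.comp j (mixFst X) := rfl

theorem ev_incl {x y : A.Obj} (f : A.DLetter d x y) (b : A.hom y x (-(f.1 + d - 1))) :
    A.ev f (A.incl _ b) = f.2 b := by
  rw [ev, LinearMap.comp_apply, comp_incl_same]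

theorem ev_incl_ne {x y : A.Obj} (f : A.DLetter d x y) {j : ℤ} (h : f.1 + j + d - 1 ≠ 0)
    (b : A.hom y x j) : A.ev f (A.incl _ b) = 0 := by
  rw [ev, LinearMap.comp_apply, comp_incl_ne _ (by omega), map_zero]

/-- Components in `B^*[d-1]` are recovered from the linear form on the total space. -/
theorem snd_comp {x y : A.Obj} (j : ℤ) (X : (mix A B g d).Tot x y)
    (b : B.hom (g y) (g x) (-(j + d - 1))) :
    ((mix A B g d).comp j X).2 b = mixSnd X (B.incl _ b) := by
  induction X using tot_induction with
  | incl i a =>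
    rw [mixSnd_incl]
    by_cases h : i = j
    · subst h
      rw [comp_incl_same]
      exact (ev_incl (⟨i, a.2⟩ : B.DLetter d (g x) (g y)) b).symm
    · rw [comp_incl_ne _ h, ev_incl_ne _ (by simp only; omega)]
      rfl
  | add X Y hX hY =>
    rw [map_add, map_add, LinearMap.add_apply, ← hX, ← hY]
    rfl

theorem mix_eq_zero {x y : A.Obj} {X : (mix A B g d).Tot x y} (h₁ : mixFst X = 0)
    (h₂ : mixSnd X = 0) : X = 0 := by
  refine tot_ext fun j => Prod.ext ?_ (LinearMap.ext fun b => ?_)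
  · rw [fst_comp, h₁, map_zero, map_zero]; rfl
  · rw [snd_comp, h₂, map_zero]; rfl

theorem mix_ext {x y : A.Obj} {X Y : (mix A B g d).Tot x y} (h₁ : mixFst X = mixFst Y)
    (h₂ : mixSnd X = mixSnd Y) : X = Y := by
  rw [← sub_eq_zero]
  refine mix_eq_zero ?_ ?_
  · rw [map_sub, h₁, sub_self]
  · rw [map_sub, h₂, sub_self]

/-- A homogeneous linear form is determined by its degree and its values. The degree has to be
given, since the zero linear form has every degree. -/
theorem dletter_ext {x y : A.Obj} {f f' : A.DLetter d x y} (h₁ : f.1 = f'.1)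
    (h₂ : A.ev f = A.ev f') : f = f' := by
  obtain ⟨i, f⟩ := f
  obtain ⟨i', f'⟩ := f'
  obtain rfl : i = i' := h₁
  congr 1
  refine LinearMap.ext fun b => ?_
  rw [← ev_incl (⟨i, f⟩ : A.DLetter d x y), h₂, ev_incl]

theorem tot_incl (Φ : QuiverHom A B) {x y : A.Obj} (j : ℤ) (a : A.hom x y j) :
    Φ.tot x y (A.incl j a) = B.incl j (Φ.map x y j a) := totMap_incl Φ.map j a

theorem ev_dual (Φ : QuiverHom A B) {x y : A.Obj} (f : B.DLetter d (Φ.obj x) (Φ.obj y)) :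
    A.ev (Φ.dual f) = B.ev f ∘ₗ Φ.tot y x := rfl

theorem mixPair_apply (Φ : QuiverHom A B) (x y : A.Obj) (i j : ℤ)
    (a : (mix A B Φ.obj d).hom x y i) (b : (mix A B Φ.obj d).hom y x j) :
    mixPair Φ d x y i j a b =
      B.ev (⟨i, a.2⟩ : B.DLetter d (Φ.obj x) (Φ.obj y)) (B.incl j (Φ.map y x j b.1)) := rfl

theorem mixForm_incl_incl (Φ : QuiverHom A B) (x y : A.Obj) (i j : ℤ)
    (a : (mix A B Φ.obj d).hom x y i) (b : (mix A B Φ.obj d).hom y x j) :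
    (mixForm Φ d).val x y ((mix A B Φ.obj d).incl i a) ((mix A B Φ.obj d).incl j b) =
      i.negOnePow • mixPair Φ d x y i j a b -
        ((i - 1) * (j - 1) + j).negOnePow • mixPair Φ d y x j i b a := by
  simp only [mixForm, GradedQuiver.incl, DirectSum.toModule_lof, LinearMap.flip_apply,
      LinearMap.sub_apply, Units.smul_def, LinearMap.smul_apply]

theorem negOnePow_smul_sub_smul {V : Type*} [AddCommGroup V] (i j : ℤ) (a b : V) :
    i.negOnePow • a - ((i - 1) * (j - 1) + j).negOnePow • b =
      -(((i - 1) * (j - 1)).negOnePow •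
        (j.negOnePow • b - ((j - 1) * (i - 1) + i).negOnePow • a)) := by
  have : (i - 1) * (j - 1) + ((j - 1) * (i - 1) + i) = i + 2 * ((i - 1) * (j - 1)) := by ring
  rw [smul_sub, negOnePow_smul_smul, negOnePow_smul_smul, neg_sub, this,
    Int.negOnePow_add i, Int.negOnePow_two_mul, mul_one]

/-- The mixed form is graded antisymmetric. -/
theorem mixForm_antisymm (Φ : QuiverHom A B) {x y : A.Obj} (a : (mix A B Φ.obj d).Letter x y)
    (b : (mix A B Φ.obj d).Letter y x) :
    (mixForm Φ d).val x y ((mix A B Φ.obj d).incl a.1 a.2) ((mix A B Φ.obj d).incl b.1 b.2) =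
      -(((a.1 - 1) * (b.1 - 1)).negOnePow • (mixForm Φ d).val y x
        ((mix A B Φ.obj d).incl b.1 b.2) ((mix A B Φ.obj d).incl a.1 a.2)) := by
  rw [mixForm_incl_incl, mixForm_incl_incl]
  exact negOnePow_smul_sub_smul _ _ _ _

/-- The value of the `Φ`-mixed form when the second argument is homogeneous, with signs that
depend only on the degree of the second argument. -/
theorem mixForm_val (Φ : QuiverHom A B) {x y : A.Obj} (X : (mix A B Φ.obj d).Tot x y) (j : ℤ)
    (b : (mix A B Φ.obj d).hom y x j) :
    (mixForm Φ d).val x y X ((mix A B Φ.obj d).incl j b) =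
      (d + 1 + j).negOnePow • mixSnd X (B.incl j (Φ.map y x j b.1)) +
        (d * j + d + j + 1).negOnePow •
          B.ev (⟨j, b.2⟩ : B.DLetter d (Φ.obj y) (Φ.obj x)) (Φ.tot x y (mixFst X)) := by
  have hj := zmod_two_mul_self j
  induction X using tot_induction with
  | incl i a =>
    rw [mixForm_incl_incl, mixPair_apply, mixPair_apply, mixSnd_incl, mixFst_incl, tot_incl]
    by_cases h : i + j + d - 1 = 0
    · rw [sub_eq_add_neg, neg_eq_negOnePow_smul, negOnePow_smul_smul]
      obtain rfl : i = 1 - d - j := by omega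
      congr 2
      · refine negOnePow_congr ?_
        push_cast
        grind
      · refine negOnePow_congr ?_
        push_cast
        grind
    · rw [ev_incl_ne _ (by simp only; omega), ev_incl_ne _ (by simp only; omega), smul_zero,
        smul_zero, smul_zero, smul_zero, sub_zero, add_zero]
  | add X Y hX hY =>
    rw [map_add, LinearMap.add_apply, hX, hY, map_add mixSnd, LinearMap.add_apply,
      map_add mixFst, map_add, map_add, smul_add, smul_add, add_add_add_comm]

/-- Linear maps of mixed quivers which preserve the pairings preserve the mixed forms. -/
theorem mixForm_isometry {A' B' : GradedQuiver.{w} k} (Φ : QuiverHom A B) (Φ' : QuiverHom A' B')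
    {F₀ : A.Obj → A'.Obj}
    (φ : HomMap (mix A B Φ.obj d) (mix A' B' Φ'.obj d) F₀)
    (h : ∀ {x y i j} (a : (mix A B Φ.obj d).hom x y i) (b : (mix A B Φ.obj d).hom y x j),
      mixPair Φ' d _ _ i j (φ x y i a) (φ y x j b) = mixPair Φ d x y i j a b)
    {x y : A.Obj} (a : (mix A B Φ.obj d).Tot x y) (b : (mix A B Φ.obj d).Tot y x) :
    (mixForm Φ' d).val _ _ (totMap φ x y a) (totMap φ y x b) = (mixForm Φ d).val x y a b := by
  induction a using tot_induction with
  | incl i a =>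
    induction b using tot_induction with
    | incl j b => rw [totMap_incl, totMap_incl, mixForm_incl_incl, mixForm_incl_incl, h, h]
    | add X Y hX hY => rw [map_add, map_add, map_add, hX, hY]
  | add X Y hX hY =>
    rw [map_add, map_add, map_add, LinearMap.add_apply, LinearMap.add_apply, hX, hY]

/-- `Hom`-finiteness enters only here: the parts of `A ⊕ A^*[d-1]` in complementary degrees have the
same finite dimension, so that it suffices to prove injectivity. -/
theorem mixForm_id_nondegenerate (hA : A.HomFinite) :
    (mixForm (QuiverHom.id A) d).Nondegenerate := by
  have hfin : ∀ x y j, Module.Finite k (A.hom x y j) := fun x y j => by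
    have := hA x y
    exact Module.Finite.of_surjective (A.comp j) fun a => ⟨A.incl j a, comp_incl_same A j a⟩
  intro x y i j h
  have hd : i + j + (d - 1) = 0 := h
  have hrank : Module.finrank k ((mix A A (QuiverHom.id A).obj d).hom x y i) =
      Module.finrank k (Module.Dual k ((mix A A (QuiverHom.id A).obj d).hom y x j)) := by
    obtain rfl : j = -(i + d - 1) := by omega
    have : -(-(i + d - 1) + d - 1) = i := by omega
    rw [Subspace.dual_finrank_eq]
    refine (Module.finrank_prod (R := k)).trans (Eq.trans ?_ (Module.finrank_prod (R := k)).symm)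
    rw [Subspace.dual_finrank_eq, Subspace.dual_finrank_eq, this, add_comm]
    rfl
  refine ⟨?inj, (LinearMap.injective_iff_surjective_of_finrank_eq_finrank hrank).1 ?inj⟩
  refine (injective_iff_map_eq_zero _).2 fun a ha => ?_
  have hX : ∀ b, (mixForm (QuiverHom.id A) d).val x y ((mix A A (QuiverHom.id A).obj d).incl i a)
      ((mix A A (QuiverHom.id A).obj d).incl j b) = 0 := fun b => LinearMap.congr_fun ha b
  obtain rfl : j = -(i + d - 1) := by omega
  refine Prod.ext ?_ (LinearMap.ext fun b => ?_)
  · refine (Module.forall_dual_apply_eq_zero_iff k _).1 fun f => ?_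
    have e : i = -(-(i + d - 1) + d - 1) := by omega
    have h₁ := hX (0, f ∘ₗ A.comp i ∘ₗ A.incl _)
    rw [mixForm_val, map_zero, map_zero, map_zero, smul_zero, zero_add, mixFst_incl, tot_incl,
      smul_eq_zero_iff_eq] at h₁
    have h₂ : A.incl (-(-(i + d - 1) + d - 1)) (A.comp _ (A.incl i a.1)) = A.incl i a.1 :=
      incl_comp_of_homogeneous fun j hj => comp_incl_ne _ (by omega) _
    have h₃ : f (A.comp i (A.incl (-(-(i + d - 1) + d - 1)) (A.comp _ (A.incl i a.1)))) = 0 := h₁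
    rwa [h₂, comp_incl_same] at h₃
  · have h₁ := hX (b, 0)
    rw [mixForm_val, mixSnd_incl] at h₁
    have h₂ : (d + 1 + -(i + d - 1)).negOnePow •
        A.ev (⟨i, a.2⟩ : A.DLetter d x y) (A.incl _ b) = 0 := by
      refine Eq.trans ?_ h₁
      exact (add_zero _).symm.trans (congrArg₂ _ rfl (smul_zero _).symm)
    rw [smul_eq_zero_iff_eq] at h₂
    exact (ev_incl (⟨i, a.2⟩ : A.DLetter d x y) b).symm.trans h₂

end Mix

/-! ### Expansion of words in `A ⊕ B^*[d-1]` -/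

/-- A function on words is linear in each letter. -/
def WordLinear {Q : GradedQuiver.{w} k} {x t : Q.Obj} {V : Type*} [AddCommMonoid V] [Module k V]
    (G : Word Q.Letter x t → V) : Prop :=
  ∀ {y z} (p : Word Q.Letter x y) (q : Word Q.Letter z t) (j : ℤ),
    IsLinearMap k fun a : Q.hom y z j => G (p.append (.cons ⟨j, a⟩ q))

/-- A property of words is preserved by addition of letters. -/
def WordAdditive {Q : GradedQuiver.{w} k} {x t : Q.Obj} (P : Word Q.Letter x t → Prop) : Prop :=
  ∀ {y z} (p : Word Q.Letter x y) (q : Word Q.Letter z t) (j : ℤ) (a b : Q.hom y z j),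
    P (p.append (.cons ⟨j, a⟩ q)) → P (p.append (.cons ⟨j, b⟩ q)) →
      P (p.append (.cons ⟨j, a + b⟩ q))

theorem totHom_list_sum {Q : GradedQuiver.{w} k} {x y : Q.Obj} {V ι : Type*} [AddCommMonoid V]
    [Module k V] (f : TotHom Q x y V) (l : List ι) (F : ι → Q.Tot x y) :
    f (l.map F).sum = (l.map fun i => f (F i)).sum := by
  rw [map_list_sum, List.map_map]
  rfl

section Expand

variable {A B A' B' : GradedQuiver.{w} k} {g : A.Obj → B.Obj} {g' : A'.Obj → B'.Obj} {d : ℤ}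

/-- A function on words whose letters belong to `A` or `B^*[d-1]` is linear in each letter. -/
structure PureLinear {x t : A.Obj} {V : Type*} [AddCommMonoid V] [Module k V]
    (H : MWord A B g d x t → V) : Prop where
  inl : ∀ {y z} (p : MWord A B g d x y) (q : MWord A B g d z t) (j : ℤ),
    IsLinearMap k fun a : A.hom y z j => H (p.append (.cons (.inl ⟨j, a⟩) q))
  inr : ∀ {y z} (p : MWord A B g d x y) (q : MWord A B g d z t) (j : ℤ),
    IsLinearMap k fun f : B.dualHom d (g y) (g z) j => H (p.append (.cons (.inr ⟨j, f⟩) q))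

/-- A letter in `A` or in `B^*[d-1]` as a letter in `A ⊕ B^*[d-1]`. -/
def pureLetter {x y : A.Obj} : PLetter A B g d x y → (mix A B g d).Letter x y
  | .inl a => ⟨a.1, a.2, 0⟩
  | .inr f => ⟨f.1, 0, f.2⟩

/-- A word whose letters belong to `A` or `B^*[d-1]` as a word in `A ⊕ B^*[d-1]`. -/
def emb {x y : A.Obj} (p : MWord A B g d x y) : Word (mix A B g d).Letter x y :=
  p.map (fun x => x) pureLetter

@[simp] theorem emb_nil (x : A.Obj) : emb (.nil x : MWord A B g d x x) = .nil x := rfl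

@[simp] theorem emb_cons {x y z : A.Obj} (a : PLetter A B g d x y) (p : MWord A B g d y z) :
    emb (.cons a p) = .cons (pureLetter a) (emb p) := rfl

theorem emb_append {x y z : A.Obj} (p : MWord A B g d x y) (q : MWord A B g d y z) :
    emb (p.append q) = (emb p).append (emb q) := Word.map_append _ _ _ _

theorem wdeg_emb {x y : A.Obj} (p : MWord A B g d x y) :
    (mix A B g d).wdeg (emb p) = pdeg p := by
  induction p with
  | nil x => rfl
  | cons a p ih => rw [emb_cons, wdeg_cons, ih]; cases a <;> rfl

/-- A property which is preserved by addition of letters holds for all words as soon as it holds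
for those whose letters belong to `A` or `B^*[d-1]`. -/
theorem emb_induction {x t : A.Obj} {P : Word (mix A B g d).Letter x t → Prop}
    (pure : ∀ p, P (emb p)) (add : WordAdditive P) (p : Word (mix A B g d).Letter x t) : P p := by
  have key : ∀ {y} (q : Word (mix A B g d).Letter y t) (p : MWord A B g d x y),
      P ((emb p).append q) := by
    intro y q
    induction q with
    | nil t => intro p; rw [Word.append_nil]; exact pure p
    | @cons y z t a q ih =>
      intro r
      obtain ⟨j, a, f⟩ := a
      -- The letter is the sum of its components in `A` and in `B^*[d-1]`.
      have h₁ := ih pure add p (r.append (.single (.inl ⟨j, a⟩)))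
      have h₂ := ih pure add p (r.append (.single (.inr ⟨j, f⟩)))
      rw [emb_append, Word.append_assoc] at h₁ h₂
      have := add (emb r) q j _ _ h₁ h₂
      have e : ((a, 0) : (mix A B g d).hom y z j) + (0, f) = (a, f) :=
        Prod.ext (add_zero a) (zero_add f)
      rwa [e] at this
  exact key p (.nil x)

theorem pdeg_of_mem_expand {x y : A.Obj} (p : Word (mix A B g d).Letter x y) :
    ∀ q ∈ expand p, pdeg q = (mix A B g d).wdeg p := by
  induction p with
  | nil x => intro q hq; rw [expand, List.mem_singleton] at hq; rw [hq]; rfl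
  | cons a p ih =>
    intro q hq
    simp only [expand, List.mem_flatMap] at hq
    obtain ⟨r, hr, hq⟩ := hq
    simp only [List.mem_cons, List.not_mem_nil, or_false] at hq
    rw [wdeg_cons, ← ih r hr]
    rcases hq with rfl | rfl <;> rfl

theorem sum_expand_cons {x y z : A.Obj} {V : Type*} [AddCommMonoid V]
    (H : MWord A B g d x z → V) (a : (mix A B g d).Letter x y)
    (p : Word (mix A B g d).Letter y z) :
    ((expand (.cons a p)).map H).sum = ((expand p).map fun q =>
      H (.cons (.inl ⟨a.1, a.2.1⟩) q) + H (.cons (.inr ⟨a.1, a.2.2⟩) q)).sum := by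
  rw [expand, Word.sum_flatMap_map]
  simp

variable {V : Type*} [AddCommGroup V] [Module k V]

theorem PureLinear.cons {x y t : A.Obj} {H : MWord A B g d x t → V} (hH : PureLinear H)
    (a : PLetter A B g d x y) : PureLinear fun q : MWord A B g d y t => H (.cons a q) :=
  ⟨fun p q j => hH.inl (.cons a p) q j, fun p q j => hH.inr (.cons a p) q j⟩

theorem PureLinear.add {x t : A.Obj} {H H' : MWord A B g d x t → V} (hH : PureLinear H)
    (hH' : PureLinear H') : PureLinear fun q => H q + H' q :=
  ⟨fun p q j => isLinearMap_add (hH.inl p q j) (hH'.inl p q j),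
    fun p q j => isLinearMap_add (hH.inr p q j) (hH'.inr p q j)⟩

/-- Summing over the expansion extends a function that is linear in each letter from words whose
letters belong to `A` or `B^*[d-1]` to all words. -/
theorem PureLinear.sum_expand {x t : A.Obj} {H : MWord A B g d x t → V} (hH : PureLinear H) :
    WordLinear fun p : Word (mix A B g d).Letter x t => ((expand p).map H).sum := by
  intro y z p q j
  induction p with
  | nil x =>
    refine isLinearMap_congr ?_ fun a => sum_expand_cons H ⟨j, a⟩ q
    refine isLinearMap_list_sum _ (fun r (a : (mix A B g d).hom _ _ j) =>
      H (.cons (.inl ⟨j, a.1⟩) r) + H (.cons (.inr ⟨j, a.2⟩) r)) fun r _ => isLinearMap_add ?_ ?_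
    · exact ⟨fun a b => (hH.inl (.nil _) r j).map_add a.1 b.1,
        fun c a => (hH.inl (.nil _) r j).map_smul c a.1⟩
    · exact ⟨fun a b => (hH.inr (.nil _) r j).map_add a.2 b.2,
        fun c a => (hH.inr (.nil _) r j).map_smul c a.2⟩
  | cons b p ih =>
    exact isLinearMap_congr (ih ((hH.cons (.inl ⟨b.1, b.2.1⟩)).add (hH.cons (.inr ⟨b.1, b.2.2⟩))))
      fun a => sum_expand_cons H b (p.append (.cons ⟨j, a⟩ q))

theorem PureLinear.sum_expand_emb {x t : A.Obj} {H : MWord A B g d x t → V} (hH : PureLinear H)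
    (p : MWord A B g d x t) : ((expand (emb p)).map H).sum = H p := by
  induction p with
  | nil x => rw [emb_nil, expand, List.map_singleton, List.sum_singleton]
  | cons a p ih =>
    rw [emb_cons, sum_expand_cons]
    rcases a with a | f
    · exact (ih ((hH.cons _).add (hH.cons _))).trans
        ((congrArg _ ((hH.inr (.nil _) p _).map_zero)).trans (add_zero _))
    · exact (ih ((hH.cons _).add (hH.cons _))).trans
        ((congrArg (· + _) ((hH.inl (.nil _) p _).map_zero)).trans (zero_add _))

variable (a : ∀ {x y : A.Obj}, MWord A B g d x y → A.Tot x y)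
  (b : ∀ {x y : A.Obj}, MWord A B g d x y → B.DLetter d (g x) (g y))
  (a' : ∀ {x y : A'.Obj}, MWord A' B' g' d x y → A'.Tot x y)
  (b' : ∀ {x y : A'.Obj}, MWord A' B' g' d x y → B'.DLetter d (g' x) (g' y))

theorem mixFst_mixInl {x y : A.Obj} (X : A.Tot x y) : mixFst (mixInl B g d X) = X :=
  tot_ext fun _ => rfl

theorem mixSnd_mixInl {x y : A.Obj} (X : A.Tot x y) :
    mixSnd (mixInl B g d X : (mix A B g d).Tot x y) = 0 := by
  refine tot_hom_ext fun j b => ?_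
  rw [LinearMap.zero_apply]
  by_cases h : ∃ i, j = -(i + d - 1)
  · obtain ⟨i, rfl⟩ := h
    exact (snd_comp i (mixInl B g d X) b).symm
  · exact absurd ⟨1 - d - j, by omega⟩ h

theorem mixFst_mixOp {x y : A.Obj} (p : Word (mix A B g d).Letter x y) :
    mixFst (mixOp a b x y p) = ((expand p).map a).sum := by
  refine (totHom_list_sum mixFst (expand p) _).trans ?_
  congr 1
  refine List.map_congr_left fun q _ => ?_
  refine (map_add mixFst (mixInl B g d (a q)) _).trans ?_
  rw [mixFst_mixInl, mixFst_incl, map_zero, add_zero]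

theorem mixSnd_mixOp {x y : A.Obj} (p : Word (mix A B g d).Letter x y) :
    mixSnd (mixOp a b x y p) = ((expand p).map fun q => B.ev (b q)).sum := by
  refine (totHom_list_sum mixSnd (expand p) _).trans ?_
  congr 1
  refine List.map_congr_left fun q _ => ?_
  refine (map_add mixSnd (mixInl B g d (a q)) _).trans ?_
  rw [mixSnd_mixInl, mixSnd_incl, zero_add]

variable {h : A.Obj → A'.Obj}
  (α : ∀ (x y : A.Obj) (j : ℤ), A.hom x y j →ₗ[k] A'.hom (h x) (h y) j)
  (β : ∀ (x y : A.Obj) (j : ℤ),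
    B.dualHom d (g x) (g y) j →ₗ[k] B'.dualHom d (g' (h x)) (g' (h y)) j)

/-- The map between mixed quivers with given components. -/
def mixMap : HomMap (mix A B g d) (mix A' B' g' d) h := fun x y j =>
  LinearMap.prodMap (α x y j) (β x y j)

/-- The map on letters in `A` or `B^*[d-1]` with given components. -/
def pureMap {x y : A.Obj} : PLetter A B g d x y → PLetter A' B' g' d (h x) (h y) :=
  Sum.map (letterMap α) fun f => ⟨f.1, β x y f.1 f.2⟩

theorem expand_map {x y : A.Obj} (p : Word (mix A B g d).Letter x y) :
    expand (g := g') (p.map h (letterMap (mixMap (g' := g') α β))) =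
      (expand p).map fun q => q.map h (pureMap α β) := by
  induction p with
  | nil x => rfl
  | cons a p ih =>
    simp only [Word.map, expand, ih, List.flatMap_map, List.map_flatMap]
    rfl

/-- Maps of mixed quivers commute with operations that are given by their components as soon as they
do so on words whose letters belong to `A` or `B^*[d-1]`. -/
theorem totMap_mixOp
    (ha : ∀ {x y} (q : MWord A B g d x y), totMap α x y (a q) = a' (q.map h (pureMap α β)))
    (hb : ∀ {x y} (q : MWord A B g d x y),
      (⟨(b q).1, β x y (b q).1 (b q).2⟩ : B'.DLetter d (g' (h x)) (g' (h y))) =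
        b' (q.map h (pureMap α β)))
    {x y : A.Obj} (p : Word (mix A B g d).Letter x y) :
    totMap (mixMap (g' := g') α β) x y (mixOp a b x y p) =
      mixOp a' b' _ _ (p.map h (letterMap (mixMap (g' := g') α β))) := by
  refine (totHom_list_sum (totMap (mixMap (g' := g') α β) x y) (expand p) _).trans ?_
  rw [mixOp, expand_map, List.map_map]
  refine congrArg List.sum (List.map_congr_left fun q _ => ?_)
  rw [Function.comp_apply, ← ha, ← hb]
  refine (map_add (totMap (mixMap (g' := g') α β) x y) (mixInl B g d (a q)) _).trans ?_
  refine congrArg₂ (· + ·) ?_ ?_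
  · exact tot_ext fun j => Prod.ext rfl (map_zero (β x y j))
  · refine (totMap_incl _ _ _).trans (congrArg _ ?_)
    exact Prod.ext (map_zero (α x y _)) rfl

end Expand

/-! ### Degrees of words in `A` and `B^*[d-1]` -/

section Degrees

variable {A B A' B' : GradedQuiver.{w} k} {g : A.Obj → B.Obj} {g' : A'.Obj → B'.Obj} {d : ℤ}
  {x y z t : A.Obj}

@[simp] theorem pdeg_append (p : MWord A B g d x y) (q : MWord A B g d y z) :
    pdeg (p.append q) = pdeg p + pdeg q := Word.weight_append _ _ _

@[simp] theorem adeg_append (p : MWord A B g d x y) (q : MWord A B g d y z) :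
    adeg (p.append q) = adeg p + adeg q := Word.weight_append _ _ _

@[simp] theorem fdeg_append (p : MWord A B g d x y) (q : MWord A B g d y z) :
    fdeg (p.append q) = fdeg p + fdeg q := Word.weight_append _ _ _

@[simp] theorem fnum_append (p : MWord A B g d x y) (q : MWord A B g d y z) :
    fnum (p.append q) = fnum p + fnum q := Word.weight_append _ _ _

section Cons

variable (a : A.Letter x y) (f : B.DLetter d (g x) (g y)) (p : MWord A B g d y z)

@[simp] theorem pdeg_nil : pdeg (.nil x : MWord A B g d x x) = 0 := (rfl)
@[simp] theorem adeg_nil : adeg (.nil x : MWord A B g d x x) = 0 := (rfl)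
@[simp] theorem fdeg_nil : fdeg (.nil x : MWord A B g d x x) = 0 := (rfl)
@[simp] theorem fnum_nil : fnum (.nil x : MWord A B g d x x) = 0 := (rfl)
@[simp] theorem leftDeg_nil : leftDeg (.nil x : MWord A B g d x x) = 0 := (rfl)
@[simp] theorem rightDeg_nil : rightDeg (.nil x : MWord A B g d x x) = 0 := (rfl)
@[simp] theorem signExp_nil : signExp (.nil x : MWord A B g d x x) = 0 := (rfl)

@[simp] theorem pdeg_cons_inl : pdeg (.cons (.inl a) p) = a.1 - 1 + pdeg p := (rfl)
@[simp] theorem adeg_cons_inl : adeg (.cons (.inl a) p) = a.1 - 1 + adeg p := (rfl)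
@[simp] theorem fdeg_cons_inl : fdeg (.cons (.inl a) p) = fdeg p := zero_add _
@[simp] theorem fnum_cons_inl : fnum (.cons (.inl a) p) = fnum p := zero_add _
@[simp] theorem leftDeg_cons_inl : leftDeg (.cons (.inl a) p) = a.1 - 1 + leftDeg p := (rfl)
@[simp] theorem rightDeg_cons_inl : rightDeg (.cons (.inl a) p) =
    if fnum p = 0 then a.1 - 1 + rightDeg p else rightDeg p := (rfl)
@[simp] theorem signExp_cons_inl : signExp (.cons (.inl a) p) =
    (a.1 - 1) * (fdeg p + (adeg p - leftDeg p)) + signExp p := (rfl)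

@[simp] theorem pdeg_cons_inr : pdeg (.cons (.inr f) p) = f.1 - 1 + pdeg p := (rfl)
@[simp] theorem adeg_cons_inr : adeg (.cons (.inr f) p) = adeg p := zero_add _
@[simp] theorem fdeg_cons_inr : fdeg (.cons (.inr f) p) = f.1 - 1 + fdeg p := (rfl)
@[simp] theorem fnum_cons_inr : fnum (.cons (.inr f) p) = 1 + fnum p := (rfl)
@[simp] theorem leftDeg_cons_inr : leftDeg (.cons (.inr f) p) = 0 := (rfl)
@[simp] theorem rightDeg_cons_inr : rightDeg (.cons (.inr f) p) = rightDeg p := (rfl)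
@[simp] theorem signExp_cons_inr : signExp (.cons (.inr f) p) = d + signExp p := (rfl)

end Cons

theorem pdeg_eq_add (p : MWord A B g d x y) : pdeg p = adeg p + fdeg p := by
  induction p with
  | nil x => rfl
  | cons a p ih => rcases a with a | f <;> simp only [pdeg_cons_inl, pdeg_cons_inr, adeg_cons_inl,
      adeg_cons_inr, fdeg_cons_inl, fdeg_cons_inr, ih] <;> ring

theorem fnum_nonneg (p : MWord A B g d x y) : 0 ≤ fnum p := by
  induction p with
  | nil x => exact le_rfl
  | cons a p ih => rcases a with a | f <;> simp only [fnum_cons_inl, fnum_cons_inr] <;> omega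

theorem fnum_append_eq_zero (p : MWord A B g d x y) (q : MWord A B g d y z) :
    fnum (p.append q) = 0 ↔ fnum p = 0 ∧ fnum q = 0 := by
  have := fnum_nonneg p
  have := fnum_nonneg q
  rw [fnum_append]
  omega

@[simp] theorem leftDeg_append (p : MWord A B g d x y) (q : MWord A B g d y z) :
    leftDeg (p.append q) = leftDeg p + if fnum p = 0 then leftDeg q else 0 := by
  induction p with
  | nil x => simp
  | cons a p ih =>
    have := fnum_nonneg p
    rcases a with a | f
    · simp [ih, add_assoc]
    · simp only [Word.cons_append, leftDeg_cons_inr, fnum_cons_inr]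
      rw [if_neg (by omega), add_zero]

@[simp] theorem rightDeg_append (p : MWord A B g d x y) (q : MWord A B g d y z) :
    rightDeg (p.append q) = (if fnum q = 0 then rightDeg p else 0) + rightDeg q := by
  induction p with
  | nil x => simp
  | cons a p ih =>
    rcases a with a | f
    · simp only [Word.cons_append, rightDeg_cons_inl, ih, fnum_append_eq_zero]
      split_ifs <;> omega
    · simp [ih]

/-- Between two consecutive words, the last block of `p` and the first block of `q` merge into one
block. The products of degrees of letters in the same block do not occur in `signExp`. -/
@[simp] theorem signExp_append (p : MWord A B g d x y) (q : MWord A B g d y z) :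
    signExp (p.append q) =
      signExp p + signExp q + adeg p * (fdeg q + adeg q) - rightDeg p * leftDeg q := by
  induction p with
  | nil x => simp
  | cons a p ih =>
    rcases a with a | f
    · simp only [Word.cons_append, signExp_cons_inl, rightDeg_cons_inl, adeg_cons_inl, ih,
        fdeg_append, adeg_append, leftDeg_append]
      split_ifs <;> ring
    · simp only [Word.cons_append, signExp_cons_inr, rightDeg_cons_inr, adeg_cons_inr, ih]
      ring

/-- The degree functions of a word in `A`. -/
theorem degrees_of_fnum_eq_zero {p : MWord A B g d x y} (hp : fnum p = 0) :
    fdeg p = 0 ∧ leftDeg p = adeg p ∧ rightDeg p = adeg p ∧ signExp p = 0 ∧ pdeg p = adeg p := by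
  induction p with
  | nil x => simp
  | cons a p ih =>
    rcases a with a | f
    · rw [fnum_cons_inl] at hp
      obtain ⟨h₁, h₂, h₃, h₄, h₅⟩ := ih hp
      simp [h₁, h₂, h₃, h₄, h₅, hp]
    · have := fnum_nonneg p
      rw [fnum_cons_inr] at hp
      omega

theorem fsplit_append_cons_inr {l : MWord A B g d x y} (hl : fnum l = 0)
    (f : B.DLetter d (g y) (g z)) (r : MWord A B g d z t) :
    fsplit (l.append (.cons (.inr f) r)) = some ⟨l, f, r⟩ := by
  induction l with
  | nil x => rfl
  | cons a l ih =>
    rcases a with a | f'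
    · rw [fnum_cons_inl] at hl
      simp only [Word.cons_append, fsplit, ih hl, Option.map_some]
    · have := fnum_nonneg l
      rw [fnum_cons_inr] at hl
      omega

theorem fsplit_of_fnum_eq_zero {p : MWord A B g d x y} (hp : fnum p = 0) : fsplit p = none := by
  induction p with
  | nil x => rfl
  | cons a p ih =>
    rcases a with a | f
    · rw [fnum_cons_inl] at hp
      simp only [fsplit, ih hp, Option.map_none]
    · have := fnum_nonneg p
      rw [fnum_cons_inr] at hp
      omega

/-- A word that does not lie in `A` can be cut at its first letter in `B^*[d-1]`. -/
theorem exists_eq_append_cons_inr {p : MWord A B g d x y} (hp : fnum p ≠ 0) :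
    ∃ (z t : A.Obj) (l : MWord A B g d x z) (f : B.DLetter d (g z) (g t)) (r : MWord A B g d t y),
      fnum l = 0 ∧ p = l.append (.cons (.inr f) r) := by
  induction p with
  | nil x => exact absurd rfl hp
  | cons a p ih =>
    rcases a with a | f
    · rw [fnum_cons_inl] at hp
      obtain ⟨z, t, l, f, r, hl, rfl⟩ := ih hp
      exact ⟨z, t, .cons (.inl a) l, f, r, by rwa [fnum_cons_inl], rfl⟩
    · exact ⟨_, _, .nil _, f, p, rfl, rfl⟩

section Map

variable {h : A.Obj → A'.Obj}
  (α : ∀ (x y : A.Obj) (j : ℤ), A.hom x y j →ₗ[k] A'.hom (h x) (h y) j)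
  (β : ∀ (x y : A.Obj) (j : ℤ),
    B.dualHom d (g x) (g y) j →ₗ[k] B'.dualHom d (g' (h x)) (g' (h y)) j)
  (p : MWord A B g d x y)

theorem pdeg_map : pdeg (g := g') (p.map h (pureMap α β)) = pdeg p := by
  induction p with
  | nil x => rfl
  | cons a p ih => rcases a with a | f <;> simp only [Word.map, pureMap, Sum.map_inl, Sum.map_inr,
      pdeg_cons_inl, pdeg_cons_inr, letterMap] <;> exact congrArg _ ih

theorem adeg_map : adeg (g := g') (p.map h (pureMap α β)) = adeg p := by
  induction p with
  | nil x => rfl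
  | cons a p ih => rcases a with a | f <;> simp only [Word.map, pureMap, Sum.map_inl, Sum.map_inr,
      adeg_cons_inl, adeg_cons_inr, letterMap] <;> first | exact ih | exact congrArg _ ih

theorem fdeg_map : fdeg (g := g') (p.map h (pureMap α β)) = fdeg p := by
  induction p with
  | nil x => rfl
  | cons a p ih => rcases a with a | f <;> simp only [Word.map, pureMap, Sum.map_inl, Sum.map_inr,
      fdeg_cons_inl, fdeg_cons_inr, letterMap] <;> first | exact ih | exact congrArg _ ih

theorem fnum_map : fnum (g := g') (p.map h (pureMap α β)) = fnum p := by
  induction p with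
  | nil x => rfl
  | cons a p ih => rcases a with a | f <;> simp only [Word.map, pureMap, Sum.map_inl, Sum.map_inr,
      fnum_cons_inl, fnum_cons_inr] <;> first | exact ih | exact congrArg _ ih

theorem leftDeg_map : leftDeg (g := g') (p.map h (pureMap α β)) = leftDeg p := by
  induction p with
  | nil x => rfl
  | cons a p ih =>
    rcases a with a | f
    · exact congrArg (a.1 - 1 + ·) ih
    · rfl

theorem rightDeg_map : rightDeg (g := g') (p.map h (pureMap α β)) = rightDeg p := by
  induction p with
  | nil x => rfl
  | cons a p ih =>
    rcases a with a | f
    · have h₁ := fnum_map (g' := g') α β p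
      simp only [Word.map, pureMap, Sum.map_inl, rightDeg_cons_inl, letterMap] at h₁ ih ⊢
      rw [h₁, ih]
    · exact ih

theorem signExp_map : signExp (g := g') (p.map h (pureMap α β)) = signExp p := by
  induction p with
  | nil x => rfl
  | cons a p ih =>
    rcases a with a | f
    · have h₁ := fdeg_map (g' := g') α β p
      have h₂ := adeg_map (g' := g') α β p
      have h₃ := leftDeg_map (g' := g') α β p
      simp only [Word.map, pureMap, Sum.map_inl, signExp_cons_inl, letterMap] at h₁ h₂ h₃ ih ⊢
      rw [h₁, h₂, h₃, ih]
    · exact congrArg (d + ·) ih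

end Map

end Degrees

/-! ### The components of the operations on `A ⊕ A^*[d-1]` -/

section Components

variable {A : GradedQuiver.{w} k} {d : ℤ} {M : MultiOp A}

theorem isLinearMap_lid_map {N V U : Type*} [AddCommGroup N] [Module k N] [AddCommGroup V]
    [Module k V] [AddCommGroup U] [Module k U] {G : U → N →ₗ[k] k} (hG : IsLinearMap k G) :
    IsLinearMap k fun u => (TensorProduct.lid k V).toLinearMap ∘ₗ
      TensorProduct.map (G u) (LinearMap.id : V →ₗ[k] V) :=
  ⟨fun a b => by rw [hG.map_add, TensorProduct.map_add_left, LinearMap.comp_add],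
    fun c a => by rw [hG.map_smul, TensorProduct.map_smul_left, LinearMap.comp_smul]⟩

/-- The contraction depends linearly on each linear form. -/
theorem parse_append_cons_inr {x y z t : A.Obj} (p : PWord A d x y) (q : PWord A d z t) (j : ℤ) :
    ∃ (S : Shape A.Obj x t) (ws : S.Inputs A) (F : A.dualHom d y z j → S.Forms A d),
      (∀ f, parse (p.append (.cons (.inr ⟨j, f⟩) q)) = ⟨S, ws, F f⟩) ∧
        ∀ V : ModuleCat.{u} k, IsLinearMap k fun f => S.contract A d V (F f) := by
  induction p with
  | nil x =>
    refine ⟨.step x x (parse q).1, ((.nil x : Word A.Letter x x), (parse q).2.1),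
      fun f => ((⟨j, f⟩ : A.DLetter d x z), (parse q).2.2), fun f => rfl, fun V => ?_⟩
    exact isLinearMap_lid_map (G := fun f => A.ev (⟨j, f⟩ : A.DLetter d x z) ∘ₗ
      (parse q).1.contract A d (ModuleCat.of k (A.Tot z x)) (parse q).2.2)
      ⟨fun _ _ => rfl, fun _ _ => rfl⟩
  | @cons x x' y a p ih =>
    obtain ⟨S, ws, F, h₁, h₂⟩ := ih
    rcases a with a | f₀
    · cases S with
      | one _ _ =>
        refine ⟨.one x t, Word.cons a ws, fun _ => PUnit.unit, fun f => ?_, h₂⟩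
        exact congrArg (fun b : Blocks A d x' t => Blocks.consA a b.1 b.2.1 b.2.2) (h₁ f)
      | step _ s S =>
        refine ⟨.step x s S, (Word.cons a ws.1, ws.2), F, fun f => ?_, h₂⟩
        exact congrArg (fun b : Blocks A d x' t => Blocks.consA a b.1 b.2.1 b.2.2) (h₁ f)
    · refine ⟨.step x x S, ((.nil x : Word A.Letter x x), ws), fun f => (f₀, F f), fun f => ?_,
        fun V => ?_⟩
      · exact congrArg (Blocks.consF f₀) (h₁ f)
      · refine isLinearMap_lid_map (G := fun f => A.ev f₀ ∘ₗ
          S.contract A d (ModuleCat.of k (A.Tot x' x)) (F f)) ?_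
        exact ⟨fun a b => by rw [(h₂ _).map_add, LinearMap.comp_add],
          fun c a => by rw [(h₂ _).map_smul, LinearMap.comp_smul]⟩

theorem pureLinear_pair (hM : IsCyclicMulti d M) {x t : A.Obj} :
    PureLinear fun p : PWord A d x t => M.pair p := by
  refine ⟨fun p q j => hM.linear p q j, fun {y z} p q j => ?_⟩
  obtain ⟨S, ws, F, h₁, h₂⟩ := parse_append_cons_inr p q j
  have h : ∀ f : A.dualHom d y z j, M.pair (p.append (.cons (.inr ⟨j, f⟩) q)) =
      S.contract A d _ (F f) (M S ws) := fun f => by rw [MultiOp.pair, h₁]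
  refine isLinearMap_congr ?_ h
  exact ⟨fun a b => by rw [(h₂ _).map_add, LinearMap.add_apply],
    fun c a => by rw [(h₂ _).map_smul, LinearMap.smul_apply]⟩

theorem pureLinear_opA (hM : IsCyclicMulti d M) {x t : A.Obj} :
    PureLinear fun p : PWord A d x t => opA d M p := by
  have hM' := pureLinear_pair hM (x := x) (t := t)
  constructor
  · intro y z p q j
    refine isLinearMap_congr (isLinearMap_negOnePow_smul (hM'.inl p q j)
      (signExp (p.append (.cons (.inl ⟨j, (0 : A.hom y z j)⟩) q)))) fun a => ?_
    rw [opA, signExp_append, signExp_append]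
    rfl
  · intro y z p q j
    refine isLinearMap_congr (isLinearMap_negOnePow_smul (hM'.inr p q j)
      (signExp (p.append (.cons (.inr ⟨j, (0 : A.dualHom d y z j)⟩) q)))) fun a => ?_
    rw [opA, signExp_append, signExp_append]
    rfl

/-- The sign of the component to `A^*[d-1]` of the operations on a word `l f r` with `l` in `A`,
paired with an element of degree `j`. -/
def dualSign {x y z t : A.Obj} (l : PWord A d x y) (f : A.DLetter d y z) (r : PWord A d z t)
    (j : ℤ) : ℤ :=
  adeg l + (f.1 - 1) + pdeg r + (pdeg r + (j - 1)) * (adeg l + (f.1 - 1)) +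
    (d + 1) * (f.1 - 1) + signExp r + (adeg r - rightDeg r) * (adeg l + (j - 1))

theorem ev_pair_eq_zero (hM : IsCyclicMulti d M) {x y : A.Obj} (f : A.DLetter d y x)
    (p : PWord A d x y) (h : f.1 + pdeg p + d + 1 ≠ 0) : A.ev f (M.pair p) = 0 := by
  rw [ev, LinearMap.comp_apply, hM.degree _ _ (by omega), map_zero]

/-- The component to `A^*[d-1]` of the operations in all degrees, including those in which both
sides vanish. -/
theorem ev_opD (hM : IsCyclicMulti d M) {x y z t : A.Obj} {l : PWord A d x y} (hl : fnum l = 0)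
    (f : A.DLetter d y z) (r : PWord A d z t) {j : ℤ} (b : A.hom t x j) :
    A.ev (opD hM (l.append (.cons (.inr f) r))) (A.incl j b) =
      (dualSign l f r j).negOnePow • A.ev f (M.pair (r.append (.cons (.inl ⟨j, b⟩) l))) := by
  have hd : pdeg (l.append (.cons (.inr f) r)) = pdeg l + (f.1 - 1 + pdeg r) := by
    rw [pdeg_append, pdeg_cons_inr]
  obtain ⟨h₁, h₂, h₃, h₄, h₅⟩ := degrees_of_fnum_eq_zero hl
  by_cases hj : j = -(pdeg (l.append (.cons (.inr f) r)) + 2 + d - 1)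
  · subst hj
    refine (ev_incl (opD hM (l.append (.cons (.inr f) r))) b).trans ?_
    simp only [opD, fsplit_append_cons_inr hl]
    refine congrArg (fun n : ℤ => n.negOnePow •
      A.ev f (M.pair (r.append (.cons (.inl ⟨_, b⟩) l)))) (?_ : _ = dualSign l f r _)
    rw [signExp_append, signExp_cons_inl, leftDeg_cons_inl, fdeg_cons_inl, adeg_cons_inl, dualSign,
      hd, h₁, h₂, h₄, h₅]
    ring
  · rw [ev_incl_ne (opD hM (l.append (.cons (.inr f) r))) (by rw [opD]; simp only; omega),
      ev_pair_eq_zero hM, smul_zero]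
    rw [pdeg_append, pdeg_cons_inl]
    change f.1 + (pdeg r + (j - 1 + pdeg l)) + d + 1 ≠ 0
    omega

theorem ev_opD_of_fnum_eq_zero (hM : IsCyclicMulti d M) {x y : A.Obj} {p : PWord A d x y}
    (hp : fnum p = 0) : A.ev (opD hM p) = 0 := by
  have : opD hM p = ⟨pdeg p + 2, 0⟩ := by rw [opD, fsplit_of_fnum_eq_zero hp]
  rw [this]
  exact LinearMap.zero_comp _

theorem isLinearMap_of_apply_incl {V : Type*} [AddCommMonoid V] [Module k V] {x y : A.Obj}
    {F : V → A.Tot x y →ₗ[k] k} (h : ∀ j b, IsLinearMap k fun v => F v (A.incl j b)) :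
    IsLinearMap k F :=
  ⟨fun v v' => tot_hom_ext fun j b => (h j b).map_add v v',
    fun c v => tot_hom_ext fun j b => (h j b).map_smul c v⟩

theorem pureLinear_ev_opD (hM : IsCyclicMulti d M) {x t : A.Obj} :
    PureLinear fun p : PWord A d x t => A.ev (opD hM p) := by
  have hz : ∀ {y z} (j : ℤ), IsLinearMap k fun _ : A.hom y z j => (0 : A.Tot t x →ₗ[k] k) :=
    fun j => ⟨fun _ _ => (add_zero _).symm, fun _ _ => (smul_zero _).symm⟩
  constructor
  · intro y z p q j
    by_cases hp : fnum p = 0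
    · by_cases hq : fnum q = 0
      · refine isLinearMap_congr (hz j) fun a => ev_opD_of_fnum_eq_zero hM ?_
        rw [fnum_append, fnum_cons_inl, hp, hq, add_zero]
      · obtain ⟨s, v, l, f, r, hl, rfl⟩ := exists_eq_append_cons_inr hq
        refine isLinearMap_of_apply_incl fun i b => ?_
        have hl' : ∀ a : A.hom y z j, fnum (p.append (.cons (.inl ⟨j, a⟩) l)) = 0 := fun a => by
          rw [fnum_append, fnum_cons_inl, hp, hl, add_zero]
        refine isLinearMap_congr (isLinearMap_negOnePow_smul (isLinearMap_comp
          (LinearMap.isLinear (A.ev f)) ((pureLinear_pair hM).inl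
            (r.append (.cons (.inl ⟨i, b⟩) p)) l j))
          (dualSign (p.append (.cons (.inl ⟨j, (0 : A.hom y z j)⟩) l)) f r i)) fun a => ?_
        have := ev_opD hM (hl' a) f r b
        simp only [Word.append_assoc, Word.cons_append] at this ⊢
        rw [this, dualSign, dualSign]
        simp only [adeg_append, adeg_cons_inl]
    · obtain ⟨s, v, l, f, r, hl, rfl⟩ := exists_eq_append_cons_inr hp
      refine isLinearMap_of_apply_incl fun i b => ?_
      refine isLinearMap_congr (isLinearMap_negOnePow_smul (isLinearMap_comp
        (LinearMap.isLinear (A.ev f)) ((pureLinear_pair hM).inl r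
          (q.append (.cons (.inl ⟨i, b⟩) l)) j))
        (dualSign l f (r.append (.cons (.inl ⟨j, (0 : A.hom y z j)⟩) q)) i)) fun a => ?_
      have := ev_opD hM hl f (r.append (.cons (.inl ⟨j, a⟩) q)) b
      simp only [Word.append_assoc, Word.cons_append] at this ⊢
      rw [this, dualSign, dualSign]
      simp only [pdeg_append, pdeg_cons_inl, adeg_append, adeg_cons_inl, rightDeg_append,
        rightDeg_cons_inl, signExp_append, signExp_cons_inl, fnum_cons_inl, fdeg_cons_inl,
        leftDeg_cons_inl]
  · intro y z p q j
    by_cases hp : fnum p = 0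
    · refine isLinearMap_of_apply_incl fun i b => ?_
      refine isLinearMap_congr (f := fun f : A.dualHom d y z j =>
        (dualSign p (⟨j, 0⟩ : A.DLetter d y z) q i).negOnePow • A.ev (⟨j, f⟩ : A.DLetter d y z)
          (M.pair (q.append (.cons (.inl ⟨i, b⟩) p)))) ?_ fun a => ?_
      · exact isLinearMap_negOnePow_smul ⟨fun _ _ => rfl, fun _ _ => rfl⟩ _
      · exact ev_opD hM hp _ q b
    · obtain ⟨s, v, l, f, r, hl, rfl⟩ := exists_eq_append_cons_inr hp
      refine isLinearMap_of_apply_incl fun i b => ?_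
      refine isLinearMap_congr (isLinearMap_negOnePow_smul (isLinearMap_comp
        (LinearMap.isLinear (A.ev f)) ((pureLinear_pair hM).inr r
          (q.append (.cons (.inl ⟨i, b⟩) l)) j))
        (dualSign l f (r.append (.cons (.inr ⟨j, (0 : A.dualHom d y z j)⟩) q)) i)) fun a => ?_
      have := ev_opD hM hl f (r.append (.cons (.inr ⟨j, a⟩) q)) b
      simp only [Word.append_assoc, Word.cons_append] at this ⊢
      rw [this, dualSign, dualSign]
      simp only [pdeg_append, pdeg_cons_inr, adeg_append, adeg_cons_inr, rightDeg_append,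
        rightDeg_cons_inr, signExp_append, signExp_cons_inr, fnum_cons_inr, fdeg_cons_inr,
        leftDeg_cons_inr]

end Components

/-! ### Cyclicity of the operations on `A ⊕ A^*[d-1]` -/

section Double

variable {A : GradedQuiver.{w} k} {d : ℤ} {M : MultiOp A}

/-- The operations on `A ⊕ A^*[d-1]` given by a cyclically invariant collection of maps. -/
def doubleOp (hM : IsCyclicMulti d M) : Op (bdry A d) := mixOp (opA d M) (opD hM)

/-- The natural bilinear form on `A ⊕ A^*[d-1]`. -/
def doubleForm (A : GradedQuiver.{w} k) (d : ℤ) : Form (bdry A d) := mixForm (QuiverHom.id A) d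

theorem doubleForm_val {x y : A.Obj} (X : (bdry A d).Tot x y) (j : ℤ) (b : (bdry A d).hom y x j) :
    (doubleForm A d).val x y X ((bdry A d).incl j b) =
      (d + 1 + j).negOnePow • mixSnd X (A.incl j b.1) +
        (d * j + d + j + 1).negOnePow • A.ev (⟨j, b.2⟩ : A.DLetter d y x) (mixFst X) := by
  have h := mixForm_val (QuiverHom.id A) X j b
  rw [QuiverHom.tot_id] at h
  exact h

theorem list_sum_apply {V W ι : Type*} [AddCommMonoid V] [AddCommMonoid W] [Module k V]
    [Module k W] (l : List ι) (F : ι → V →ₗ[k] W) (v : V) :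
    (l.map F).sum v = (l.map fun i => F i v).sum := by
  induction l with
  | nil => rfl
  | cons i l ih => rw [List.map_cons, List.sum_cons, LinearMap.add_apply, ih]; rfl

variable (hM : IsCyclicMulti d M)

theorem mixFst_doubleOp_emb {x y : A.Obj} (p : PWord A d x y) :
    mixFst (doubleOp hM x y (emb p)) = opA d M p := by
  rw [doubleOp, mixFst_mixOp]
  exact (pureLinear_opA hM).sum_expand_emb p

theorem mixSnd_doubleOp_emb {x y : A.Obj} (p : PWord A d x y) :
    mixSnd (doubleOp hM x y (emb p)) = A.ev (opD hM p) := by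
  rw [doubleOp, mixSnd_mixOp]
  exact (pureLinear_ev_opD hM).sum_expand_emb p

theorem doubleOp_nil (x : A.Obj) : doubleOp hM x x (.nil x) = 0 := by
  have h₁ := mixFst_doubleOp_emb hM (.nil x)
  have h₂ := mixSnd_doubleOp_emb hM (.nil x)
  rw [opA, hM.uncurved, smul_zero] at h₁
  rw [ev_opD_of_fnum_eq_zero hM fnum_nil] at h₂
  exact mix_eq_zero h₁ h₂

theorem doubleOp_degree {x y : A.Obj} (p : Word (bdry A d).Letter x y) (j : ℤ)
    (hj : j ≠ (bdry A d).wdeg p + 2) : (bdry A d).comp j (doubleOp hM x y p) = 0 := by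
  refine Prod.ext ?_ (LinearMap.ext fun b => ?_)
  · rw [fst_comp, doubleOp, mixFst_mixOp, map_list_sum, List.map_map]
    refine sum_map_eq_zero _ _ fun q hq => ?_
    rw [Function.comp_apply, opA, map_zsmul_unit, hM.degree, smul_zero]
    rwa [pdeg_of_mem_expand p q hq]
  · rw [snd_comp, doubleOp, mixSnd_mixOp, list_sum_apply]
    refine sum_map_eq_zero _ _ fun q hq => ev_incl_ne _ ?_ b
    have := pdeg_of_mem_expand p q hq
    change pdeg q + 2 + -(j + d - 1) + d - 1 ≠ 0
    change j ≠ (mix A A (fun x => x) d).wdeg p + 2 at hj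
    omega

theorem doubleOp_isMultilinear : (doubleOp hM).IsMultilinear := by
  intro x y z t p q j
  have h₁ := (pureLinear_opA hM).sum_expand p q j
  have h₂ := (pureLinear_ev_opD hM).sum_expand p q j
  simp only [← mixFst_mixOp (opA d M) (opD hM), ← mixSnd_mixOp (opA d M) (opD hM)] at h₁ h₂
  constructor
  · intro a b
    refine mix_ext ?_ ?_
    · rw [map_add mixFst]; exact h₁.map_add a b
    · rw [map_add mixSnd]; exact h₂.map_add a b
  · intro c a
    refine mix_ext ?_ ?_
    · rw [map_smul mixFst]; exact h₁.map_smul c a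
    · rw [map_smul mixSnd]; exact h₂.map_smul c a

/-- Pairing with elements of `A` detects the component to `A^*[d-1]`. -/
theorem doubleForm_inl {x y : A.Obj} (X : (bdry A d).Tot x y) (b : A.Letter y x) :
    (doubleForm A d).val x y X ((bdry A d).incl (pureLetter (.inl b) : (bdry A d).Letter y x).1
      (pureLetter (.inl b) : (bdry A d).Letter y x).2) =
      (d + 1 + b.1).negOnePow • mixSnd X (A.incl b.1 b.2) := by
  refine (doubleForm_val X b.1 (b.2, 0)).trans ((congrArg _ ?_).trans (add_zero _))
  exact (congrArg _ (LinearMap.congr_fun (LinearMap.zero_comp _) _)).trans (smul_zero _)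

/-- Pairing with linear forms detects the component to `A`. -/
theorem doubleForm_inr {x y : A.Obj} (X : (bdry A d).Tot x y) (f : A.DLetter d y x) :
    (doubleForm A d).val x y X ((bdry A d).incl (pureLetter (.inr f) : (bdry A d).Letter y x).1
      (pureLetter (.inr f) : (bdry A d).Letter y x).2) =
      (d * f.1 + d + f.1 + 1).negOnePow • A.ev f (mixFst X) := by
  refine (doubleForm_val X f.1 (0, f.2)).trans ((congrArg (· + _) ?_).trans (zero_add _))
  rw [map_zero, map_zero, smul_zero]

theorem eq_smul_of_smul_eq {V : Type*} [AddCommGroup V] {m n : ℤ} {a b : V}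
    (h : m.negOnePow • a = n.negOnePow • b) : a = (m + n).negOnePow • b := by
  rw [← negOnePow_smul_smul, ← h, negOnePow_smul_smul, ← two_mul, Int.negOnePow_two_mul, one_smul]

/-- A word without linear forms is a word in `A`. -/
theorem exists_eq_ofA {x y : A.Obj} {l : PWord A d x y} (hl : fnum l = 0) :
    ∃ l' : Word A.Letter x y, l = ofA l' ∧ A.wdeg l' = adeg l := by
  induction l with
  | nil x => exact ⟨.nil x, rfl, rfl⟩
  | cons a l ih =>
    rcases a with a | f
    · rw [fnum_cons_inl] at hl
      obtain ⟨l', rfl, h⟩ := ih hl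
      exact ⟨.cons a l', rfl, by rw [wdeg_cons, h, adeg_cons_inl]⟩
    · have := fnum_nonneg l
      rw [fnum_cons_inr] at hl
      omega

/-- Two multiples of a contraction agree as soon as their signs agree whenever the contraction is
not zero for reasons of degree. -/
theorem negOnePow_smul_ev_pair_congr (hM : IsCyclicMulti d M) {x y : A.Obj}
    (f : A.DLetter d y x) (p : PWord A d x y) {m n : ℤ}
    (h : (f.1 : ZMod 2) + pdeg p + d + 1 = 0 → (m : ZMod 2) = n) :
    m.negOnePow • A.ev f (M.pair p) = n.negOnePow • A.ev f (M.pair p) := by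
  by_cases hd : f.1 + pdeg p + d + 1 = 0
  · rw [negOnePow_congr (h (by exact_mod_cast congrArg (Int.cast : ℤ → ZMod 2) hd))]
  · rw [ev_pair_eq_zero hM f p hd, smul_zero, smul_zero]

/-- Almost cyclicity on words whose letters belong to `A` or `A^*[d-1]`. After the elimination of
the component to `A^*[d-1]`, this amounts to the cyclic invariance of `M`. -/
theorem doubleOp_cyclic_emb {x y z : A.Obj} (p : PWord A d x y)
    (b : PLetter A A (fun x => x) d y z) (c : PLetter A A (fun x => x) d z x) :
    (doubleForm A d).val x z (doubleOp hM x z (emb (p.append (.cons b (.nil z)))))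
        ((bdry A d).incl (pureLetter c).1 (pureLetter c).2) =
      (((pureLetter c).1 - 1) * (pdeg p + ((pureLetter b).1 - 1))).negOnePow •
        (doubleForm A d).val z y (doubleOp hM z y (emb (.cons c p)))
          ((bdry A d).incl (pureLetter b).1 (pureLetter b).2) := by
  have sq := zmod_two_mul_self
  rcases c with c | f <;> rcases b with b | g
  · rw [doubleForm_inl, doubleForm_inl, mixSnd_doubleOp_emb, mixSnd_doubleOp_emb]
    by_cases h : fnum p = 0
    · rw [ev_opD_of_fnum_eq_zero hM (by simp [fnum_append, h]),
        ev_opD_of_fnum_eq_zero hM (by simp [h])]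
      simp
    · obtain ⟨s, v, l, f, r, hl, rfl⟩ := exists_eq_append_cons_inr h
      rw [Word.append_assoc, Word.cons_append, ev_opD hM hl, ← Word.cons_append,
        ev_opD hM (by simp [hl])]
      simp only [negOnePow_smul_smul, Word.append_assoc, Word.cons_append, Word.nil_append]
      refine negOnePow_smul_ev_pair_congr hM _ _ ?_
      simp only [pureLetter, dualSign, pdeg_eq_add]
      simp [degrees_of_fnum_eq_zero hl]
      grind
  · rw [doubleForm_inl, doubleForm_inr, mixSnd_doubleOp_emb, mixFst_doubleOp_emb, opA,
      map_zsmul_unit]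
    by_cases h : fnum p = 0
    · rw [ev_opD hM h]
      simp only [negOnePow_smul_smul, Word.nil_append]
      refine negOnePow_smul_ev_pair_congr hM _ _ ?_
      simp only [pureLetter, dualSign, pdeg_eq_add]
      simp [degrees_of_fnum_eq_zero h]
      grind
    · obtain ⟨s, v, l, f, r, hl, rfl⟩ := exists_eq_append_cons_inr h
      rw [Word.append_assoc, Word.cons_append, ev_opD hM hl]
      obtain ⟨l', rfl, hw⟩ := exists_eq_ofA hl
      have h' : A.ev f (M.pair (r.append (.cons (.inr g) (.cons (.inl c) (ofA l'))))) = _ •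
          A.ev g (M.pair (.cons (.inl c) ((ofA l').append (.cons (.inr f) r)))) :=
        eq_smul_of_smul_eq (hM.cyclic r g (.cons c l') f)
      rw [wdeg_cons, hw] at h'
      simp only [Word.append_assoc, Word.cons_append, Word.nil_append]
      rw [h']
      clear h'
      simp only [negOnePow_smul_smul]
      refine negOnePow_smul_ev_pair_congr hM _ _ ?_
      simp only [pureLetter, dualSign, pdeg_eq_add]
      simp [degrees_of_fnum_eq_zero hl]
      have h₁ := sq (adeg (ofA (d := d) l'))
      have h₂ := sq (adeg r)
      have h₃ := sq (fdeg r)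
      have h₄ := sq c.1
      have h₅ := sq f.1
      have h₆ := sq g.1
      clear sq hw h hl
      grind
  · rw [doubleForm_inl, doubleForm_inr, mixSnd_doubleOp_emb, mixFst_doubleOp_emb, opA,
      map_zsmul_unit]
    have h := ev_opD hM (l := .nil z) fnum_nil f p b.2
    rw [Word.nil_append] at h
    rw [h]
    simp only [negOnePow_smul_smul]
    refine negOnePow_smul_ev_pair_congr hM _ _ ?_
    simp only [pureLetter, dualSign, pdeg_eq_add]
    simp [degrees_of_fnum_eq_zero (fnum_nil (x := z))]
    grind
  · rw [doubleForm_inr, doubleForm_inr, mixFst_doubleOp_emb, mixFst_doubleOp_emb, opA, opA,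
      map_zsmul_unit, map_zsmul_unit]
    have h' := eq_smul_of_smul_eq (hM.cyclic p g (.nil z) f)
    rw [show (ofA (.nil z) : PWord A d z z) = .nil z from rfl, Word.nil_append, wdeg_nil] at h'
    rw [h']
    clear h'
    simp only [negOnePow_smul_smul]
    refine negOnePow_smul_ev_pair_congr hM _ _ ?_
    simp only [pureLetter, pdeg_eq_add]
    simp [degrees_of_fnum_eq_zero (fnum_nil (x := z))]
    have h₁ := sq (adeg p)
    have h₂ := sq (fdeg p)
    have h₃ := sq f.1
    have h₄ := sq g.1
    clear sq
    grind

theorem letter_induction {A B : GradedQuiver.{w} k} {g : A.Obj → B.Obj} {x y : A.Obj}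
    {P : (mix A B g d).Letter x y → Prop} (pure : ∀ a, P (pureLetter a))
    (add : ∀ (j : ℤ) (a a' : (mix A B g d).hom x y j), P ⟨j, a⟩ → P ⟨j, a'⟩ → P ⟨j, a + a'⟩)
    (a : (mix A B g d).Letter x y) : P a := by
  obtain ⟨j, a, f⟩ := a
  have := add j _ _ (pure (.inl ⟨j, a⟩)) (pure (.inr ⟨j, f⟩))
  have e : ((a, 0) : (mix A B g d).hom x y j) + (0, f) = (a, f) :=
    Prod.ext (add_zero a) (zero_add f)
  rwa [e] at this

theorem doubleOp_almostCyclic : AlmostCyclic (doubleOp hM) (doubleForm A d) := by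
  have hlin : (doubleOp hM).IsMultilinear := doubleOp_isMultilinear hM
  intro x y z p b c
  refine letter_induction (d := d) (P := fun c => (doubleForm A d).val x z
    (doubleOp hM x z (p.append (.single b))) ((bdry A d).incl c.1 c.2) =
      ((c.1 - 1) * ((bdry A d).wdeg p + (b.1 - 1))).negOnePow •
        (doubleForm A d).val z y (doubleOp hM z y (.cons c p)) ((bdry A d).incl b.1 b.2))
    (fun c => ?_) (fun j c c' h h' => ?_) c
  · refine letter_induction (d := d) (P := fun b => (doubleForm A d).val x z
      (doubleOp hM x z (p.append (.single b)))
        ((bdry A d).incl (pureLetter c).1 (pureLetter c).2) =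
        (((pureLetter c).1 - 1) * ((bdry A d).wdeg p + (b.1 - 1))).negOnePow •
          (doubleForm A d).val z y (doubleOp hM z y (.cons (pureLetter c) p))
            ((bdry A d).incl b.1 b.2)) (fun b => ?_) (fun j b b' h h' => ?_) b
    · refine emb_induction (P := fun p => (doubleForm A d).val x z
        (doubleOp hM x z (p.append (.single (pureLetter b))))
          ((bdry A d).incl (pureLetter c).1 (pureLetter c).2) =
          (((pureLetter c).1 - 1) * ((bdry A d).wdeg p + ((pureLetter b).1 - 1))).negOnePow •
            (doubleForm A d).val z y (doubleOp hM z y (.cons (pureLetter c) p))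
              ((bdry A d).incl (pureLetter b).1 (pureLetter b).2)) (fun p => ?_)
        (fun {s t} q r j a a' h h' => ?_) p
      · have h := doubleOp_cyclic_emb hM p b c
        rw [emb_append] at h
        rw [wdeg_emb]
        exact h
      · have h₁ := (hlin q (r.append (.single (pureLetter b))) j).map_add a a'
        have h₂ := (hlin (.cons (pureLetter c) q) r j).map_add a a'
        simp only [Word.append_assoc, Word.cons_append, wdeg_append, wdeg_cons] at h h' h₁ h₂ ⊢
        rw [h₁, h₂, map_add, map_add, LinearMap.add_apply, LinearMap.add_apply, smul_add, h, h']
    · have h₁ := (hlin p (.nil z) j).map_add b b'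
      dsimp only at h h' ⊢
      rw [Word.single] at h h' ⊢
      rw [h₁, map_add, map_add, map_add, LinearMap.add_apply, smul_add, ← h, ← h']
  · have h₁ := (hlin (.nil z) p j).map_add c c'
    simp only [Word.nil_append] at h h' h₁ ⊢
    rw [h₁, map_add, map_add, map_add, LinearMap.add_apply, smul_add, h, h']

end Double

/-! ### The Stasheff identities on `A ⊕ A^*[d-1]` -/

section DoubleStasheff

variable {A : GradedQuiver.{w} k} {d : ℤ} {M : MultiOp A}

/-- The sign of a term of the Stasheff sum in which the value of the inner operation is in `A`. -/
theorem inner_sign {x y z t : A.Obj} (u : PWord A d x y) (v : PWord A d y z) (q : PWord A d z t)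
    {j : ℤ} (hj : j = pdeg v + 2) (a : A.hom y z j) :
    ((pdeg u + (signExp (u.append (.cons (.inl ⟨j, a⟩) q)) + signExp v) : ℤ) : ZMod 2) =
      (fdeg (u.append (v.append q)) + signExp (u.append (v.append q)) + innerSign u v q : ℤ) := by
  have sq := zmod_two_mul_self
  have hj' := congrArg (Int.cast : ℤ → ZMod 2) hj
  clear hj
  by_cases h : fnum v = 0
  · simp only [innerSign, pdeg_eq_add] at hj' ⊢
    simp [h, degrees_of_fnum_eq_zero h] at hj' ⊢
    have h₁ := sq (adeg u)
    have h₂ := sq (adeg v)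
    have h₃ := sq (adeg q)
    have h₄ := sq (fdeg q)
    have h₅ := sq (rightDeg u)
    have h₆ := sq (leftDeg q)
    clear sq
    grind
  · simp only [innerSign, pdeg_eq_add] at hj' ⊢
    simp [h] at hj' ⊢
    have h₁ := sq (adeg u)
    have h₂ := sq (adeg v)
    have h₃ := sq (adeg q)
    have h₄ := sq (fdeg q)
    have h₅ := sq (fdeg v)
    have h₆ := sq (leftDeg q)
    have h₇ := sq (rightDeg u)
    clear sq
    grind

/-- The sign of a term of the Stasheff sum in which the value of the inner operation, with arguments
`l f r`, is in `A^*[d-1]`. -/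
theorem outer_sign {x y z t s s' : A.Obj} (u : PWord A d x y) {l : PWord A d y s} (hl : fnum l = 0)
    (f : A.DLetter d s s') (r : PWord A d s' z) (q : PWord A d z t) {j : ℤ}
    (hj : j = pdeg (l.append (.cons (.inr f) r)) + 2) (f' : A.dualHom d y z j) :
    ((pdeg u + (signExp (u.append (.cons (.inr ⟨j, f'⟩) q)) +
        dualSign l f r (-(j + d - 1))) : ℤ) : ZMod 2) =
      (fdeg (u.append ((l.append (.cons (.inr f) r)).append q)) +
        signExp (u.append ((l.append (.cons (.inr f) r)).append q)) +
          outerSign u (l.append (.cons (.inr f) r)) q ⟨l, f, r⟩ : ℤ) := by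
  have sq := zmod_two_mul_self
  have hr : (1 : ℤ) + fnum r ≠ 0 := by have := fnum_nonneg r; omega
  have hj' := congrArg (Int.cast : ℤ → ZMod 2) hj
  clear hj
  simp only [outerSign, dualSign, pdeg_eq_add] at hj' ⊢
  simp [degrees_of_fnum_eq_zero hl, hl, hr] at hj' ⊢
  have h₁ := sq (adeg u)
  have h₂ := sq (adeg l)
  have h₃ := sq (adeg q)
  have h₄ := sq (fdeg q)
  have h₅ := sq (fdeg r)
  have h₆ := sq (leftDeg q)
  have h₇ := sq (rightDeg u)
  have h₈ := sq (adeg r)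
  have h₉ := sq (rightDeg r)
  have h₁₀ := sq f.1
  have h₁₁ := sq d
  clear sq
  grind

variable (hM : IsCyclicMulti d M)

theorem isLinearMap_map_negOnePow_smul {V W : Type*} [AddCommGroup V] [AddCommGroup W] [Module k V]
    [Module k W] {f : V → W} (h : IsLinearMap k f) (n : ℤ) (a : V) :
    f (n.negOnePow • a) = n.negOnePow • f a :=
  map_zsmul_unit (h.mk' f) n.negOnePow a

theorem mixFst_doubleOp_append_cons {x y z t : A.Obj} (u : PWord A d x y) (q : PWord A d z t)
    (j : ℤ) (a : (bdry A d).hom y z j) :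
    mixFst (doubleOp hM x t ((emb u).append (.cons ⟨j, a⟩ (emb q)))) =
      opA d M (u.append (.cons (.inl ⟨j, a.1⟩) q)) +
        opA d M (u.append (.cons (.inr ⟨j, a.2⟩) q)) := by
  have h := (doubleOp_isMultilinear hM (emb u) (emb q) j).map_add (a.1, 0) (0, a.2)
  rw [show ((a.1, 0) : (bdry A d).hom y z j) + (0, a.2) = a from
    Prod.ext (add_zero _) (zero_add _)] at h
  rw [h, map_add mixFst, ← mixFst_doubleOp_emb hM, ← mixFst_doubleOp_emb hM, emb_append, emb_append]
  rfl

/-- The contribution of a decomposition `u · v · q` to the component to `A` of the Stasheff sum. -/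
theorem mixFst_stasheff_term {x y z t : A.Obj} (u : PWord A d x y) (v : PWord A d y z)
    (q : PWord A d z t) :
    (pdeg u).negOnePow • mixFst (doubleOp hM x t ((emb u).append
        (.cons ((bdry A d).letter (pdeg v + 2) (doubleOp hM y z (emb v))) (emb q)))) =
      (fdeg (u.append (v.append q)) + signExp (u.append (v.append q))).negOnePow •
        ((innerSign u v q).negOnePow •
            M.pair (u.append (.cons (.inl (A.letter (pdeg v + 2) (M.pair v))) q)) +
          match fsplit v with
          | none => 0
          | some r => (outerSign u v q r).negOnePow •
              M.pair (u.append (.cons (.inr ⟨pdeg v + 2, outerForm hM r _⟩) q))) := by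
  have h₁ : ((bdry A d).comp (pdeg v + 2) (doubleOp hM y z (emb v))).1 =
      (signExp v).negOnePow • A.comp (pdeg v + 2) (M.pair v) := by
    rw [fst_comp, mixFst_doubleOp_emb, opA, map_zsmul_unit]
  rw [GradedQuiver.letter, mixFst_doubleOp_append_cons, h₁, smul_add, smul_add, opA, opA,
    isLinearMap_map_negOnePow_smul ((pureLinear_pair hM).inl u q _)]
  refine congrArg₂ (· + ·) ?_ ?_
  · simp only [negOnePow_smul_smul]
    rw [negOnePow_congr (inner_sign u v q rfl _)]
    rfl
  · by_cases hv : fnum v = 0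
    · have h₂ : ((bdry A d).comp (pdeg v + 2) (doubleOp hM y z (emb v))).2 = 0 := by
        refine LinearMap.ext fun b => ?_
        rw [snd_comp, mixSnd_doubleOp_emb, ev_opD_of_fnum_eq_zero hM hv]
        rfl
      rw [h₂, ((pureLinear_pair hM).inr u q _).map_zero, fsplit_of_fnum_eq_zero hv]
      simp only [smul_zero]
    · obtain ⟨s, s', l, f, r, hl, rfl⟩ := exists_eq_append_cons_inr hv
      have h₂ : ((bdry A d).comp (pdeg (l.append (.cons (.inr f) r)) + 2)
          (doubleOp hM y z (emb (l.append (.cons (.inr f) r))))).2 =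
          (dualSign l f r (-(pdeg (l.append (.cons (.inr f) r)) + 2 + d - 1))).negOnePow •
            outerForm hM ⟨l, f, r⟩ _ := by
        refine LinearMap.ext fun b => ?_
        rw [snd_comp, mixSnd_doubleOp_emb, ev_opD hM hl]
        rfl
      rw [h₂, isLinearMap_map_negOnePow_smul ((pureLinear_pair hM).inr u q _),
        fsplit_append_cons_inr hl]
      simp only [negOnePow_smul_smul]
      rw [← negOnePow_congr (outer_sign u hl f r q rfl _)]

/-- On words whose letters belong to `A` or `A^*[d-1]`, the component to `A` of the Stasheff sum
is a contraction of the necklace product up to a sign: the terms in which the inner operation has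
its value in `A` and in `A^*[d-1]` are those of the inner and of the outer summand. -/
theorem mixFst_stasheffSum_emb {x y : A.Obj} (p : PWord A d x y) :
    mixFst ((doubleOp hM).stasheffSum (emb p)) =
      (fdeg p + signExp p).negOnePow • necklace hM p := by
  rw [Op.stasheffSum, totHom_list_sum, emb, Word.splits3_map, List.map_map, necklace]
  refine sum_map_congr_smul _ _ _ _ ?_
  intro s hs
  have hp := Word.append_of_mem_splits3 p s hs
  obtain ⟨u, v, q⟩ := s
  dsimp only at hp
  subst hp
  rw [Function.comp_apply, map_zsmul_unit mixFst]
  have h := mixFst_stasheff_term hM u v q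
  dsimp only at h ⊢
  refine Eq.trans ?_ (h.trans ?_)
  · rw [← wdeg_emb, ← wdeg_emb]
    rfl
  · congr 2
    cases fsplit v <;> rfl

theorem mixSnd_stasheffSum_emb_of_fnum_eq_zero {x y : A.Obj} {p : PWord A d x y}
    (hp : fnum p = 0) : mixSnd ((doubleOp hM).stasheffSum (emb p)) = 0 := by
  rw [Op.stasheffSum, totHom_list_sum, emb, Word.splits3_map, List.map_map]
  refine sum_map_eq_zero _ _ fun s hs => ?_
  have h := Word.append_of_mem_splits3 p s hs
  obtain ⟨u, v, q⟩ := s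
  dsimp only at h
  subst h
  rw [fnum_append_eq_zero, fnum_append_eq_zero] at hp
  obtain ⟨hu, hv, hq⟩ := hp
  have h₁ : (bdry A d).letter (pdeg v + 2) (doubleOp hM _ _ (emb v)) =
      pureLetter (.inl (A.letter (pdeg v + 2) (opA d M v))) := by
    refine Sigma.ext rfl (heq_of_eq (Prod.ext ?_ (LinearMap.ext fun b => ?_)))
    · rw [← mixFst_doubleOp_emb hM]
      exact fst_comp (pdeg v + 2) (doubleOp hM _ _ (emb v))
    · refine (snd_comp (pdeg v + 2) (doubleOp hM _ _ (emb v)) b).trans ?_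
      rw [mixSnd_doubleOp_emb, ev_opD_of_fnum_eq_zero hM hv]
      rfl
  rw [Function.comp_apply, map_zsmul_unit mixSnd]
  have h₂ : mixSnd (doubleOp hM x y ((emb u).append (.cons
      ((bdry A d).letter ((mix A A (fun x => x) d).wdeg (emb v) + 2) (doubleOp hM _ _ (emb v)))
        (emb q)))) = 0 := by
    rw [wdeg_emb, h₁, ← emb_cons, ← emb_append, mixSnd_doubleOp_emb, ev_opD_of_fnum_eq_zero hM]
    simp [hu, hq]
  exact (congrArg _ h₂).trans (smul_zero _)

/-- The vanishing of the pairing of a Stasheff sum with a letter is invariant under rotation. -/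
theorem doubleForm_rotate {x y z : A.Obj} (p : PWord A d x y)
    (b : PLetter A A (fun x => x) d y z) (c : PLetter A A (fun x => x) d z x)
    (h : (doubleForm A d).val x z ((doubleOp hM).stasheffSum (emb (p.append (.single b))))
      ((bdry A d).incl (pureLetter c).1 (pureLetter c).2) = 0) :
    (doubleForm A d).val z y ((doubleOp hM).stasheffSum (emb (.cons c p)))
      ((bdry A d).incl (pureLetter b).1 (pureLetter b).2) = 0 := by
  have h' := form_stasheffSum_rotate (doubleOp_nil hM) (fun p j => doubleOp_degree hM p j)
    (doubleOp_isMultilinear hM) (doubleOp_almostCyclic hM)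
    (fun a b => mixForm_antisymm (QuiverHom.id A) a b) (emb p) (pureLetter b) (pureLetter c)
  rw [emb_append] at h
  exact (smul_eq_zero_iff_eq _).1 (h'.symm.trans h)

section PreCalabiYau

variable (hX : IsPreCY d M)

theorem mixFst_stasheffSum_emb_eq_zero {x y : A.Obj} (p : PWord A d x y) :
    mixFst ((doubleOp hX.multi).stasheffSum (emb p)) = 0 := by
  rw [mixFst_stasheffSum_emb, hX.maurerCartan, smul_zero]

/-- If a word contains a linear form, the cyclic invariance moves it to the last argument of the
bilinear form, where it is paired with the component to `A` of the Stasheff sum. -/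
theorem doubleForm_stasheffSum_emb_append {x y z : A.Obj} (p : PWord A d x y) (hp : fnum p ≠ 0)
    (q : PWord A d y z) (c : PLetter A A (fun x => x) d z x) :
    (doubleForm A d).val x z ((doubleOp hX.multi).stasheffSum (emb (p.append q)))
      ((bdry A d).incl (pureLetter c).1 (pureLetter c).2) = 0 := by
  induction p generalizing z with
  | nil x => exact absurd rfl hp
  | cons a p ih =>
    refine doubleForm_rotate hX.multi (p.append q) c a ?_
    rw [Word.append_assoc]
    rcases a with a | f
    · rw [fnum_cons_inl] at hp
      exact ih hp (q.append (.single c)) (.inl a)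
    · rw [doubleForm_inr, mixFst_stasheffSum_emb_eq_zero hX, map_zero, smul_zero]

theorem stasheffSum_emb_eq_zero {x y : A.Obj} (p : PWord A d x y) :
    (doubleOp hX.multi).stasheffSum (emb p) = 0 := by
  refine mix_eq_zero (mixFst_stasheffSum_emb_eq_zero hX p) ?_
  by_cases hp : fnum p = 0
  · exact mixSnd_stasheffSum_emb_of_fnum_eq_zero hX.multi hp
  · refine tot_hom_ext fun j b => ?_
    have h := doubleForm_stasheffSum_emb_append hX p hp (.nil y) (.inl ⟨j, b⟩)
    rw [Word.append_nil, doubleForm_inl] at h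
    exact (smul_eq_zero_iff_eq _).1 h

theorem doubleOp_isAInf : IsAInf (doubleOp hX.multi) where
  uncurved := doubleOp_nil hX.multi
  degree p j := doubleOp_degree hX.multi p j
  linear p q j := doubleOp_isMultilinear hX.multi p q j
  stasheff p := by
    refine emb_induction (P := fun p => (doubleOp hX.multi).stasheffSum p = 0)
      (stasheffSum_emb_eq_zero hX) (fun p q j a b ha hb => ?_) p
    have h : (doubleOp hX.multi).IsMultilinear := doubleOp_isMultilinear hX.multi
    dsimp only at ha hb ⊢
    rw [(h.stasheffSum p q j).map_add, ha, hb, add_zero]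

theorem doubleOp_isCyclicAInf (hA : A.HomFinite) :
    IsCyclicAInf (doubleOp hX.multi) (doubleForm A d) where
  isAInf := doubleOp_isAInf hX
  almostCyclic := doubleOp_almostCyclic hX.multi
  nondegenerate := mixForm_id_nondegenerate hA

end PreCalabiYau

end DoubleStasheff

/-! ### Strict morphisms and the operations on mixed quivers -/

section Strict

variable {A B : GradedQuiver.{w} k} {d : ℤ}

/-- The words `(id ⊕ Φ^*) p` and `(Φ ⊕ id) p` are cut into blocks at the same places, and the
contraction of `Φ ⊗ … ⊗ Φ ⊗ h` with the linear forms in `p` is that of `id ⊗ … ⊗ id ⊗ h` with their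
pullbacks. -/
theorem parse_pull_push (Φ : QuiverHom A B) {x y : A.Obj} (p : MWord A B Φ.obj d x y) :
    ∃ (S : Shape A.Obj x y) (I : S.Inputs A) (G : S.Forms A d) (F : (S.map Φ.obj).Forms B d),
      parse (Φ.pull p) = ⟨S, I, G⟩ ∧ parse (Φ.push p) = ⟨S.map Φ.obj, Φ.inputs S I, F⟩ ∧
        ∀ {V W : ModuleCat.{u} k} (h : V →ₗ[k] W) (o : S.Out A V),
          (S.map Φ.obj).contract B d W F (Φ.out S h o) = h (S.contract A d V G o) := by
  induction p with
  | nil x => exact ⟨.one x x, .nil x, PUnit.unit, PUnit.unit, rfl, rfl, fun h o => rfl⟩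
  | @cons x x' y a p ih =>
    obtain ⟨S, I, G, F, h₁, h₂, h₃⟩ := ih
    rcases a with a | f
    · cases S with
      | one _ _ =>
        refine ⟨.one x y, Word.cons a I, G, F, ?_, ?_, h₃⟩
        · exact congrArg (fun b : Blocks A d x' y => Blocks.consA a b.1 b.2.1 b.2.2) h₁
        · exact congrArg (fun b : Blocks B d (Φ.obj x') (Φ.obj y) =>
            Blocks.consA (Φ.letter a) b.1 b.2.1 b.2.2) h₂
      | step _ s S =>
        refine ⟨.step x s S, (Word.cons a I.1, I.2), G, F, ?_, ?_, h₃⟩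
        · exact congrArg (fun b : Blocks A d x' y => Blocks.consA a b.1 b.2.1 b.2.2) h₁
        · exact congrArg (fun b : Blocks B d (Φ.obj x') (Φ.obj y) =>
            Blocks.consA (Φ.letter a) b.1 b.2.1 b.2.2) h₂
    · refine ⟨.step x x S, ((.nil x : Word A.Letter x x), I), (Φ.dual f, G), (f, F), ?_, ?_, ?_⟩
      · exact congrArg (Blocks.consF (Φ.dual f)) h₁
      · exact congrArg (Blocks.consF f) h₂
      · intro V W h o
        have key : (Shape.contract B d ((Shape.step x x S).map Φ.obj) W (f, F)) ∘ₗ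
            Φ.out (Shape.step x x S) h =
            h ∘ₗ Shape.contract A d (Shape.step x x S) V (Φ.dual f, G) := by
          refine TensorProduct.ext' fun o v => ?_
          have e := h₃ (V := ModuleCat.of k (A.Tot x' x))
            (W := ModuleCat.of k (B.Tot (Φ.obj x') (Φ.obj x))) (Φ.tot x' x) o
          refine Eq.trans (congrArg (fun t : B.Tot (Φ.obj x') (Φ.obj x) => B.ev f t • h v) e) ?_
          exact (map_smul h (A.ev (Φ.dual f)
            (S.contract A d (ModuleCat.of k (A.Tot x' x)) G o)) v).symm
        exact LinearMap.congr_fun key o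

section

variable {X Y : SpCY.{w} k d} (Φ : X ⟶ Y)

/-- The compatibility of a strict morphism with the multilinear maps, after contraction with
linear forms. -/
theorem tot_pair_pull {x y : X.quiver.Obj}
    (p : MWord X.quiver Y.quiver Φ.hom.obj d x y) :
    Φ.hom.tot x y (MultiOp.pair X.M (Φ.hom.pull p)) = MultiOp.pair Y.M (Φ.hom.push p) := by
  obtain ⟨S, I, G, F, h₁, h₂, h₃⟩ := parse_pull_push Φ.hom p
  rw [MultiOp.pair, MultiOp.pair, h₁, h₂]
  rw [← Φ.comm S I]
  exact (h₃ (V := ModuleCat.of k (X.quiver.Tot x y))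
    (W := ModuleCat.of k (Y.quiver.Tot (Φ.hom.obj x) (Φ.hom.obj y))) (Φ.hom.tot x y) _).symm

theorem QuiverHom.pull_eq_map {A B : GradedQuiver.{w} k} (Φ : QuiverHom A B) {x y : A.Obj}
    (p : MWord A B Φ.obj d x y) :
    Φ.pull p = p.map (fun x => x) (pureMap (g' := fun x => x) (fun _ _ _ => LinearMap.id)
      fun x y j => LinearMap.lcomp k k (Φ.map y x (-(j + d - 1)))) := rfl

theorem QuiverHom.push_eq_map {A B : GradedQuiver.{w} k} (Φ : QuiverHom A B) {x y : A.Obj}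
    (p : MWord A B Φ.obj d x y) :
    Φ.push p = p.map Φ.obj (pureMap (g' := fun x => x) Φ.map fun _ _ _ => LinearMap.id) := rfl

theorem tot_opA_pull {x y : X.quiver.Obj} (p : MWord X.quiver Y.quiver Φ.hom.obj d x y) :
    Φ.hom.tot x y (opA d X.M (Φ.hom.pull p)) = opA d Y.M (Φ.hom.push p) := by
  rw [opA, opA, map_zsmul_unit, tot_pair_pull, QuiverHom.pull_eq_map, QuiverHom.push_eq_map,
    signExp_map, signExp_map]

theorem pull_append {A B : GradedQuiver.{w} k} (Φ : QuiverHom A B) {x y z : A.Obj}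
    (p : MWord A B Φ.obj d x y) (q : MWord A B Φ.obj d y z) :
    Φ.pull (p.append q) = (Φ.pull p).append (Φ.pull q) := Word.map_append _ _ _ _

theorem push_append {A B : GradedQuiver.{w} k} (Φ : QuiverHom A B) {x y z : A.Obj}
    (p : MWord A B Φ.obj d x y) (q : MWord A B Φ.obj d y z) :
    Φ.push (p.append q) = (Φ.push p).append (Φ.push q) := Word.map_append _ _ _ _

/-- Restriction of linear forms along `Φ` maps the component to `B^*[d-1]` of the operations of `B`
to the component to `A^*[d-1]` of those of `A`. -/
theorem dual_opD_push {x y : X.quiver.Obj} (p : MWord X.quiver Y.quiver Φ.hom.obj d x y) :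
    Φ.hom.dual (opD Y.isPreCY.multi (Φ.hom.push p)) = opD X.isPreCY.multi (Φ.hom.pull p) := by
  refine dletter_ext ?_ ?_
  · change pdeg (Φ.hom.push p) + 2 = pdeg (Φ.hom.pull p) + 2
    rw [QuiverHom.pull_eq_map, QuiverHom.push_eq_map, pdeg_map, pdeg_map]
  · rw [ev_dual]
    by_cases hp : fnum p = 0
    · rw [ev_opD_of_fnum_eq_zero, ev_opD_of_fnum_eq_zero, LinearMap.zero_comp]
      · rw [QuiverHom.pull_eq_map, fnum_map, hp]
      · rw [QuiverHom.push_eq_map, fnum_map, hp]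
    · obtain ⟨z, t, l, f, r, hl, rfl⟩ := exists_eq_append_cons_inr hp
      refine tot_hom_ext fun j b => ?_
      have h₁ : fnum (Φ.hom.pull l) = 0 := by rw [QuiverHom.pull_eq_map, fnum_map, hl]
      have h₂ : fnum (Φ.hom.push l) = 0 := by rw [QuiverHom.push_eq_map, fnum_map, hl]
      have e₁ := ev_opD X.isPreCY.multi h₁ (Φ.hom.dual f) (Φ.hom.pull r) b
      have e₂ := ev_opD Y.isPreCY.multi h₂ f (Φ.hom.push r) (Φ.hom.map _ _ j b)
      have e₃ := tot_pair_pull Φ (r.append (.cons (.inl ⟨j, b⟩) l))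
      have hs : dualSign (Φ.hom.pull l) (Φ.hom.dual f) (Φ.hom.pull r) j =
          dualSign (Φ.hom.push l) f (Φ.hom.push r) j := by
        simp only [dualSign, QuiverHom.pull_eq_map, QuiverHom.push_eq_map, pdeg_map, adeg_map,
          signExp_map, rightDeg_map]
        rfl
      rw [LinearMap.comp_apply, tot_incl, pull_append, push_append]
      refine e₂.trans (Eq.trans ?_ e₁.symm)
      rw [hs, ev_dual, LinearMap.comp_apply]
      refine congrArg _ (congrArg _ ?_)
      rw [pull_append, push_append] at e₃
      exact e₃.symm

end

end Strict

/-! ### Strict hat morphisms -/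

theorem Word.map_congr {O : Type w} {L : O → O → Type u} {O' : Type w₁} {L' : O' → O' → Type u}
    (g : O → O') {φ ψ : ∀ {x y : O}, L x y → L' (g x) (g y)}
    (h : ∀ {x y : O} (a : L x y), φ a = ψ a) {x y : O} (p : Word L x y) :
    p.map g φ = p.map g ψ := by
  induction p with
  | nil x => rfl
  | cons a p ih => simp only [Word.map, h, ih]

theorem totMap_id {Q : GradedQuiver.{w} k} {x y : Q.Obj} (a : Q.Tot x y) :
    totMap (R := Q) (F₀ := fun x => x) (fun _ _ _ => LinearMap.id) x y a = a :=
  tot_ext fun _ => rfl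

section Hat

variable {A B C : GradedQuiver.{w} k} {d : ℤ}

/-- The linear part `id ⊕ Φ^*` of `φ_A`. -/
def pullMap (Φ : QuiverHom A B) (d : ℤ) : HomMap (mix A B Φ.obj d) (bdry A d) (fun x => x) :=
  mixMap (g' := fun x => x) (fun _ _ _ => LinearMap.id)
    fun x y j => LinearMap.lcomp k k (Φ.map y x (-(j + d - 1)))

/-- The linear part `Φ ⊕ id` of `φ_B`. -/
def pushMap (Φ : QuiverHom A B) (d : ℤ) : HomMap (mix A B Φ.obj d) (bdry B d) Φ.obj :=
  mixMap (g' := fun x => x) Φ.map fun _ _ _ => LinearMap.id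

theorem pull_push_jointly_injective (Φ : QuiverHom A B) {x y : A.Obj} {j : ℤ}
    (a : (mix A B Φ.obj d).hom x y j) (h₁ : pullMap Φ d x y j a = 0)
    (h₂ : pushMap Φ d x y j a = 0) : a = 0 :=
  Prod.ext (congrArg Prod.fst h₁ :) (congrArg Prod.snd h₂ :)

theorem mixForm_pullMap (Φ : QuiverHom A B) {x y : A.Obj} (a : (mix A B Φ.obj d).Tot x y)
    (b : (mix A B Φ.obj d).Tot y x) :
    (mixForm (QuiverHom.id A) d).val _ _ (totMap (pullMap Φ d) x y a)
      (totMap (pullMap Φ d) y x b) = (mixForm Φ d).val x y a b := by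
  refine mixForm_isometry Φ (QuiverHom.id A) (pullMap Φ d) (fun {x y i j} a b => ?_) a b
  rw [mixPair_apply, mixPair_apply, ← tot_incl, ← tot_incl, QuiverHom.tot_id]
  rfl

theorem mixForm_pushMap (Φ : QuiverHom A B) {x y : A.Obj} (a : (mix A B Φ.obj d).Tot x y)
    (b : (mix A B Φ.obj d).Tot y x) :
    (mixForm (QuiverHom.id B) d).val _ _ (totMap (pushMap Φ d) x y a)
      (totMap (pushMap Φ d) y x b) = (mixForm Φ d).val x y a b := by
  refine mixForm_isometry Φ (QuiverHom.id B) (pushMap Φ d) (fun {x y i j} a b => ?_) a b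
  rw [mixPair_apply, mixPair_apply, ← tot_incl, QuiverHom.tot_id]
  rfl

variable {X Y Z : SpCY.{w} k d} (Φ : X ⟶ Y) (Ψ : Y ⟶ Z)

theorem bdryOp_isCyclicAInf (X : SpCY.{w} k d) :
    IsCyclicAInf (bdryOp X) (mixForm (QuiverHom.id X.quiver) d) :=
  doubleOp_isCyclicAInf X.isPreCY X.homFinite

theorem pullMap_mixedOp {x y : X.quiver.Obj}
    (p : Word (mix X.quiver Y.quiver Φ.hom.obj d).Letter x y) :
    totMap (pullMap Φ.hom d) x y (mixedOp Φ x y p) =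
      bdryOp X x y (p.map (fun x => x) (letterMap (pullMap Φ.hom d))) :=
  totMap_mixOp _ _ _ _ _ _ (fun _ => totMap_id _) (fun q => dual_opD_push Φ q) p

theorem pushMap_mixedOp {x y : X.quiver.Obj}
    (p : Word (mix X.quiver Y.quiver Φ.hom.obj d).Letter x y) :
    totMap (pushMap Φ.hom d) x y (mixedOp Φ x y p) =
      bdryOp Y _ _ (p.map Φ.hom.obj (letterMap (pushMap Φ.hom d))) :=
  totMap_mixOp _ _ _ _ _ _ (fun q => tot_opA_pull Φ q) (fun _ => rfl) p

theorem mixedOp_isAInf : IsAInf (mixedOp Φ) :=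
  IsAInf.of_jointly_injective (pullMap Φ.hom d) (pushMap Φ.hom d) (bdryOp_isCyclicAInf X).isAInf
    (bdryOp_isCyclicAInf Y).isAInf (pullMap_mixedOp Φ) (pushMap_mixedOp Φ)
    fun a h₁ h₂ => pull_push_jointly_injective Φ.hom a h₁ h₂

theorem mixedOp_isStrictCyclicHat :
    IsStrictCyclicHat (bdryOp X) (mixForm (QuiverHom.id X.quiver) d)
      (bdryOp Y) (mixForm (QuiverHom.id Y.quiver) d)
      (mixedOp Φ) (mixForm Φ.hom d) (phiA Φ.hom d) (phiB Φ.hom d) where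
  isAInf := mixedOp_isAInf Φ
  almostCyclic := AlmostCyclic.of_isometry (pullMap Φ.hom d) (bdryOp_isCyclicAInf X).almostCyclic
    (pullMap_mixedOp Φ) (mixForm_pullMap Φ.hom)
  morA := isAInfMor_ofLinear (pullMap Φ.hom d) (mixedOp_isAInf Φ) (bdryOp_isCyclicAInf X).isAInf
    (pullMap_mixedOp Φ)
  strictA := ofLinear_isStrict (pullMap Φ.hom d)
  cyclicA := ofLinear_isCyclic (pullMap Φ.hom d) (mixForm_pullMap Φ.hom)
  morB := isAInfMor_ofLinear (pushMap Φ.hom d) (mixedOp_isAInf Φ) (bdryOp_isCyclicAInf Y).isAInf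
    (pushMap_mixedOp Φ)
  strictB := ofLinear_isStrict (pushMap Φ.hom d)
  cyclicB := ofLinear_isCyclic (pushMap Φ.hom d) (mixForm_pushMap Φ.hom)

/-! ### Composition of strict hat morphisms -/

/-- The map `id ⊕ Ψ^*` from `A ⊕ C^*[d-1]` to `A ⊕ B^*[d-1]`. -/
def compPullMap (Φ : QuiverHom A B) (Ψ : QuiverHom B C) (d : ℤ) :
    HomMap (mix A C (Φ.comp Ψ).obj d) (mix A B Φ.obj d) (fun x => x) :=
  mixMap (fun _ _ _ => LinearMap.id)
    fun x y j => LinearMap.lcomp k k (Ψ.map (Φ.obj y) (Φ.obj x) (-(j + d - 1)))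

/-- The map `Φ ⊕ id` from `A ⊕ C^*[d-1]` to `B ⊕ C^*[d-1]`. -/
def compPushMap (Φ : QuiverHom A B) (Ψ : QuiverHom B C) (d : ℤ) :
    HomMap (mix A C (Φ.comp Ψ).obj d) (mix B C Ψ.obj d) Φ.obj :=
  mixMap (g := (Φ.comp Ψ).obj) (g' := Ψ.obj) Φ.map fun _ _ _ => LinearMap.id

/-- The map `id ⊕ Ψ^*` on words. -/
def compPull (Φ : QuiverHom A B) (Ψ : QuiverHom B C) {x y : A.Obj}
    (p : MWord A C (Φ.comp Ψ).obj d x y) : MWord A B Φ.obj d x y :=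
  p.map (fun x => x) (pureMap (fun _ _ _ => LinearMap.id)
    fun x y j => LinearMap.lcomp k k (Ψ.map (Φ.obj y) (Φ.obj x) (-(j + d - 1))))

/-- The map `Φ ⊕ id` on words. -/
def compPush (Φ : QuiverHom A B) (Ψ : QuiverHom B C) {x y : A.Obj}
    (p : MWord A C (Φ.comp Ψ).obj d x y) : MWord B C Ψ.obj d (Φ.obj x) (Φ.obj y) :=
  p.map Φ.obj (pureMap (g := (Φ.comp Ψ).obj) (g' := Ψ.obj) Φ.map fun _ _ _ => LinearMap.id)

section Words

variable (Φ : QuiverHom A B) (Ψ : QuiverHom B C) {x y : A.Obj}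
  (p : MWord A C (Φ.comp Ψ).obj d x y)

theorem pull_compPull : Φ.pull (compPull Φ Ψ p) = (Φ.comp Ψ).pull p :=
  (Word.map_map _ _ _ _ p).trans (Word.map_congr _ (fun a => by cases a <;> rfl) p)

theorem push_compPush : Ψ.push (compPush Φ Ψ p) = (Φ.comp Ψ).push p :=
  (Word.map_map _ _ _ _ p).trans (Word.map_congr _ (fun a => by cases a <;> rfl) p)

/-- In both words the letters in `A` are mapped by `Φ` and the linear forms are restricted along
`Ψ`. -/
theorem pull_compPush : Ψ.pull (compPush Φ Ψ p) = Φ.push (compPull Φ Ψ p) :=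
  (Word.map_map _ _ _ _ p).trans ((Word.map_congr _ (fun a => by cases a <;> rfl) p).trans
    (Word.map_map _ _ _ _ p).symm)

end Words

/-- The map `χ_A` commutes with the operations. -/
theorem compPullMap_mixedOp {x y : X.quiver.Obj}
    (p : Word (mix X.quiver Z.quiver (Φ ≫ Ψ).hom.obj d).Letter x y) :
    totMap (compPullMap Φ.hom Ψ.hom d) x y (mixedOp (Φ ≫ Ψ) x y p) =
      mixedOp Φ x y (p.map (fun x => x) (letterMap (compPullMap Φ.hom Ψ.hom d))) := by
  refine totMap_mixOp _ _ _ _ _ _ (fun q => (totMap_id _).trans ?_) (fun q => ?_) p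
  · exact congrArg (opA d X.M) (pull_compPull Φ.hom Ψ.hom q).symm
  · have h := dual_opD_push Ψ (compPush Φ.hom Ψ.hom q)
    rw [push_compPush, pull_compPush] at h
    exact h

/-- The map `χ_C` commutes with the operations. -/
theorem compPushMap_mixedOp {x y : X.quiver.Obj}
    (p : Word (mix X.quiver Z.quiver (Φ ≫ Ψ).hom.obj d).Letter x y) :
    totMap (compPushMap Φ.hom Ψ.hom d) x y (mixedOp (Φ ≫ Ψ) x y p) =
      mixedOp Ψ _ _ (p.map Φ.hom.obj (letterMap (compPushMap Φ.hom Ψ.hom d))) := by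
  refine totMap_mixOp _ _ _ _ _ _ (fun q => ?_) (fun q => ?_) p
  · have h := tot_opA_pull Φ (compPull Φ.hom Ψ.hom q)
    rw [pull_compPull, ← pull_compPush] at h
    exact h
  · exact congrArg (opD Z.isPreCY.multi) (push_compPush Φ.hom Ψ.hom q).symm

end Hat

end PreCY

end

/-- There is a functor of partial categories from the category of `Hom`-finite
`d`-pre-Calabi-Yau categories and strict morphisms to the partial category of cyclic
`A∞`-categories `A ⊕ A^*[d-1]` and strict cyclic hat morphisms, with the values described in
the statement. That these values are objects and morphisms of the target is part of the claim. -/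
theorem mainTheorem2 {k : Type u} [Field k] [CharZero k] (d : ℤ) :
    ∃ (hobj : ∀ X : SpCY.{w} k d,
        IsCyclicAInf (bdryOp X) (mixForm (QuiverHom.id X.quiver) d))
      (hmap : ∀ (X Y : SpCY.{w} k d) (Φ : X ⟶ Y),
        IsStrictCyclicHat (bdryOp X) (mixForm (QuiverHom.id X.quiver) d)
          (bdryOp Y) (mixForm (QuiverHom.id Y.quiver) d)
          (mixedOp Φ) (mixForm Φ.hom d) (phiA Φ.hom d) (phiB Φ.hom d))
      (F : PartialFunctor (SpCY.{w} k d) (Scyc.{w} k d)),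
      F.toPrefunctor =
        { obj := fun X => ⟨X.quiver, bdryOp X, mixForm (QuiverHom.id X.quiver) d, hobj X⟩
          map := fun {X Y} Φ => ⟨Φ.hom.obj, mixedOp Φ, mixForm Φ.hom d, phiA Φ.hom d,
            phiB Φ.hom d, hmap X Y Φ⟩ } := by
  refine ⟨bdryOp_isCyclicAInf, fun X Y Φ => mixedOp_isStrictCyclicHat Φ,
    { obj := fun X => ⟨X.quiver, bdryOp X, mixForm (QuiverHom.id X.quiver) d,
        bdryOp_isCyclicAInf X⟩
      map := fun {X Y} Φ => ⟨Φ.hom.obj, mixedOp Φ, mixForm Φ.hom d, phiA Φ.hom d, phiB Φ.hom d,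
        mixedOp_isStrictCyclicHat Φ⟩
      map_comp := ?_ }, rfl⟩
  intro X Y Z Φ Ψ _ h
  obtain rfl : Φ ≫ Ψ = _ := h
  refine ⟨rfl, MorOp.ofLinear (compPullMap Φ.hom Ψ.hom d),
    MorOp.ofLinear (compPushMap Φ.hom Ψ.hom d), ?_, ?_, ?_, ?_, ?_⟩
  · exact isAInfMor_ofLinear _ (mixedOp_isAInf _) (mixedOp_isAInf Φ) (compPullMap_mixedOp Φ Ψ)
  · exact isAInfMor_ofLinear _ (mixedOp_isAInf _) (mixedOp_isAInf Ψ) (compPushMap_mixedOp Φ Ψ)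
  · exact (comp_ofLinear (compPullMap Φ.hom Ψ.hom d) (pushMap Φ.hom d)).trans
      (comp_ofLinear (compPushMap Φ.hom Ψ.hom d) (pullMap Ψ.hom d)).symm
  · exact (comp_ofLinear (compPullMap Φ.hom Ψ.hom d) (pullMap Φ.hom d)).symm
  · exact (comp_ofLinear (compPushMap Φ.hom Ψ.hom d) (pushMap Ψ.hom d)).symm
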